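/- Let $\Omega=\{y\in[0,1]^{\mathbb N_+}:\sum_i y_i=1,\ y_1\ge y_2\ge\cdots\}$. Let $PD(1)$ be the law on $\Omega$ of the nonincreasing rearrangement of $(x_j)_{j\ge1}$, where $x_j=U_j\bigl(1-\sum_{i<j}x_i\bigr)$ and $U_1,U_2,\dots$ are i.i.d. uniform on $[0,1]$. For $(Y,Z)\in\Omega^2$ call the entry $Y_i$ matched (with respect to $Z$) if $|\{j:Z_j=Y_i\}|\ge|\{j\le i:Y_j=Y_i\}|$; let $I(Y,Z)$ be the set of indices $i$ of matched entries, and let $Q=\sum_{i\in I(Y,Z)}Y_i$. Let $\tilde Y=(\tilde Y_i)$ be the tiling of $[0,1]$ by intervals of lengths $Y_i$ in which the intervals with $i\notin I(Y,Z)$ tile $[0,1-Q]$ and those with $i\in I(Y,Z)$ tile $[1-Q,1]$, each class placed from left to right in increasing order of the indices. Define $\tilde Z$ in the same way with the roles of $Y$ and $Z$ exchanged. The coupling kernel $\tilde M$ moves $(Y,Z)$ to $(Y',Z')$ as follows. Let $u,v$ be independent uniform random variables in $[0,1]$. Let $a$ be the index with $u\in\tilde Y_a$. Let $\hat Y$ be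 the tiling obtained from $\tilde Y$ by shifting $\tilde Y_a$ to the beginning of $[0,1]$ (keeping the order of the other intervals), and let $b$ be the index with $v\in\hat Y_b$. If $a\ne b$, $Y'$ is obtained from $Y$ by replacing the two entries $Y_a,Y_b$ by the single entry $Y_a+Y_b$ and resorting in nonincreasing order; if $a=b$, $Y'$ is obtained by replacing $Y_a$ by the two entries $v$ and $Y_a-v$ and resorting. $Z'$ is obtained from $Z$ by the same rule, using $\tilde Z$ and the same $u,v$. Theorem. There is an absolute constant $C>0$ such that the following holds. Let $Y^0$ and $Z^0$ be independent random samples from $PD(1)$, and let $(Y^t,Z^t)_{t\ge0}$ be the Markov chain with transition kernel $\tilde M$ started at $(Y^0,Z^0)$. Let $y_1^t$ be the size of the largest unmatched entry of $Y^t$ (with respect to $Z^t$), and $z_1^t$ the size of the largest unmatched entry of $Z^t$ (with respect to $Y^t$), each set to $0$ if all entries are matched. Let $t_0\ge2$ be an integer, and let $q$ be uniformly distributed in $\{0,1,\dots,t_0-1\}$ and independent of the chain $(Y^t,Z^t)_{t\ge0}$. Then for every $\rho>0$, $$ \mathbf P\bigl[\max\{y_1^q,z_1^q\}>\rho\bigr]\le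 C\,\rho^{-1}\,(\log t_0)^{-1}. $$ -/

import Mathlib

open MeasureTheory ProbabilityTheory

noncomputable section

namespace CoagFrag

/-- Configurations. Entries are indexed from `0`. The configurations of interest are those in the
simplex `{y : ℕ → ℝ | y nonincreasing, y ≥ 0, ∑ y i = 1}`, taken inside the ambient space `ℕ → ℝ`
(product σ-algebra): `PD1` is concentrated on the simplex and the coupling below, started in it,
stays in it almost surely. -/
abbrev Config : Type := ℕ → ℝ

/-- Sorting in nonincreasing order: the entry of index `n` is the `(n+1)`-st largest value of `x`,
that is the largest `s` such that at least `n + 1` indices carry a value `≥ s`.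
(Meant for nonnegative summable `x`; superfluous zero entries are dropped.) -/
def sortDesc (x : Config) : Config := fun n =>
  ⨆ F : {F : Finset ℕ // F.card = n + 1}, ⨅ i : F.1, x i

/-- The uniform distribution on `[0,1]`. -/
def unif : Measure ℝ := volume.restrict (Set.Icc 0 1)

instance : IsProbabilityMeasure unif := ⟨by simp [unif]⟩

/-- Stick breaking: `x_j = U_j (1 - ∑_{i<j} x_i)`. -/
def stick (U : ℕ → ℝ) (j : ℕ) : ℝ := U j * (1 - ∑ i : Fin j, stick U i)
termination_by j
decreasing_by exact i.2

/-- The Poisson-Dirichlet distribution with parameter `1`: the law of the sorted stick breaking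
sequence of i.i.d. uniform variables. -/
def PD1 : Measure Config :=
  (Measure.infinitePi (fun _ : ℕ => unif)).map (fun U => sortDesc (stick U))

/-- `I(Y,Z)`: the indices of the entries of `Y` matched by entries of `Z`. With
`k = #{j ≤ i : Y_j = Y_i}`, the entry `Y_i` is matched (to the `k`-th entry of `Z` of
the same value) iff `Z` has at least `k` entries equal to `Y_i`. -/
def matched (Y Z : Config) : Set ℕ :=
  {i | {j | j ≤ i ∧ Y j = Y i}.encard ≤ {j | Z j = Y i}.encard}

open Classical in
/-- `Q(Y,Z)`: the sum of the matched entries. -/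
def matchedSum (Y Z : Config) : ℝ := ∑' i, if i ∈ matched Y Z then Y i else 0

open Classical in
/-- Left endpoint of the interval `Ỹ_i`, of length `Y_i`. The matched intervals tile `[1-Q,1]`, the
unmatched ones tile `[0,1-Q]`, each class in the order of the indices. -/
def tileLeft (Y Z : Config) (i : ℕ) : ℝ :=
  if i ∈ matched Y Z then
    1 - matchedSum Y Z + ∑ j ∈ Finset.range i, if j ∈ matched Y Z then Y j else 0
  else ∑ j ∈ Finset.range i, if j ∈ matched Y Z then 0 else Y j

/-- Index of the interval that contains `x`, where the interval of index `i` has left endpoint `L i`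
and length `Y i`. (Intervals are taken half-open; this only matters for countably many `x`.) -/
def tileAt (L Y : Config) (x : ℝ) : ℕ := sInf {i | L i ≤ x ∧ x < L i + Y i}

open Classical in
/-- Left endpoint of `Ŷ_i`: the tiling `Ỹ` with the interval of index `a` shifted to the
beginning. -/
def hatLeft (Y Z : Config) (a i : ℕ) : ℝ :=
  if i = a then 0
  else if tileLeft Y Z i + Y i ≤ tileLeft Y Z a then Y a + tileLeft Y Z i
  else tileLeft Y Z i

/-- Replace the two entries `Y_a`, `Y_b` (`a ≠ b`) by the single entry `Y_a + Y_b`, and resort. -/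
def merge (Y : Config) (a b : ℕ) : Config :=
  sortDesc (fun i => if i = a then Y a + Y b else if i = b then 0 else Y i)

/-- Replace the entry `Y_a` by the two entries `v` and `Y_a - v`, and resort. -/
def split (Y : Config) (a : ℕ) (v : ℝ) : Config :=
  sortDesc (fun i => match i with
    | 0 => v
    | i + 1 => if i = a then Y a - v else Y i)

/-- The index `a` selected by `u` in the tiling `Ỹ`. -/
def firstIdx (Y Z : Config) (u : ℝ) : ℕ := tileAt (tileLeft Y Z) Y u

/-- The index `b` selected by `v` in the tiling `Ŷ`. -/
def secondIdx (Y Z : Config) (u v : ℝ) : ℕ := tileAt (hatLeft Y Z (firstIdx Y Z u)) Y v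

/-- The new configuration `Y'`. -/
def stepOne (Y Z : Config) (u v : ℝ) : Config :=
  if firstIdx Y Z u = secondIdx Y Z u v then split Y (firstIdx Y Z u) v
  else merge Y (firstIdx Y Z u) (secondIdx Y Z u v)

/-- The pair `(Y', Z')`, both made with the same `u` and `v`. -/
def coupledStep (p : Config × Config) (w : ℝ × ℝ) : Config × Config :=
  (stepOne p.1 p.2 w.1 w.2, stepOne p.2 p.1 w.1 w.2)

/-- The size of the largest unmatched entry of `Y` (`0` if all entries are matched). -/
def largestUnmatched (Y Z : Config) : ℝ := sSup (Y '' (matched Y Z)ᶜ)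

/-! Measurability of the coupled step. -/

section Measurability

variable {α : Type*} [MeasurableSpace α]

lemma measurable_sortDesc : Measurable sortDesc :=
  measurable_pi_lambda _ fun _ => Measurable.iSup fun _ => Measurable.iInf fun _ =>
    measurable_pi_apply _

lemma measurable_stick (j : ℕ) : Measurable (fun U : ℕ → ℝ => stick U j) := by
  induction j using Nat.strong_induction_on with
  | _ j ih =>
    have h : (fun U : ℕ → ℝ => stick U j)
        = fun U => U j * (1 - ∑ i : Fin j, stick U i) := by
      funext U
      rw [stick]
    rw [h]
    exact (measurable_pi_apply j).mul
      (measurable_const.sub (Finset.measurable_sum _ fun i _ => ih i i.2))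

instance : IsProbabilityMeasure PD1 :=
  Measure.isProbabilityMeasure_map
    (measurable_sortDesc.comp (measurable_pi_lambda _ measurable_stick)).aemeasurable

lemma mem_matched_iff (Y Z : Config) (i : ℕ) : i ∈ matched Y Z ↔
    ∃ F : Finset ℕ, ∃ G : Finset ℕ, F.card = G.card ∧
      (∀ j ∈ F, Z j = Y i) ∧ ∀ j, j ∈ G ↔ (j ≤ i ∧ Y j = Y i) := by
  have hfin : {j | j ≤ i ∧ Y j = Y i}.Finite := (Set.finite_Iic i).subset fun j hj => hj.1
  constructor
  · intro h
    obtain ⟨t, ht, hc⟩ := Set.exists_subset_encard_eq (show _ ≤ _ from h)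
    have htf : t.Finite := by
      rw [← Set.encard_ne_top_iff, hc]
      exact hfin.encard_lt_top.ne
    refine ⟨htf.toFinset, hfin.toFinset, ?_, ?_, ?_⟩
    · rw [htf.encard_eq_coe_toFinset_card, hfin.encard_eq_coe_toFinset_card] at hc
      exact_mod_cast hc
    · intro j hj
      exact ht (by simpa using hj)
    · intro j
      simp
  · rintro ⟨F, G, hc, hF, hG⟩
    have h1 : {j | j ≤ i ∧ Y j = Y i} = (G : Set ℕ) := by
      ext j
      simp [hG]
    change Set.encard _ ≤ _
    rw [h1, Set.encard_coe_eq_coe_finsetCard, ← hc, ← Set.encard_coe_eq_coe_finsetCard]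
    exact Set.encard_le_encard fun j hj => hF j (by simpa using hj)

lemma measurableSet_matched {Y Z : α → Config} (hY : Measurable Y) (hZ : Measurable Z) (i : ℕ) :
    MeasurableSet {x | i ∈ matched (Y x) (Z x)} := by
  have hy : ∀ j, Measurable fun x => Y x j := fun j => (measurable_pi_apply j).comp hY
  have hz : ∀ j, Measurable fun x => Z x j := fun j => (measurable_pi_apply j).comp hZ
  simp only [mem_matched_iff]
  refine measurableSet_setOfPred.2 (Measurable.exists fun F => Measurable.exists fun G => ?_)
  refine Measurable.and measurable_const (Measurable.and ?_ ?_)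
  · exact Measurable.forall fun j => Measurable.forall fun _ =>
      measurableSet_setOfPred.1 (measurableSet_eq_fun (hz j) (hy i))
  · exact Measurable.forall fun j => Measurable.iff measurable_const
      (Measurable.and measurable_const (measurableSet_setOfPred.1 (measurableSet_eq_fun (hy j) (hy i))))

lemma measurable_matchedSum {Y Z : α → Config} (hY : Measurable Y) (hZ : Measurable Z) :
    Measurable fun x => matchedSum (Y x) (Z x) := by
  unfold matchedSum
  exact Measurable.tsum fun i => Measurable.ite (measurableSet_matched hY hZ i)
    ((measurable_pi_apply i).comp hY) measurable_const

lemma measurable_tileLeft {Y Z : α → Config} (hY : Measurable Y) (hZ : Measurable Z) (i : ℕ) :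
    Measurable fun x => tileLeft (Y x) (Z x) i := by
  unfold tileLeft
  refine Measurable.ite (measurableSet_matched hY hZ i) ?_ ?_
  · exact (measurable_const.sub (measurable_matchedSum hY hZ)).add
      (Finset.measurable_sum _ fun j _ => Measurable.ite (measurableSet_matched hY hZ j)
        ((measurable_pi_apply j).comp hY) measurable_const)
  · exact Finset.measurable_sum _ fun j _ => Measurable.ite (measurableSet_matched hY hZ j)
        measurable_const ((measurable_pi_apply j).comp hY)

lemma measurable_sInf_nat {p : ℕ → α → Prop} (hp : ∀ i, MeasurableSet {x | p i x}) :
    Measurable fun x => sInf {i | p i x} := by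
  classical
  refine measurable_to_countable' fun n => ?_
  have h : (fun x => sInf {i | p i x}) ⁻¹' {n}
      = {x | (p n x ∧ ∀ j, j < n → ¬ p j x) ∨ (n = 0 ∧ ∀ j, ¬ p j x)} := by
    ext x
    simp only [Set.mem_preimage, Set.mem_singleton_iff, Set.mem_ofPred_eq]
    constructor
    · intro hx
      by_cases he : ∃ j, p j x
      · left
        refine ⟨hx ▸ Nat.sInf_mem (s := {i | p i x}) he, fun j hj hpj => ?_⟩
        exact absurd (Nat.sInf_le (s := {i | p i x}) hpj) (by omega)
      · right
        push Not at he
        refine ⟨?_, he⟩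
        rw [← hx]
        have : {i | p i x} = ∅ := by
          ext j
          simp [he j]
        rw [this, Nat.sInf_empty]
    · rintro (⟨h1, h2⟩ | ⟨h1, h2⟩)
      · refine le_antisymm (Nat.sInf_le h1) ?_
        by_contra hlt
        exact h2 _ (not_le.1 hlt) (Nat.sInf_mem (s := {i | p i x}) ⟨n, h1⟩)
      · have : {i | p i x} = ∅ := by
          ext j
          simp [h2 j]
        rw [this, Nat.sInf_empty, h1]
  rw [h]
  have hp' : ∀ i, Measurable (p i) := fun i => measurableSet_setOfPred.1 (hp i)
  exact measurableSet_setOfPred.2 (Measurable.or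
    ((hp' n).and (Measurable.forall fun j => Measurable.forall fun _ => (hp' j).not))
    (measurable_const.and (Measurable.forall fun j => (hp' j).not)))

lemma measurable_tileAt {L Y : α → Config} {t : α → ℝ} (hL : ∀ i, Measurable fun x => L x i)
    (hY : ∀ i, Measurable fun x => Y x i) (ht : Measurable t) :
    Measurable fun x => tileAt (L x) (Y x) (t x) :=
  measurable_sInf_nat fun i => (measurableSet_le (hL i) ht).inter
    (measurableSet_lt ht ((hL i).add (hY i)))

lemma measurable_eval {f : ℕ → α → ℝ} {a : α → ℕ} (hf : ∀ i, Measurable (f i))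
    (ha : Measurable a) : Measurable fun x => f (a x) x :=
  (measurable_from_prod_countable_right (f := fun q : ℕ × α => f q.1 q.2) hf).comp
    (ha.prodMk measurable_id)

lemma measurable_hatLeft {Y Z : α → Config} {a : α → ℕ} (hY : Measurable Y) (hZ : Measurable Z)
    (ha : Measurable a) (i : ℕ) : Measurable fun x => hatLeft (Y x) (Z x) (a x) i := by
  have hL := measurable_tileLeft hY hZ
  have hy : ∀ j, Measurable fun x => Y x j := fun j => (measurable_pi_apply j).comp hY
  unfold hatLeft
  refine Measurable.ite (measurableSet_eq_fun measurable_const ha) measurable_const ?_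
  exact Measurable.ite
    (measurableSet_le ((hL i).add (hy i)) (measurable_eval hL ha))
    ((measurable_eval hy ha).add (hL i)) (hL i)

lemma measurable_stepOne {Y Z : α → Config} {u v : α → ℝ} (hY : Measurable Y) (hZ : Measurable Z)
    (hu : Measurable u) (hv : Measurable v) :
    Measurable fun x => stepOne (Y x) (Z x) (u x) (v x) := by
  have hy : ∀ j, Measurable fun x => Y x j := fun j => (measurable_pi_apply j).comp hY
  have ha : Measurable fun x => firstIdx (Y x) (Z x) (u x) :=
    measurable_tileAt (measurable_tileLeft hY hZ) hy hu
  have hb : Measurable fun x => secondIdx (Y x) (Z x) (u x) (v x) :=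
    measurable_tileAt (measurable_hatLeft hY hZ ha) hy hv
  unfold stepOne
  refine Measurable.ite (measurableSet_eq_fun ha hb) ?_ ?_
  · refine measurable_sortDesc.comp (measurable_pi_lambda _ fun i => ?_)
    cases i with
    | zero => exact hv
    | succ i =>
      exact Measurable.ite (measurableSet_eq_fun measurable_const ha)
        ((measurable_eval hy ha).sub hv) (hy i)
  · refine measurable_sortDesc.comp (measurable_pi_lambda _ fun i => ?_)
    exact Measurable.ite (measurableSet_eq_fun measurable_const ha)
      ((measurable_eval hy ha).add (measurable_eval hy hb))
      (Measurable.ite (measurableSet_eq_fun measurable_const hb) measurable_const (hy i))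

lemma measurable_coupledStep :
    Measurable fun q : (Config × Config) × (ℝ × ℝ) => coupledStep q.1 q.2 :=
  (measurable_stepOne (by fun_prop) (by fun_prop) (by fun_prop) (by fun_prop)).prodMk
    (measurable_stepOne (by fun_prop) (by fun_prop) (by fun_prop) (by fun_prop))

end Measurability

/-- The coupling kernel `M̃`: from `(Y,Z)`, the law of `(Y',Z')` for `u`, `v` independent and
uniform in `[0,1]`. -/
def couplingKernel : Kernel (Config × Config) (Config × Config) where
  toFun p := (unif.prod unif).map (coupledStep p)
  measurable' := by
    have h : (fun p => (unif.prod unif).map (coupledStep p))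
        = fun p => ((unif.prod unif).map (Prod.mk p)).map (fun q => coupledStep q.1 q.2) := by
      funext p
      rw [Measure.map_map measurable_coupledStep measurable_prodMk_left]
      rfl
    rw [h]
    exact (Measure.measurable_map _ measurable_coupledStep).comp Measurable.map_prodMk_left

/-- `X` is a (time homogeneous, discrete time) Markov chain with transition kernel `κ`:
`P(X_{t+1} ∈ A | X_0, …, X_t) = κ(X_t, A)` almost surely. -/
structure IsMarkovChain {E Ω : Type*} [MeasurableSpace E] [MeasurableSpace Ω]
    (κ : Kernel E E) (X : ℕ → Ω → E) (μ : Measure Ω) : Prop where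
  measurable : ∀ t, Measurable (X t)
  transition : ∀ (t : ℕ) (A : Set E), MeasurableSet A →
    μ⟦X (t + 1) ⁻¹' A | ⨆ s : Fin (t + 1), MeasurableSpace.comap (X s) inferInstance⟧
      =ᵐ[μ] fun ω => (κ (X t ω)).real A

end CoagFrag

end

noncomputable section

namespace CoagFrag

/-! ### Sorting and multisets of entries -/

/-! Write T for `t₀`, fix ε > 0 and let N be the number of unmatched entries of size at least ε in
the two configurations together (`unmatchedCount`). A matched pair occupies the same interval in
both tilings (`firstIdx_aligned`). Comparing the two moves case by case (`exists_decomposition`)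
shows that N does not grow in a step that touches and creates only entries of size at least ε, and
that N drops if moreover both configurations merge two unmatched entries. A step is exceptional if
it touches or creates a small entry or lowers N. Such steps are paid for by the initial value of N
and by the mass of the small entries (`countMean_stepLaw_add_le`). Under PD(1) the fourth roots of
the entries have expected sum at most 5. With ε = T⁻² this bounds the initial mean of N by a
multiple of T^(1/2) and the mean small mass up to time T by a multiple of 1/T. Hence the expected
number of exceptional steps before T is O(T^(1/2)) (`sum_excProb_le`).

So the chain rarely visits states from which an exceptional step is likely. This covers the states
where no single unmatched entry carries almost all the unmatched mass (`Spread`), and those where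
one such entry faces three sizable ones on the other side (`OneAgainstThree`), since the latter tend
to become `Spread` in one step. In all other states at most three of the dyadic ranges (s/2, s), s =
ρ 2⁻ᵏ, k < K, contain an unmatched entry (`card_scales_add_le_three`).

On the other hand, while some unmatched entry exceeds ρ, a step cuts from it a piece in (s/2, s)
with probability at least ρs/4, up to exceptional steps. An occupied scale s loses its entry with
probability at most 2s. The factor s cancels: in the time average every scale is occupied for at
least about ρ/9 of the time during which an entry exceeds ρ (`scaleSet_balance`,
`sum_largeSet_le_sum_scaleSet`). Summing over K scales, with K of order log T, and comparing with
the bound 3 gives a fraction of time of order 1/(ρ log T). Since η = ρ 2⁻ᴷ is only a small negative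
power of T, the powers of 1/η lost on the rare states are absorbed by the gap between T^(1/2) and T.
-/

lemma finite_le_of_summable {x : ℕ → ℝ} (hx : Summable x) {s : ℝ} (hs : 0 < s) :
    {i | s ≤ x i}.Finite := by
  have h := hx.tendsto_cofinite_zero.eventually (gt_mem_nhds hs)
  rw [Filter.eventually_cofinite] at h
  simpa using h

lemma bddAbove_of_finite {x : ℕ → ℝ} (hf : ∀ s : ℝ, 0 < s → {i | s ≤ x i}.Finite) :
    BddAbove (Set.range x) := by
  obtain ⟨B, hB⟩ := ((hf 1 one_pos).image x).bddAbove
  refine ⟨max B 1, ?_⟩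
  rintro _ ⟨i, rfl⟩
  by_cases h : 1 ≤ x i
  · exact (hB ⟨i, h, rfl⟩).trans (le_max_left _ _)
  · exact (not_le.1 h).le.trans (le_max_right _ _)

lemma lt_iInf_finset_iff {x : ℕ → ℝ} {F : Finset ℕ} (hF : F.Nonempty) {t : ℝ} :
    t < ⨅ i : F, x i ↔ ∀ i ∈ F, t < x i := by
  have : Nonempty F := hF.to_subtype
  constructor
  · intro h i hi
    exact h.trans_le (ciInf_le (Set.finite_range _).bddBelow (⟨i, hi⟩ : F))
  · intro h
    obtain ⟨i, hi⟩ := exists_eq_ciInf_of_finite (f := fun i : F => x i)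
    rw [← hi]
    exact h i i.2

/-- Everything about `sortDesc` is read off from this. The level must be positive: only then is the
level set finite and its `ncard` meaningful. -/
lemma lt_sortDesc_iff {x : ℕ → ℝ} (hf : ∀ s : ℝ, 0 < s → {i | s ≤ x i}.Finite) {t : ℝ}
    (ht : 0 < t) (n : ℕ) : t < sortDesc x n ↔ n < {i | t < x i}.ncard := by
  have hfin : {i | t < x i}.Finite := (hf t ht).subset fun i (hi : t < x i) => (hi.le : t ≤ x i)
  have : Nonempty {F : Finset ℕ // F.card = n + 1} := ⟨⟨Finset.range (n + 1), by simp⟩⟩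
  have hne : ∀ F : {F : Finset ℕ // F.card = n + 1}, F.1.Nonempty := fun F =>
    Finset.card_pos.1 (by rw [F.2]; omega)
  have hb : BddAbove (Set.range fun F : {F : Finset ℕ // F.card = n + 1} => ⨅ i : F.1, x i) := by
    obtain ⟨B, hB⟩ := bddAbove_of_finite hf
    refine ⟨B, ?_⟩
    rintro _ ⟨F, rfl⟩
    obtain ⟨i, hi⟩ := hne F
    exact (ciInf_le (Set.finite_range _).bddBelow (⟨i, hi⟩ : F.1)).trans (hB ⟨i, rfl⟩)
  unfold sortDesc
  rw [lt_ciSup_iff hb]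
  constructor
  · rintro ⟨F, hF⟩
    rw [lt_iInf_finset_iff (hne F)] at hF
    have : F.1.card ≤ {i | t < x i}.ncard := by
      rw [← Set.ncard_coe_finset]
      exact Set.ncard_le_ncard (fun i hi => hF i (by simpa using hi)) hfin
    rw [F.2] at this
    omega
  · intro h
    rw [Set.ncard_eq_toFinset_card _ hfin] at h
    obtain ⟨F, hF, hc⟩ := Finset.exists_subset_card_eq (Nat.succ_le_of_lt h)
    refine ⟨⟨F, hc⟩, (lt_iInf_finset_iff (hne ⟨F, hc⟩)).2 fun i hi => ?_⟩
    simpa using hF hi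

lemma sortDesc_nonneg {x : ℕ → ℝ} (h0 : ∀ i, 0 ≤ x i) (n : ℕ) : 0 ≤ sortDesc x n :=
  Real.iSup_nonneg fun _ => Real.iInf_nonneg fun _ => h0 _

lemma antitone_sortDesc {x : ℕ → ℝ} (h0 : ∀ i, 0 ≤ x i)
    (hf : ∀ s : ℝ, 0 < s → {i | s ≤ x i}.Finite) : Antitone (sortDesc x) := by
  intro m n hmn
  by_contra! h
  have hpos : 0 ≤ sortDesc x m := sortDesc_nonneg h0 m
  obtain ⟨t, h1, h2⟩ := exists_between h
  have ht : 0 < t := hpos.trans_lt h1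
  have := (lt_sortDesc_iff hf ht n).1 h2
  exact lt_asymm h1 ((lt_sortDesc_iff hf ht m).2 (by omega))

/-- Two sequences take every positive value equally often. -/
def SameEntries (x y : ℕ → ℝ) : Prop := ∀ t : ℝ, 0 < t → {i | x i = t}.ncard = {i | y i = t}.ncard

/-- Only finitely many entries lie in [t/2, t), so the entries do not accumulate at `t` from below.
This turns facts about strict level sets into facts about the closed ones. -/
lemma exists_lt_gap {x : ℕ → ℝ} (hf : ∀ s : ℝ, 0 < s → {i | s ≤ x i}.Finite) {t : ℝ} (ht : 0 < t) :
    ∃ s, 0 < s ∧ s < t ∧ ∀ i, s < x i → t ≤ x i := by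
  have hfin : {i | t / 2 ≤ x i ∧ x i < t}.Finite := (hf (t / 2) (by positivity)).subset fun i hi => hi.1
  rcases (hfin.image x).toFinset.eq_empty_or_nonempty with he | hne
  · refine ⟨t / 2, by positivity, by linarith, fun i hi => ?_⟩
    by_contra! hlt
    have : x i ∈ (hfin.image x).toFinset := by
      simp only [Set.Finite.mem_toFinset]
      exact ⟨i, ⟨hi.le, hlt⟩, rfl⟩
    simp [he] at this
  · have hm := Finset.max'_mem _ hne
    set s := (hfin.image x).toFinset.max' hne with hs
    simp only [Set.Finite.mem_toFinset] at hm
    obtain ⟨j, ⟨hj1, hj2⟩, hj3⟩ := hm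
    refine ⟨s, by linarith [hj3], by linarith [hj3], fun i hi => ?_⟩
    by_contra! hlt
    have : x i ∈ (hfin.image x).toFinset := by
      simp only [Set.Finite.mem_toFinset]
      exact ⟨i, ⟨by linarith, hlt⟩, rfl⟩
    have := Finset.le_max' _ _ this
    linarith

lemma setOf_lt_sortDesc {x : ℕ → ℝ} (hf : ∀ s : ℝ, 0 < s → {i | s ≤ x i}.Finite) {t : ℝ}
    (ht : 0 < t) : {n | t < sortDesc x n} = Set.Iio {i | t < x i}.ncard := by
  ext n
  exact lt_sortDesc_iff hf ht n

lemma setOf_le_sortDesc {x : ℕ → ℝ} (hf : ∀ s : ℝ, 0 < s → {i | s ≤ x i}.Finite) {t : ℝ}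
    (ht : 0 < t) : {n | t ≤ sortDesc x n} = Set.Iio {i | t ≤ x i}.ncard := by
  obtain ⟨s, hs0, hst, hs⟩ := exists_lt_gap hf ht
  have hset : {i | s < x i} = {i | t ≤ x i} :=
    Set.ext fun i => ⟨fun h => hs i h, fun h => hst.trans_le h⟩
  ext n
  simp only [Set.mem_ofPred_eq, Set.mem_Iio]
  constructor
  · intro h
    rw [← hset]
    exact (lt_sortDesc_iff hf hs0 n).1 (hst.trans_le h)
  · intro h
    refine le_of_forall_lt fun r hr => ?_
    -- Raising `r` to `max r s` keeps the level positive, as `lt_sortDesc_iff` requires.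
    have hr' : 0 < max r s := hs0.trans_le (le_max_right _ _)
    refine (le_max_left r s).trans_lt ((lt_sortDesc_iff hf hr' n).2 (h.trans_le ?_))
    refine Set.ncard_le_ncard (fun i hi => ?_) ((hf _ hr').subset fun i (hi : max r s < x i) => (hi.le : max r s ≤ x i))
    exact (max_lt hr hst).trans_le hi

lemma finite_le_sortDesc {x : ℕ → ℝ} (hf : ∀ s : ℝ, 0 < s → {i | s ≤ x i}.Finite) :
    ∀ s : ℝ, 0 < s → {i | s ≤ sortDesc x i}.Finite := fun s hs => by
  rw [setOf_le_sortDesc hf hs]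
  exact Set.finite_Iio _

lemma ncard_fiber {x : ℕ → ℝ} (hf : ∀ s : ℝ, 0 < s → {i | s ≤ x i}.Finite) {t : ℝ} (ht : 0 < t) :
    {i | x i = t}.ncard = {i | t ≤ x i}.ncard - {i | t < x i}.ncard := by
  have h : {i | x i = t} = {i | t ≤ x i} \ {i | t < x i} := by
    ext i
    simp only [Set.mem_ofPred_eq, Set.mem_sdiff, not_lt]
    exact ⟨fun h => ⟨h.ge, h.le⟩, fun h => le_antisymm h.2 h.1⟩
  have hs : {i | t < x i} ⊆ {i | t ≤ x i} := fun i (hi : t < x i) => (hi.le : t ≤ x i)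
  rw [h, Set.ncard_sdiff hs ((hf t ht).subset fun i (hi : t < x i) => (hi.le : t ≤ x i))]

lemma sameEntries_sortDesc {x : ℕ → ℝ} (hf : ∀ s : ℝ, 0 < s → {i | s ≤ x i}.Finite) :
    SameEntries (sortDesc x) x := fun t ht => by
  rw [ncard_fiber hf ht, ncard_fiber (finite_le_sortDesc hf) ht, setOf_le_sortDesc hf ht,
    setOf_lt_sortDesc hf ht]
  simp [Set.ncard_eq_toFinset_card']

lemma finite_fiber {x : ℕ → ℝ} (hf : ∀ s : ℝ, 0 < s → {i | s ≤ x i}.Finite) {t : ℝ} (ht : 0 < t) :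
    {i | x i = t}.Finite := (hf t ht).subset fun _ hi => ge_of_eq hi

/-- The bijection is glued from the fibres: positive ones are finite of equal size, negative ones
are empty. Zero entries are left out because sorting may change their number. -/
lemma SameEntries.exists_equiv {x y : ℕ → ℝ} (h : SameEntries x y)
    (hx : ∀ s : ℝ, 0 < s → {i | s ≤ x i}.Finite) (hy : ∀ s : ℝ, 0 < s → {i | s ≤ y i}.Finite)
    (hx0 : ∀ i, 0 ≤ x i) (hy0 : ∀ i, 0 ≤ y i) :
    ∃ e : {i // x i ≠ 0} ≃ {i // y i ≠ 0}, ∀ i, y (e i) = x i := by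
  have hfe : ∀ t : {t : ℝ // t ≠ 0}, Nonempty ({i // x i = t} ≃ {i // y i = t}) := by
    rintro ⟨t, ht⟩
    rcases lt_or_gt_of_ne ht with h' | h'
    · have : IsEmpty {i // x i = t} := ⟨fun i => by linarith [i.2, hx0 i]⟩
      have : IsEmpty {i // y i = t} := ⟨fun i => by linarith [i.2, hy0 i]⟩
      exact ⟨Equiv.equivOfIsEmpty _ _⟩
    · have : Finite {i // x i = t} := finite_fiber hx h'
      have : Finite {i // y i = t} := finite_fiber hy h'
      exact Finite.card_eq.1 (h t h')
  have f := fun t => (hfe t).some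
  let ex := Equiv.sigmaSubtypeFiberEquivSubtype x (p := fun i => x i ≠ 0) (q := fun t => t ≠ 0)
    (fun _ => Iff.rfl)
  let ey := Equiv.sigmaSubtypeFiberEquivSubtype y (p := fun i => y i ≠ 0) (q := fun t => t ≠ 0)
    (fun _ => Iff.rfl)
  have hey : ∀ z, y (ey z) = z.1 := fun z => z.2.2
  refine ⟨ex.symm.trans ((Equiv.sigmaCongrRight f).trans ey), fun i => ?_⟩
  obtain ⟨z, rfl⟩ := ex.surjective i
  simp only [Equiv.trans_apply, Equiv.symm_apply_apply]
  rw [hey]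
  exact z.2.2.symm

lemma hasSum_comp_iff {x : ℕ → ℝ} {E : Type*} [AddCommMonoid E] [TopologicalSpace E] {G : ℝ → E}
    (hG : G 0 = 0) {a : E} :
    HasSum (fun i : {i // x i ≠ 0} => G (x i)) a ↔ HasSum (fun i => G (x i)) a :=
  hasSum_subtype_iff_of_support_subset (f := fun i => G (x i)) (s := {i | x i ≠ 0}) (by
    intro i hi h
    exact hi (by simp [h, hG]))

/-- Carries every additive functional of the entries (total mass, small mass, sum of fourth roots)
over to the sorted sequence. `G 0 = 0` makes the number of zeros irrelevant. -/
lemma SameEntries.hasSum_iff {x y : ℕ → ℝ} (h : SameEntries x y)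
    (hx : ∀ s : ℝ, 0 < s → {i | s ≤ x i}.Finite) (hy : ∀ s : ℝ, 0 < s → {i | s ≤ y i}.Finite)
    (hx0 : ∀ i, 0 ≤ x i) (hy0 : ∀ i, 0 ≤ y i) {E : Type*} [AddCommMonoid E] [TopologicalSpace E]
    {G : ℝ → E} (hG : G 0 = 0) {a : E} :
    HasSum (fun i => G (x i)) a ↔ HasSum (fun i => G (y i)) a := by
  obtain ⟨e, he⟩ := h.exists_equiv hx hy hx0 hy0
  rw [← hasSum_comp_iff hG, ← hasSum_comp_iff (x := y) hG, ← e.hasSum_iff]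
  simp only [Function.comp_def, he]

/-- The multiset of the values `x i ≥ ε`, `i ∈ S`. -/
def bigPart (ε : ℝ) (x : ℕ → ℝ) (S : Set ℕ) : Multiset ℝ := ∑ᶠ i ∈ {i | i ∈ S ∧ ε ≤ x i}, {x i}

section BigPart

variable {ε : ℝ} {x : ℕ → ℝ} (hf : {i | ε ≤ x i}.Finite)

include hf in
lemma bigPart_eq_sum (S : Set ℕ) : bigPart ε x S
    = ∑ i ∈ (hf.subset (fun _ hi => hi.2) : {i | i ∈ S ∧ ε ≤ x i}.Finite).toFinset, {x i} :=
  finsum_mem_eq_finite_toFinset_sum _ _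

include hf in
lemma count_bigPart (S : Set ℕ) {t : ℝ} (ht : ε ≤ t) :
    (bigPart ε x S).count t = {i | i ∈ S ∧ x i = t}.ncard := by
  classical
  have hfin : {i | i ∈ S ∧ x i = t}.Finite := hf.subset fun i hi => ht.trans hi.2.ge
  rw [bigPart_eq_sum hf, Multiset.count_sum', Set.ncard_eq_toFinset_card _ hfin, Finset.card_eq_sum_ones]
  simp only [Multiset.count_singleton]
  rw [← Finset.sum_filter]
  refine Finset.sum_congr ?_ fun _ _ => rfl
  ext i
  simp only [Finset.mem_filter, Set.Finite.mem_toFinset, Set.mem_ofPred_eq]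
  constructor
  · rintro ⟨⟨h1, h2⟩, h3⟩
    exact ⟨h1, h3.symm⟩
  · rintro ⟨h1, h3⟩
    exact ⟨⟨h1, ht.trans h3.ge⟩, h3.symm⟩

include hf in
lemma mem_bigPart (S : Set ℕ) {t : ℝ} : t ∈ bigPart ε x S ↔ ∃ i ∈ S, ε ≤ x i ∧ x i = t := by
  rw [bigPart_eq_sum hf, Multiset.mem_sum]
  simp only [Set.Finite.mem_toFinset, Set.mem_ofPred_eq, Multiset.mem_singleton]
  exact ⟨fun ⟨i, h, h'⟩ => ⟨i, h.1, h.2, h'.symm⟩, fun ⟨i, h, h1, h'⟩ => ⟨i, ⟨h, h1⟩, h'.symm⟩⟩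

include hf in
lemma card_bigPart (S : Set ℕ) : (bigPart ε x S).card = {i | i ∈ S ∧ ε ≤ x i}.ncard := by
  have hfin : {i | i ∈ S ∧ ε ≤ x i}.Finite := hf.subset fun i hi => hi.2
  rw [bigPart_eq_sum hf, Multiset.card_sum, Set.ncard_eq_toFinset_card _ hfin,
    Finset.card_eq_sum_ones]
  simp

include hf in
lemma bigPart_eq_cons {S : Set ℕ} {i : ℕ} (hi : i ∈ S) (hx : ε ≤ x i) :
    bigPart ε x S = x i ::ₘ bigPart ε x (S \ {i}) := by
  unfold bigPart
  have h : {j | j ∈ S ∧ ε ≤ x j} = insert i {j | j ∈ S \ {i} ∧ ε ≤ x j} := by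
    ext j
    simp only [Set.mem_ofPred_eq, Set.mem_insert_iff, Set.mem_sdiff, Set.mem_singleton_iff]
    by_cases hj : j = i
    · subst hj; simp [hi, hx]
    · simp [hj]
  rw [h, finsum_mem_insert _ (by simp) (hf.subset fun j hj => hj.2), Multiset.singleton_add]

include hf in
lemma bigPart_eq_cons_cons {S : Set ℕ} {i j : ℕ} (hi : i ∈ S) (hx : ε ≤ x i) (hj : j ∈ S)
    (hx' : ε ≤ x j) (hij : i ≠ j) :
    bigPart ε x S = x i ::ₘ x j ::ₘ bigPart ε x (S \ {i, j}) := by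
  rw [bigPart_eq_cons hf hi hx, bigPart_eq_cons hf (S := S \ {i}) (i := j) ⟨hj, by simpa using hij.symm⟩ hx',
    Set.sdiff_sdiff]
  rfl

include hf in
lemma bigPart_union {S T : Set ℕ} (h : Disjoint S T) :
    bigPart ε x (S ∪ T) = bigPart ε x S + bigPart ε x T := by
  unfold bigPart
  rw [← finsum_mem_union]
  · congr! 3 with i
    simp only [Set.mem_ofPred_eq, Set.mem_union]
    tauto
  · exact h.mono (fun i hi => hi.1) (fun i hi => hi.1)
  · exact hf.subset fun j hj => hj.2
  · exact hf.subset fun j hj => hj.2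

lemma bigPart_congr {y : ℕ → ℝ} {S : Set ℕ} (h : ∀ i ∈ S, x i = y i) :
    bigPart ε x S = bigPart ε y S := by
  unfold bigPart
  have : {i | i ∈ S ∧ ε ≤ x i} = {i | i ∈ S ∧ ε ≤ y i} := by
    ext i
    exact and_congr_right fun hi => by rw [h i hi]
  rw [this]
  exact finsum_mem_congr rfl fun i hi => by rw [h i hi.1]

include hf in
lemma bigPart_mono {S T : Set ℕ} (h : S ⊆ T) : bigPart ε x S ≤ bigPart ε x T := by
  rw [← Set.union_sdiff_cancel h, bigPart_union hf Set.disjoint_sdiff_right]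
  exact Multiset.le_add_right _ _

end BigPart

lemma SameEntries.bigPart_eq {x y : ℕ → ℝ} (h : SameEntries x y) {ε : ℝ} (hε : 0 < ε)
    (hx : {i | ε ≤ x i}.Finite) (hy : {i | ε ≤ y i}.Finite) :
    bigPart ε x Set.univ = bigPart ε y Set.univ := by
  classical
  ext t
  by_cases ht : ε ≤ t
  · rw [count_bigPart hx _ ht, count_bigPart hy _ ht]
    simpa using h t (hε.trans_le ht)
  · rw [Multiset.count_eq_zero_of_notMem, Multiset.count_eq_zero_of_notMem]
    · rw [mem_bigPart hy]; rintro ⟨i, -, h1, h2⟩; exact ht (h2 ▸ h1)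
    · rw [mem_bigPart hx]; rintro ⟨i, -, h1, h2⟩; exact ht (h2 ▸ h1)

/-! ### Geometry of the tilings -/

/-- The simplex of nonincreasing nonnegative sequences of sum one. -/
structure IsValid (Y : Config) : Prop where
  anti : Antitone Y
  nonneg : ∀ i, 0 ≤ Y i
  hasSum : HasSum Y 1

lemma IsValid.finite {Y : Config} (hY : IsValid Y) : ∀ s : ℝ, 0 < s → {i | s ≤ Y i}.Finite :=
  fun _ hs => finite_le_of_summable hY.hasSum.summable hs

lemma exists_mem_interval {g : ℕ → ℝ} {S x : ℝ} (hg : HasSum g S) (h0 : 0 ≤ x) (hx : x < S) :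
    ∃ i, ∑ j ∈ Finset.range i, g j ≤ x ∧ x < ∑ j ∈ Finset.range i, g j + g i := by
  classical
  have hex : ∃ n, x < ∑ j ∈ Finset.range n, g j :=
    (hg.tendsto_sum_nat.eventually (lt_mem_nhds hx)).exists
  have hn := Nat.find_spec hex
  have hpos : Nat.find hex ≠ 0 := by
    intro h
    rw [h] at hn
    simp only [Finset.range_zero, Finset.sum_empty] at hn
    linarith
  obtain ⟨i, hi⟩ := Nat.exists_eq_succ_of_ne_zero hpos
  refine ⟨i, not_lt.1 (Nat.find_min hex (by omega)), ?_⟩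
  rw [hi, Nat.succ_eq_add_one, Finset.sum_range_succ] at hn
  exact hn

lemma sum_range_add_le {g : ℕ → ℝ} (h0 : ∀ i, 0 ≤ g i) {i j : ℕ} (hij : i < j) :
    ∑ k ∈ Finset.range i, g k + g i ≤ ∑ k ∈ Finset.range j, g k := by
  rw [← Finset.sum_range_succ]
  exact Finset.sum_le_sum_of_subset_of_nonneg (Finset.range_mono hij) fun k _ _ => h0 k

lemma sum_range_add_le_hasSum {g : ℕ → ℝ} {S : ℝ} (h0 : ∀ i, 0 ≤ g i) (hg : HasSum g S) (i : ℕ) :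
    ∑ k ∈ Finset.range i, g k + g i ≤ S := by
  rw [← Finset.sum_range_succ]
  exact sum_le_hasSum _ (fun k _ => h0 k) hg

open Classical in
/-- The matched entries, the others being replaced by zero. -/
def matchedPart (Y Z : Config) (i : ℕ) : ℝ := if i ∈ matched Y Z then Y i else 0

open Classical in
/-- The unmatched entries, the others being replaced by zero. -/
def unmatchedPart (Y Z : Config) (i : ℕ) : ℝ := if i ∈ matched Y Z then 0 else Y i

/-- The index `i` is selected by `x` in the tiling `Ỹ`. -/
def InTile (Y Z : Config) (i : ℕ) (x : ℝ) : Prop :=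
  tileLeft Y Z i ≤ x ∧ x < tileLeft Y Z i + Y i

section Tiles

variable {Y Z : Config} (hY : IsValid Y) (hZ : IsValid Z)

lemma tileLeft_matched {i : ℕ} (hi : i ∈ matched Y Z) : tileLeft Y Z i
    = 1 - matchedSum Y Z + ∑ j ∈ Finset.range i, matchedPart Y Z j := by
  rw [tileLeft, if_pos hi]
  rfl

lemma tileLeft_unmatched {i : ℕ} (hi : i ∉ matched Y Z) : tileLeft Y Z i
    = ∑ j ∈ Finset.range i, unmatchedPart Y Z j := by
  rw [tileLeft, if_neg hi]
  rfl

lemma matchedPart_of_mem {i : ℕ} (hi : i ∈ matched Y Z) : matchedPart Y Z i = Y i := if_pos hi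

lemma matchedPart_of_notMem {i : ℕ} (hi : i ∉ matched Y Z) : matchedPart Y Z i = 0 := if_neg hi

lemma unmatchedPart_of_notMem {i : ℕ} (hi : i ∉ matched Y Z) : unmatchedPart Y Z i = Y i :=
  if_neg hi

include hY in
lemma matchedPart_nonneg (i : ℕ) : 0 ≤ matchedPart Y Z i := by
  unfold matchedPart; split_ifs <;> simp [hY.nonneg]

include hY in
lemma unmatchedPart_nonneg (i : ℕ) : 0 ≤ unmatchedPart Y Z i := by
  unfold unmatchedPart; split_ifs <;> simp [hY.nonneg]

include hY in
lemma matchedPart_le (i : ℕ) : matchedPart Y Z i ≤ Y i := by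
  unfold matchedPart; split_ifs <;> simp [hY.nonneg]

include hY in
lemma hasSum_matchedPart : HasSum (matchedPart Y Z) (matchedSum Y Z) :=
  (Summable.of_nonneg_of_le (matchedPart_nonneg hY) (matchedPart_le hY) hY.hasSum.summable).hasSum

include hY in
lemma hasSum_unmatchedPart : HasSum (unmatchedPart Y Z) (1 - matchedSum Y Z) := by
  have h : unmatchedPart Y Z = fun i => Y i - matchedPart Y Z i := by
    funext i
    unfold unmatchedPart matchedPart
    split_ifs <;> simp
  rw [h]
  exact hY.hasSum.sub (hasSum_matchedPart (Z := Z) hY)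

include hY in
lemma matchedSum_nonneg : 0 ≤ matchedSum Y Z :=
  (hasSum_matchedPart hY).nonneg (matchedPart_nonneg hY)

include hY in
lemma matchedSum_le_one : matchedSum Y Z ≤ 1 := by
  have := (hasSum_unmatchedPart (Z := Z) hY).nonneg (unmatchedPart_nonneg hY)
  linarith

include hY in
lemma tileRight_unmatched_le {i : ℕ} (hi : i ∉ matched Y Z) :
    tileLeft Y Z i + Y i ≤ 1 - matchedSum Y Z := by
  rw [tileLeft_unmatched hi, ← unmatchedPart_of_notMem hi]
  exact sum_range_add_le_hasSum (unmatchedPart_nonneg hY) (hasSum_unmatchedPart hY) i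

include hY in
lemma le_tileLeft_matched {i : ℕ} (hi : i ∈ matched Y Z) :
    1 - matchedSum Y Z ≤ tileLeft Y Z i := by
  rw [tileLeft_matched hi, le_add_iff_nonneg_right]
  exact Finset.sum_nonneg fun j _ => matchedPart_nonneg hY j

include hY in
lemma tileRight_le_one (i : ℕ) : tileLeft Y Z i + Y i ≤ 1 := by
  by_cases hi : i ∈ matched Y Z
  · have := sum_range_add_le_hasSum (matchedPart_nonneg hY) (hasSum_matchedPart (Z := Z) hY) i
    rw [matchedPart_of_mem hi] at this
    rw [tileLeft_matched hi]
    linarith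
  · have := tileRight_unmatched_le hY hi
    have := matchedSum_nonneg (Z := Z) hY
    linarith

include hY in
lemma tileLeft_nonneg (i : ℕ) : 0 ≤ tileLeft Y Z i := by
  by_cases hi : i ∈ matched Y Z
  · have := le_tileLeft_matched hY hi
    have := matchedSum_le_one (Z := Z) hY
    linarith
  · rw [tileLeft_unmatched hi]
    exact Finset.sum_nonneg fun j _ => unmatchedPart_nonneg hY j

include hY in
lemma tile_separated {i j : ℕ} (hij : i ≠ j) :
    tileLeft Y Z i + Y i ≤ tileLeft Y Z j ∨ tileLeft Y Z j + Y j ≤ tileLeft Y Z i := by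
  by_cases hi : i ∈ matched Y Z <;> by_cases hj : j ∈ matched Y Z
  · rw [tileLeft_matched hi, tileLeft_matched hj, ← matchedPart_of_mem hi, ← matchedPart_of_mem hj]
    rcases hij.lt_or_gt with h | h
    · left; linarith [sum_range_add_le (matchedPart_nonneg (Z := Z) hY) h]
    · right; linarith [sum_range_add_le (matchedPart_nonneg (Z := Z) hY) h]
  · right; exact (tileRight_unmatched_le hY hj).trans (le_tileLeft_matched hY hi)
  · left; exact (tileRight_unmatched_le hY hi).trans (le_tileLeft_matched hY hj)
  · rw [tileLeft_unmatched hi, tileLeft_unmatched hj, ← unmatchedPart_of_notMem hi,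
      ← unmatchedPart_of_notMem hj]
    rcases hij.lt_or_gt with h | h
    · left; linarith [sum_range_add_le (unmatchedPart_nonneg (Z := Z) hY) h]
    · right; linarith [sum_range_add_le (unmatchedPart_nonneg (Z := Z) hY) h]

include hY in
lemma InTile.unique {i j : ℕ} {x : ℝ} (hi : InTile Y Z i x) (hj : InTile Y Z j x) : i = j := by
  by_contra h
  rcases tile_separated (Z := Z) hY h with h | h <;> linarith [hi.1, hi.2, hj.1, hj.2]

include hY in
lemma exists_inTile {x : ℝ} (h0 : 0 ≤ x) (h1 : x < 1) : ∃ i, InTile Y Z i x := by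
  by_cases hx : x < 1 - matchedSum Y Z
  · obtain ⟨i, h2, h3⟩ := exists_mem_interval (hasSum_unmatchedPart (Z := Z) hY) h0 hx
    have hi : i ∉ matched Y Z := by
      intro hi
      have : unmatchedPart Y Z i = 0 := if_pos hi
      linarith
    rw [← tileLeft_unmatched hi, unmatchedPart_of_notMem hi] at h3
    rw [← tileLeft_unmatched hi] at h2
    exact ⟨i, h2, h3⟩
  · obtain ⟨i, h2, h3⟩ := exists_mem_interval (hasSum_matchedPart (Z := Z) hY)
      (x := x - (1 - matchedSum Y Z)) (by linarith) (by linarith)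
    have hi : i ∈ matched Y Z := by
      by_contra hi
      have := matchedPart_of_notMem hi
      linarith
    rw [matchedPart_of_mem hi] at h3
    refine ⟨i, ?_, ?_⟩ <;> rw [tileLeft_matched hi] <;> linarith

include hY in
lemma InTile.firstIdx_eq {i : ℕ} {x : ℝ} (hi : InTile Y Z i x) : firstIdx Y Z x = i := by
  unfold firstIdx tileAt
  have : {j | tileLeft Y Z j ≤ x ∧ x < tileLeft Y Z j + Y j} = {i} :=
    Set.eq_singleton_iff_unique_mem.2 ⟨hi, fun j hj => InTile.unique hY hj hi⟩
  rw [this, csInf_singleton]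

include hY in
lemma inTile_firstIdx {x : ℝ} (h0 : 0 ≤ x) (h1 : x < 1) : InTile Y Z (firstIdx Y Z x) x := by
  obtain ⟨i, hi⟩ := exists_inTile (Z := Z) hY h0 h1
  rwa [hi.firstIdx_eq hY]

include hY in
lemma InTile.matched_iff {i : ℕ} {x : ℝ} (hi : InTile Y Z i x) :
    i ∈ matched Y Z ↔ 1 - matchedSum Y Z ≤ x := by
  constructor
  · intro h
    exact (le_tileLeft_matched hY h).trans hi.1
  · intro h
    by_contra h'
    linarith [tileRight_unmatched_le hY h', hi.2]

include hY in
-- The shift moves the intervals left of `Ỹ_a` to the right by exactly `Y_a`, into the hole that it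
-- leaves; those on its right stay.
lemma hat_separated (a : ℕ) {i j : ℕ} (hij : i ≠ j) :
    hatLeft Y Z a i + Y i ≤ hatLeft Y Z a j ∨ hatLeft Y Z a j + Y j ≤ hatLeft Y Z a i := by
  have hs := tile_separated (Z := Z) hY hij
  have hi := hY.nonneg i
  have hj := hY.nonneg j
  have ha := hY.nonneg a
  have h0 := tileLeft_nonneg (Z := Z) hY
  unfold hatLeft
  by_cases h1 : i = a
  · subst h1
    have := h0 i
    have := h0 j
    rw [if_pos rfl, if_neg hij.symm]
    left
    split_ifs
    · linarith
    · rcases hs with h | h <;> linarith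
  · by_cases h2 : j = a
    · subst h2
      have := h0 i
      have := h0 j
      rw [if_pos rfl, if_neg h1]
      right
      split_ifs
      · linarith
      · rcases hs with h | h <;> linarith
    · rw [if_neg h1, if_neg h2]
      have h1' := tile_separated (Z := Z) hY h1
      have h2' := tile_separated (Z := Z) hY h2
      split_ifs with h3 h4 h4
      · rcases hs with h | h
        · left; linarith
        · right; linarith
      · left; rcases h2' with h | h <;> linarith
      · right; rcases h1' with h | h <;> linarith
      · exact hs

include hY in
lemma secondIdx_eq {u v : ℝ} {b : ℕ} (h1 : hatLeft Y Z (firstIdx Y Z u) b ≤ v)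
    (h2 : v < hatLeft Y Z (firstIdx Y Z u) b + Y b) : secondIdx Y Z u v = b := by
  unfold secondIdx tileAt
  have : {j | hatLeft Y Z (firstIdx Y Z u) j ≤ v ∧ v < hatLeft Y Z (firstIdx Y Z u) j + Y j} = {b} := by
    refine Set.eq_singleton_iff_unique_mem.2 ⟨⟨h1, h2⟩, fun j hj => ?_⟩
    by_contra h
    rcases hat_separated (Z := Z) hY (firstIdx Y Z u) h with h | h <;> linarith [hj.1, hj.2]
  rw [this, csInf_singleton]

include hY in
lemma secondIdx_of_lt {u v : ℝ} (hv : 0 ≤ v) (h : v < Y (firstIdx Y Z u)) :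
    secondIdx Y Z u v = firstIdx Y Z u := by
  apply secondIdx_eq hY <;> simp [hatLeft, hv, h]

include hY in
-- This lemma and the next pull `v` back to the tiling `Ỹ`: up to the right end of `Ỹ_a` the point
-- is displaced by `Y_a`, beyond it nothing has moved.
lemma secondIdx_of_lt_add {u v : ℝ} (h : Y (firstIdx Y Z u) ≤ v)
    (h' : v < Y (firstIdx Y Z u) + tileLeft Y Z (firstIdx Y Z u)) :
    secondIdx Y Z u v = firstIdx Y Z (v - Y (firstIdx Y Z u)) ∧
      secondIdx Y Z u v ≠ firstIdx Y Z u := by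
  set a := firstIdx Y Z u
  have ha := hY.nonneg a
  have hr := tileRight_le_one (Z := Z) hY a
  have ht := inTile_firstIdx (Z := Z) hY (x := v - Y a) (by linarith) (by linarith)
  set b := firstIdx Y Z (v - Y a)
  have hba : b ≠ a := by
    intro hb
    rw [hb] at ht
    linarith [ht.1]
  have hle : tileLeft Y Z b + Y b ≤ tileLeft Y Z a := by
    rcases tile_separated (Z := Z) hY hba with h3 | h3
    · exact h3
    · linarith [ht.1, ht.2]
  have hh : hatLeft Y Z a b = Y a + tileLeft Y Z b := by
    rw [hatLeft, if_neg hba, if_pos hle]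
  have : secondIdx Y Z u v = b := by
    apply secondIdx_eq hY
    · change hatLeft Y Z a b ≤ v
      linarith [ht.1]
    · change v < hatLeft Y Z a b + Y b
      linarith [ht.2]
  exact ⟨this, this ▸ hba⟩

include hY in
lemma secondIdx_of_add_le {u v : ℝ} (hu : 0 ≤ u) (hu' : u < 1) (hv : v < 1)
    (h : Y (firstIdx Y Z u) + tileLeft Y Z (firstIdx Y Z u) ≤ v) :
    secondIdx Y Z u v = firstIdx Y Z v ∧ secondIdx Y Z u v ≠ firstIdx Y Z u := by
  have hau := inTile_firstIdx (Z := Z) hY hu hu'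
  set a := firstIdx Y Z u
  have ha := hY.nonneg a
  have hl := tileLeft_nonneg (Z := Z) hY a
  have ht := inTile_firstIdx (Z := Z) hY (x := v) (by linarith) hv
  set b := firstIdx Y Z v
  have hba : b ≠ a := by
    intro hb
    rw [hb] at ht
    linarith [ht.2]
  have hh : hatLeft Y Z a b = tileLeft Y Z b := by
    rw [hatLeft, if_neg hba, if_neg]
    linarith [ht.2]
  have : secondIdx Y Z u v = b := by
    apply secondIdx_eq hY
    · change hatLeft Y Z a b ≤ v
      linarith [ht.1]
    · change v < hatLeft Y Z a b + Y b
      linarith [ht.2]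
  exact ⟨this, this ▸ hba⟩

/-! ### The matched entries of the two configurations -/

open Classical in
-- `Nat.count` sees only the strictly earlier copies of the value, hence the strict inequality.
lemma matched_iff_count {i : ℕ} (hfin : {j | Z j = Y i}.Finite) :
    i ∈ matched Y Z ↔ Nat.count (fun j => Y j = Y i) i < {j | Z j = Y i}.ncard := by
  have h1 : {j | j ≤ i ∧ Y j = Y i}
      = ((Finset.range (i + 1)).filter fun j => Y j = Y i : Finset ℕ) := by
    ext j
    simp
  change Set.encard _ ≤ _ ↔ _
  rw [h1, Set.encard_coe_eq_coe_finsetCard, ← Nat.count_eq_card_filter_range, Nat.count_succ,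
    if_pos rfl, ← hfin.cast_ncard_eq, Nat.cast_le, Nat.succ_le_iff]

include hY hZ in
-- `Nat.count` ranks the entries of value `t` by 0, 1, 2, …, and the matched ones are those whose
-- rank is below the number of copies in `Z`. The result is symmetric in `Y` and `Z`, so both
-- configurations have the same matched multiset.
lemma ncard_matched {t : ℝ} (ht : 0 < t) : {i | i ∈ matched Y Z ∧ Y i = t}.ncard
    = min {i | Y i = t}.ncard {i | Z i = t}.ncard := by
  classical
  have hfY := finite_fiber hY.finite ht
  have hfZ := finite_fiber hZ.finite ht
  set p : ℕ → Prop := fun j => Y j = t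
  have hset : {i | i ∈ matched Y Z ∧ Y i = t} = {i | p i ∧ Nat.count p i < {i | Z i = t}.ncard} := by
    ext i
    constructor
    · rintro ⟨h1, h2⟩
      rw [matched_iff_count (by rwa [h2]), h2] at h1
      exact ⟨h2, h1⟩
    · rintro ⟨h1, h2⟩
      have h1' : Y i = t := h1
      refine ⟨?_, h1⟩
      rw [matched_iff_count (by rwa [h1']), h1']
      exact h2
  have himg : Nat.count p '' {i | p i ∧ Nat.count p i < {i | Z i = t}.ncard}
      = Set.Iio (min {i | Y i = t}.ncard {i | Z i = t}.ncard) := by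
    ext k
    simp only [Set.mem_image, Set.mem_Iio, lt_min_iff]
    constructor
    · rintro ⟨i, ⟨h1, h2⟩, rfl⟩
      refine ⟨?_, h2⟩
      rw [Set.ncard_eq_toFinset_card _ hfY]
      exact Nat.count_lt_card hfY h1
    · rintro ⟨h1, h2⟩
      have h3 : ∀ hf : (Set.ofPred p).Finite, k < hf.toFinset.card := fun hf => by
        rw [Set.ncard_eq_toFinset_card _ hfY] at h1
        exact h1
      have h4 := Nat.count_nth h3
      exact ⟨Nat.nth p k, ⟨Nat.nth_mem k h3, by rwa [h4]⟩, h4⟩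
  rw [hset, ← Set.InjOn.ncard_image (f := Nat.count p)
    (fun i hi j hj h => Nat.count_injective hi.1 hj.1 h), himg, Set.ncard_eq_toFinset_card']
  simp [p]

include hY in
lemma finite_le_matchedPart : ∀ s : ℝ, 0 < s → {i | s ≤ matchedPart Y Z i}.Finite :=
  fun _ hs => finite_le_of_summable (hasSum_matchedPart hY).summable hs

lemma setOf_matchedPart_eq {t : ℝ} (ht : 0 < t) :
    {i | matchedPart Y Z i = t} = {i | i ∈ matched Y Z ∧ Y i = t} := by
  ext i
  by_cases hi : i ∈ matched Y Z <;> simp [matchedPart, hi, ht.ne]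

include hY hZ in
lemma sameEntries_matchedPart : SameEntries (matchedPart Y Z) (matchedPart Z Y) := fun t ht => by
  rw [setOf_matchedPart_eq ht, setOf_matchedPart_eq ht, ncard_matched hY hZ ht,
    ncard_matched hZ hY ht, min_comm]

include hY hZ in
lemma hasSum_comp_matchedPart {G : ℝ → ℝ} (hG : G 0 = 0) {s : ℝ} :
    HasSum (fun i => G (matchedPart Y Z i)) s ↔ HasSum (fun i => G (matchedPart Z Y i)) s :=
  (sameEntries_matchedPart hY hZ).hasSum_iff (finite_le_matchedPart hY) (finite_le_matchedPart hZ)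
    (matchedPart_nonneg hY) (matchedPart_nonneg hZ) hG

include hY hZ in
lemma matchedSum_comm : matchedSum Y Z = matchedSum Z Y :=
  ((hasSum_comp_matchedPart hY hZ (G := id) rfl).1 (hasSum_matchedPart hY)).unique
    (hasSum_matchedPart hZ)

include hY hZ in
open Classical in
-- By monotonicity, a matched entry before `a` is either larger than `Y a` or an earlier copy of it,
-- and earlier copies of a matched entry are matched. So the left endpoint of `Ỹ_a` depends only on
-- the matched multiset and on the rank of `a` among its copies.
lemma sum_range_matchedPart {a : ℕ} (ha : a ∈ matched Y Z) (hpos : 0 < Y a) :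
    HasSum (fun i => if Y a < matchedPart Y Z i then matchedPart Y Z i else 0)
      (∑ j ∈ Finset.range a, matchedPart Y Z j - Nat.count (fun j => Y j = Y a) a * Y a) := by
  have hfZ := finite_fiber hZ.finite hpos
  have h1 : ∑ j ∈ Finset.range a, matchedPart Y Z j
      = ∑ j ∈ Finset.range a, (if Y a < matchedPart Y Z j then matchedPart Y Z j else 0)
        + ∑ j ∈ Finset.range a, if Y j = Y a then Y a else 0 := by
    rw [← Finset.sum_add_distrib]
    refine Finset.sum_congr rfl fun j hj => ?_
    have hja := Finset.mem_range.1 hj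
    rcases (hY.anti hja.le).lt_or_eq with h | h
    · rw [if_neg h.ne', add_zero]
      by_cases hm : j ∈ matched Y Z
      · rw [matchedPart_of_mem hm, if_pos h]
      · rw [matchedPart_of_notMem hm, if_neg (by linarith)]
    · have hm : j ∈ matched Y Z := by
        rw [matched_iff_count (by rwa [← h]), ← h]
        rw [matched_iff_count hfZ] at ha
        exact (Nat.count_monotone _ hja.le).trans_lt ha
      rw [matchedPart_of_mem hm, ← h, if_neg (lt_irrefl _), if_pos rfl, zero_add]
  have h2 : ∑ j ∈ Finset.range a, (if Y j = Y a then Y a else 0)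
      = Nat.count (fun j => Y j = Y a) a * Y a := by
    rw [← Finset.sum_filter, Finset.sum_const, ← Nat.count_eq_card_filter_range, nsmul_eq_mul]
  rw [h1, h2, add_sub_cancel_right]
  refine hasSum_sum_of_ne_finset_zero fun i hi => if_neg ?_
  rw [Finset.mem_range, not_lt] at hi
  exact not_lt.2 ((matchedPart_le hY i).trans (hY.anti hi))

include hY hZ in
-- The partner is the entry of `Z` with the same value and the same rank. The formula of
-- `sum_range_matchedPart` is the same for both, so partners occupy the same interval.
lemma exists_aligned {a : ℕ} (ha : a ∈ matched Y Z) (hpos : 0 < Y a) :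
    ∃ c ∈ matched Z Y, Z c = Y a ∧ tileLeft Z Y c = tileLeft Y Z a := by
  classical
  have hfZ := finite_fiber hZ.finite hpos
  have hfY := finite_fiber hY.finite hpos
  have hlt := (matched_iff_count hfZ).1 ha
  set k := Nat.count (fun j => Y j = Y a) a with hk
  have h3 : ∀ hf : (Set.ofPred fun j => Z j = Y a).Finite, k < hf.toFinset.card := fun hf => by
    rw [Set.ncard_eq_toFinset_card _ hfZ] at hlt
    exact hlt
  set c := Nat.nth (fun j => Z j = Y a) k with hc
  have hZc : Z c = Y a := Nat.nth_mem k h3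
  have hcount : Nat.count (fun j => Z j = Y a) c = k := Nat.count_nth h3
  have hm : c ∈ matched Z Y := by
    rw [matched_iff_count (by rwa [hZc]), hZc, hcount, Set.ncard_eq_toFinset_card _ hfY]
    exact Nat.count_lt_card hfY rfl
  refine ⟨c, hm, hZc, ?_⟩
  have s1 := sum_range_matchedPart hY hZ ha hpos
  have s2 := sum_range_matchedPart hZ hY hm (hZc ▸ hpos)
  rw [hZc, hcount] at s2
  have := (hasSum_comp_matchedPart hY hZ (G := fun x => if Y a < x then x else 0) (by simp)).1 s1
  have := this.unique s2
  rw [tileLeft_matched ha, tileLeft_matched hm, matchedSum_comm hY hZ]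
  linarith

include hY hZ in
lemma firstIdx_aligned {x : ℝ} (hx : 1 - matchedSum Y Z ≤ x) (hx1 : x < 1) :
    Z (firstIdx Z Y x) = Y (firstIdx Y Z x) ∧
      tileLeft Z Y (firstIdx Z Y x) = tileLeft Y Z (firstIdx Y Z x) := by
  have hQ := matchedSum_le_one (Z := Z) hY
  have ht := inTile_firstIdx (Z := Z) hY (by linarith) hx1
  set a := firstIdx Y Z x
  obtain ⟨c, hc, h1, h2⟩ := exists_aligned hY hZ ((ht.matched_iff hY).2 hx) (by linarith [ht.1, ht.2])
  have hc' : InTile Z Y c x := ⟨by rw [h2]; exact ht.1, by rw [h1, h2]; exact ht.2⟩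
  rw [hc'.firstIdx_eq hZ]
  exact ⟨h1, h2⟩

end Tiles

/-! ### Unmatched multisets -/

/-- The multiset of the unmatched entries of size at least `ε`. -/
def unmatchedBig (ε : ℝ) (Y Z : Config) : Multiset ℝ := bigPart ε Y (matched Y Z)ᶜ

/-- The number of unmatched entries of size at least `ε`, in both configurations. -/
def unmatchedCount (ε : ℝ) (Y Z : Config) : ℕ :=
  (unmatchedBig ε Y Z).card + (unmatchedBig ε Z Y).card

lemma unmatchedCount_comm (ε : ℝ) (Y Z : Config) : unmatchedCount ε Y Z = unmatchedCount ε Z Y :=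
  add_comm _ _

section Unmatched

variable {ε : ℝ} (hε : 0 < ε) {Y Z : Config} (hY : IsValid Y) (hZ : IsValid Z)

include hε hY in
lemma bigPart_matched_add (S : Set ℕ) :
    bigPart ε Y S + bigPart ε Y Sᶜ = bigPart ε Y Set.univ := by
  rw [← bigPart_union (hY.finite ε hε) disjoint_compl_right, Set.union_compl_self]

include hε hY hZ in
lemma bigPart_matched_comm : bigPart ε Y (matched Y Z) = bigPart ε Z (matched Z Y) := by
  classical
  ext t
  by_cases ht : ε ≤ t
  · rw [count_bigPart (hY.finite ε hε) _ ht, count_bigPart (hZ.finite ε hε) _ ht,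
      ncard_matched hY hZ (hε.trans_le ht), ncard_matched hZ hY (hε.trans_le ht), min_comm]
  · rw [Multiset.count_eq_zero_of_notMem, Multiset.count_eq_zero_of_notMem]
    · rw [mem_bigPart (hZ.finite ε hε)]; rintro ⟨i, -, h1, h2⟩; exact ht (h2 ▸ h1)
    · rw [mem_bigPart (hY.finite ε hε)]; rintro ⟨i, -, h1, h2⟩; exact ht (h2 ▸ h1)

include hε hY hZ in
-- For each value the number of unmatched copies is the excess of `Y` over `Z`, a truncated
-- difference. Any multiset covering the excess therefore contains the unmatched entries, so after a
-- step the new matching need not be determined.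
lemma unmatchedBig_le {X : Multiset ℝ} (h : bigPart ε Y Set.univ ≤ bigPart ε Z Set.univ + X) :
    unmatchedBig ε Y Z ≤ X := by
  classical
  rw [Multiset.le_iff_count] at h ⊢
  intro t
  by_cases ht : ε ≤ t
  · have h1 := congrArg (Multiset.count t) (bigPart_matched_add hε hY (matched Y Z))
    have h2 := h t
    rw [Multiset.count_add, count_bigPart (hY.finite ε hε) _ ht, count_bigPart (hY.finite ε hε) _ ht,
      ncard_matched hY hZ (hε.trans_le ht), count_bigPart (hY.finite ε hε) _ ht] at h1
    rw [Multiset.count_add, count_bigPart (hY.finite ε hε) _ ht,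
      count_bigPart (hZ.finite ε hε) _ ht] at h2
    simp only [Set.mem_univ, true_and] at h1 h2
    rw [unmatchedBig, count_bigPart (hY.finite ε hε) _ ht]
    omega
  · rw [Multiset.count_eq_zero_of_notMem]
    · exact Nat.zero_le _
    · rw [unmatchedBig, mem_bigPart (hY.finite ε hε)]
      rintro ⟨i, -, h1, h2⟩
      exact ht (h2 ▸ h1)

include hε hY hZ in
lemma bigPart_le_add_unmatchedBig :
    bigPart ε Y Set.univ ≤ bigPart ε Z Set.univ + unmatchedBig ε Y Z := by
  rw [← bigPart_matched_add hε hY (matched Y Z), bigPart_matched_comm hε hY hZ]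
  exact add_le_add_left (bigPart_mono (hZ.finite ε hε) (Set.subset_univ _)) _

open Classical in
include hε hY in
-- The condition `b ≠ a` prevents a split entry, where both indices coincide, from being counted
-- twice.
lemma bigPart_pair (S : Set ℕ) {a b : ℕ} (ha : ε ≤ Y a) (hb : ε ≤ Y b) :
    bigPart ε Y S = (if a ∈ S then {Y a} else 0) + (if b ∈ S ∧ b ≠ a then {Y b} else 0)
      + bigPart ε Y (S \ {a, b}) := by
  have hf := hY.finite ε hε
  by_cases h1 : a ∈ S <;> by_cases h2 : b ∈ S ∧ b ≠ a
  · rw [if_pos h1, if_pos h2, bigPart_eq_cons_cons hf h1 ha h2.1 hb h2.2.symm, add_assoc]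
    rfl
  · rw [if_pos h1, if_neg h2, bigPart_eq_cons hf h1 ha, add_zero, Multiset.singleton_add]
    congr 2
    ext i
    simp only [Set.mem_sdiff, Set.mem_singleton_iff, Set.mem_insert_iff, not_or]
    refine and_congr_right fun hi => ⟨fun h => ⟨h, ?_⟩, fun h => h.1⟩
    rintro rfl
    exact h2 ⟨hi, h⟩
  · rw [if_neg h1, if_pos h2, bigPart_eq_cons hf h2.1 hb, zero_add, Multiset.singleton_add]
    congr 2
    ext i
    simp only [Set.mem_sdiff, Set.mem_singleton_iff, Set.mem_insert_iff, not_or]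
    refine and_congr_right fun hi => ⟨fun h => ⟨?_, h⟩, fun h => h.2⟩
    rintro rfl
    exact h1 hi
  · rw [if_neg h1, if_neg h2, zero_add, zero_add]
    congr 1
    ext i
    simp only [Set.mem_sdiff, Set.mem_singleton_iff, Set.mem_insert_iff, not_or]
    refine ⟨fun hi => ⟨hi, ?_, ?_⟩, fun h => h.1⟩
    · rintro rfl; exact h1 hi
    · rintro rfl
      exact h1 (by_contra fun h => h2 ⟨hi, fun h' => h (h' ▸ hi)⟩)

end Unmatched

/-! ### Merging and splitting -/

/-- The sequence sorted by `merge`. -/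
def mergeSeq (Y : Config) (a b : ℕ) (i : ℕ) : ℝ :=
  if i = a then Y a + Y b else if i = b then 0 else Y i

/-- The sequence sorted by `split`. -/
def splitSeq (Y : Config) (a : ℕ) (v : ℝ) : ℕ → ℝ
  | 0 => v
  | i + 1 => if i = a then Y a - v else Y i

lemma merge_eq (Y : Config) (a b : ℕ) : merge Y a b = sortDesc (mergeSeq Y a b) := rfl

lemma split_eq (Y : Config) (a : ℕ) (v : ℝ) : split Y a v = sortDesc (splitSeq Y a v) := by
  unfold split
  congr 1

lemma isValid_sortDesc {x : ℕ → ℝ} (h0 : ∀ i, 0 ≤ x i) (h1 : HasSum x 1) : IsValid (sortDesc x) where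
  anti := antitone_sortDesc h0 fun _ hs => finite_le_of_summable h1.summable hs
  nonneg := sortDesc_nonneg h0
  hasSum := by
    have hf : ∀ s : ℝ, 0 < s → {i | s ≤ x i}.Finite := fun _ hs => finite_le_of_summable h1.summable hs
    exact ((sameEntries_sortDesc hf).hasSum_iff (finite_le_sortDesc hf) hf (sortDesc_nonneg h0) h0
      (G := id) rfl).2 h1

lemma bigPart_sortDesc {x : ℕ → ℝ} (h1 : Summable x) {ε : ℝ} (hε : 0 < ε) :
    bigPart ε (sortDesc x) Set.univ = bigPart ε x Set.univ := by
  have hf : ∀ s : ℝ, 0 < s → {i | s ≤ x i}.Finite := fun _ hs => finite_le_of_summable h1 hs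
  exact (sameEntries_sortDesc hf).bigPart_eq hε (finite_le_sortDesc hf ε hε) (hf ε hε)

section Steps

variable {Y : Config} (hY : IsValid Y) {a b : ℕ} (hab : a ≠ b) {v : ℝ} (hv : 0 ≤ v) (hva : v ≤ Y a)

include hY in
lemma mergeSeq_nonneg (i : ℕ) : 0 ≤ mergeSeq Y a b i := by
  have := hY.nonneg
  unfold mergeSeq
  split_ifs
  · exact add_nonneg (this a) (this b)
  · rfl
  · exact this i

include hY hab in
lemma hasSum_mergeSeq : HasSum (mergeSeq Y a b) 1 := by
  have h : mergeSeq Y a b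
      = fun i => Y i + (if i = a then Y b else 0) - (if i = b then Y b else 0) := by
    funext i
    unfold mergeSeq
    split_ifs with h1 h2 h2
    · exact absurd (h1.symm.trans h2) hab
    · rw [h1]; ring
    · rw [h2]; ring
    · ring
  rw [h]
  have := (hY.hasSum.add (hasSum_ite_eq a (Y b))).sub (hasSum_ite_eq b (Y b))
  rwa [add_sub_cancel_right] at this

include hY hv hva in
lemma splitSeq_nonneg (i : ℕ) : 0 ≤ splitSeq Y a v i := by
  cases i with
  | zero => exact hv
  | succ i =>
    simp only [splitSeq]
    split_ifs
    · linarith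
    · exact hY.nonneg i

include hY in
lemma hasSum_splitSeq : HasSum (splitSeq Y a v) 1 := by
  have h : (fun i => splitSeq Y a v (i + 1)) = fun i => Y i - (if i = a then v else 0) := by
    funext i
    simp only [splitSeq]
    split_ifs with h
    · rw [h]
    · ring
  rw [← hasSum_nat_add_iff' 1, h]
  convert hY.hasSum.sub (hasSum_ite_eq a v) using 1
  simp [splitSeq]

include hY hab in
lemma isValid_merge : IsValid (merge Y a b) :=
  isValid_sortDesc (mergeSeq_nonneg hY) (hasSum_mergeSeq hY hab)

include hY hv hva in
lemma isValid_split : IsValid (split Y a v) := by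
  rw [split_eq]
  exact isValid_sortDesc (splitSeq_nonneg hY hv hva) (hasSum_splitSeq hY)

variable {ε : ℝ} (hε : 0 < ε)

lemma bigPart_mergeSeq_diff : bigPart ε (mergeSeq Y a b) (Set.univ \ {a, b})
    = bigPart ε Y (Set.univ \ {a, b}) := by
  refine bigPart_congr fun i hi => ?_
  have h1 : i ≠ a := fun h => hi.2 (by simp [h])
  have h2 : i ≠ b := fun h => hi.2 (by simp [h])
  simp [mergeSeq, h1, h2]

/-- The redundant pair `{a, a}` agrees with the form of `untouched`, so that splits and merges are
treated alike. -/
lemma bigPart_splitSeq_diff : bigPart ε (splitSeq Y a v) (Set.univ \ {0, a + 1})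
    = bigPart ε Y (Set.univ \ {a, a}) := by
  unfold bigPart
  have hset : {i | i ∈ Set.univ \ {0, a + 1} ∧ ε ≤ splitSeq Y a v i}
      = Nat.succ '' {i | i ∈ Set.univ \ {a, a} ∧ ε ≤ Y i} := by
    ext i
    cases i with
    | zero => simp
    | succ i =>
      by_cases h : i = a <;> simp [splitSeq, h]
  rw [hset, finsum_mem_image (Nat.succ_injective.injOn)]
  refine finsum_mem_congr rfl fun i hi => ?_
  have h1 : i ≠ a := fun h => hi.1.2 (by simp [h])
  simp [splitSeq, h1]

include hY hab hε in
lemma bigPart_merge (ha : ε ≤ Y a) : bigPart ε (merge Y a b) Set.univ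
    = (Y a + Y b) ::ₘ bigPart ε Y (Set.univ \ {a, b}) := by
  have hs := (hasSum_mergeSeq hY hab).summable
  have hma : mergeSeq Y a b a = Y a + Y b := if_pos rfl
  rw [merge_eq, bigPart_sortDesc hs hε, bigPart_eq_cons (finite_le_of_summable hs hε)
    (Set.mem_univ a) (by rw [hma]; linarith [hY.nonneg b]), hma]
  congr 1
  rw [← bigPart_mergeSeq_diff]
  unfold bigPart
  congr! 3 with i
  simp only [Set.mem_ofPred_eq, Set.mem_sdiff, Set.mem_univ, true_and, Set.mem_singleton_iff,
    Set.mem_insert_iff, not_or]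
  by_cases h2 : i = b
  · simp [h2, mergeSeq, hab.symm, hε]
  · simp [h2]

include hY hε in
lemma bigPart_split (h1 : ε ≤ v) (h2 : ε ≤ Y a - v) : bigPart ε (split Y a v) Set.univ
    = v ::ₘ (Y a - v) ::ₘ bigPart ε Y (Set.univ \ {a, a}) := by
  have hs := (hasSum_splitSeq hY (a := a) (v := v)).summable
  have hsa : splitSeq Y a v (a + 1) = Y a - v := if_pos rfl
  rw [split_eq, bigPart_sortDesc hs hε, bigPart_eq_cons_cons (finite_le_of_summable hs hε)
    (Set.mem_univ 0) (by exact h1) (Set.mem_univ (a + 1)) (by rwa [hsa]) (by omega), hsa,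
    bigPart_splitSeq_diff]
  rfl

lemma exists_eq_add_of_pair {x : ℕ → ℝ} (hf : {i | ε ≤ x i}.Finite) (i j : ℕ) :
    ∃ P : Multiset ℝ, P.card ≤ 2 ∧
      bigPart ε x Set.univ = P + bigPart ε x (Set.univ \ {i, j}) := by
  refine ⟨bigPart ε x {i, j}, ?_, ?_⟩
  · rw [card_bigPart hf]
    exact (Set.ncard_le_ncard (fun k hk => hk.1) (Set.toFinite _)).trans
      ((Set.ncard_insert_le i {j}).trans (by rw [Set.ncard_singleton]))
  · rw [← bigPart_union hf Set.disjoint_sdiff_right, Set.union_sdiff_cancel (Set.subset_univ _)]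

end Steps

/-! ### One step of the coupling -/

/-- The step of `Y` touches only entries, and creates only fragments, of size at least `ε`. -/
def StepBig (ε : ℝ) (Y Z : Config) (u v : ℝ) : Prop :=
  ε ≤ Y (firstIdx Y Z u) ∧ ε ≤ Y (secondIdx Y Z u v) ∧
    (firstIdx Y Z u = secondIdx Y Z u v → ε ≤ v ∧ ε ≤ Y (firstIdx Y Z u) - v)

/-- The multiset created by the step of `Y`. -/
def created (Y Z : Config) (u v : ℝ) : Multiset ℝ :=
  open Classical in
  if v < Y (firstIdx Y Z u) then {v, Y (firstIdx Y Z u) - v}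
  else {Y (firstIdx Y Z u) + Y (secondIdx Y Z u v)}

/-- The entries of index in `S` that the step does not touch. -/
def untouched (ε : ℝ) (Y Z : Config) (u v : ℝ) (S : Set ℕ) : Multiset ℝ :=
  bigPart ε Y (S \ {firstIdx Y Z u, secondIdx Y Z u v})

section Core

variable {Y Z : Config} (hY : IsValid Y) (hZ : IsValid Z) {u v : ℝ} (hu : 0 ≤ u) (hu1 : u < 1)
  (hv : 0 ≤ v) (hv1 : v < 1)

include hY hu hu1 hv hv1 in
lemma firstIdx_eq_secondIdx_iff :
    firstIdx Y Z u = secondIdx Y Z u v ↔ v < Y (firstIdx Y Z u) := by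
  constructor
  · intro h
    by_contra! h1
    rcases lt_or_ge v (Y (firstIdx Y Z u) + tileLeft Y Z (firstIdx Y Z u)) with h2 | h2
    · exact (secondIdx_of_lt_add hY h1 h2).2 h.symm
    · exact (secondIdx_of_add_le hY hu hu1 hv1 h2).2 h.symm
  · exact fun h => (secondIdx_of_lt hY hv h).symm

include hY hu hu1 hv hv1 in
lemma isValid_stepOne : IsValid (stepOne Y Z u v) := by
  unfold stepOne
  split_ifs with h
  · exact isValid_split hY hv ((firstIdx_eq_secondIdx_iff hY hu hu1 hv hv1).1 h).le
  · exact isValid_merge hY h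

include hY hu hu1 in
lemma firstIdx_mem_matched_iff : firstIdx Y Z u ∈ matched Y Z ↔ 1 - matchedSum Y Z ≤ u :=
  (inTile_firstIdx hY hu hu1).matched_iff hY

include hY hu hu1 hv hv1 in
-- An unmatched `Ỹ_a` lies in [0, 1 - Q], and moving it to the front only permutes intervals inside
-- that part.
lemma secondIdx_mem_matched_iff (h : u < 1 - matchedSum Y Z) :
    secondIdx Y Z u v ∈ matched Y Z ↔ 1 - matchedSum Y Z ≤ v := by
  have ha := mt (firstIdx_mem_matched_iff (Z := Z) hY hu hu1).1 (not_le.2 h)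
  have hr := tileRight_unmatched_le hY ha
  have hl := tileLeft_nonneg (Z := Z) hY (firstIdx Y Z u)
  have h0 := hY.nonneg (firstIdx Y Z u)
  rcases lt_or_ge v (Y (firstIdx Y Z u)) with h1 | h1
  · rw [secondIdx_of_lt hY hv h1]
    exact ⟨fun h => absurd h ha, fun h => by linarith⟩
  · rcases lt_or_ge v (Y (firstIdx Y Z u) + tileLeft Y Z (firstIdx Y Z u)) with h2 | h2
    · rw [(secondIdx_of_lt_add hY h1 h2).1, firstIdx_mem_matched_iff hY (by linarith) (by linarith)]
      constructor <;> intro h <;> linarith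
    · rw [(secondIdx_of_add_le hY hu hu1 hv1 h2).1, firstIdx_mem_matched_iff hY hv hv1]

include hY hZ hv1 in
-- The first intervals are unmatched on both sides, so nothing beyond 1 - Q has moved and `v` still
-- selects partners there.
lemma secondIdx_aligned_unmatched (hu : 0 ≤ u) (h : u < 1 - matchedSum Y Z)
    (h' : 1 - matchedSum Y Z ≤ v) :
    Z (secondIdx Z Y u v) = Y (secondIdx Y Z u v) := by
  have hQ := matchedSum_nonneg (Z := Z) hY
  have key : ∀ {Y Z : Config}, IsValid Y → u < 1 - matchedSum Y Z → 1 - matchedSum Y Z ≤ v →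
      secondIdx Y Z u v = firstIdx Y Z v := by
    intro Y Z hY h h'
    have hQ := matchedSum_nonneg (Z := Z) hY
    have ha := mt (firstIdx_mem_matched_iff (Z := Z) hY hu (by linarith)).1 (not_le.2 h)
    have hr := tileRight_unmatched_le hY ha
    exact (secondIdx_of_add_le hY hu (by linarith) hv1 (by linarith)).1
  rw [key hY h h', key hZ (matchedSum_comm hY hZ ▸ h) (matchedSum_comm hY hZ ▸ h')]
  exact (firstIdx_aligned hY hZ h' hv1).1

include hY hZ hu hu1 hv hv1 in
-- Here both tilings shift intervals of equal length from the same position, so `v` is pulled back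
-- to the same point in both.
lemma secondIdx_aligned_matched (h : 1 - matchedSum Y Z ≤ u) (h' : Y (firstIdx Y Z u) ≤ v) :
    (secondIdx Y Z u v ∈ matched Y Z ↔ secondIdx Z Y u v ∈ matched Z Y) ∧
      (secondIdx Y Z u v ∈ matched Y Z → Z (secondIdx Z Y u v) = Y (secondIdx Y Z u v)) := by
  obtain ⟨e1, e2⟩ := firstIdx_aligned hY hZ h hu1
  have hl := tileLeft_nonneg (Z := Z) hY (firstIdx Y Z u)
  have h0 := hY.nonneg (firstIdx Y Z u)
  have key : ∀ x, 0 ≤ x → x < 1 → secondIdx Y Z u v = firstIdx Y Z x →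
      secondIdx Z Y u v = firstIdx Z Y x →
      (secondIdx Y Z u v ∈ matched Y Z ↔ secondIdx Z Y u v ∈ matched Z Y) ∧
      (secondIdx Y Z u v ∈ matched Y Z → Z (secondIdx Z Y u v) = Y (secondIdx Y Z u v)) := by
    intro x hx hx1 h1 h2
    rw [h1, h2, firstIdx_mem_matched_iff hY hx hx1, firstIdx_mem_matched_iff hZ hx hx1,
      matchedSum_comm hY hZ]
    exact ⟨Iff.rfl, fun h => (firstIdx_aligned hY hZ (matchedSum_comm hY hZ ▸ h) hx1).1⟩
  rcases lt_or_ge v (Y (firstIdx Y Z u) + tileLeft Y Z (firstIdx Y Z u)) with h2 | h2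
  · refine key (v - Y (firstIdx Y Z u)) (by linarith) (by linarith)
      (secondIdx_of_lt_add hY h' h2).1 ?_
    rw [(secondIdx_of_lt_add hZ (by rwa [e1]) (by rwa [e1, e2])).1, e1]
  · exact key v hv hv1 (secondIdx_of_add_le hY hu hu1 hv1 h2).1
      (secondIdx_of_add_le hZ hu hu1 hv1 (by rwa [e1, e2])).1

variable {ε : ℝ} (hε : 0 < ε) (hYb : StepBig ε Y Z u v) (hZb : StepBig ε Z Y u v)

include hY hu hu1 hv hv1 hε hYb in
lemma bigPart_stepOne : bigPart ε (stepOne Y Z u v) Set.univ = created Y Z u v +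
    (untouched ε Y Z u v (matched Y Z) + untouched ε Y Z u v (matched Y Z)ᶜ) := by
  have hs : untouched ε Y Z u v (matched Y Z) + untouched ε Y Z u v (matched Y Z)ᶜ
      = bigPart ε Y (Set.univ \ {firstIdx Y Z u, secondIdx Y Z u v}) := by
    unfold untouched
    rw [← bigPart_union (hY.finite ε hε) (disjoint_compl_right.mono Set.sdiff_subset Set.sdiff_subset),
      ← Set.union_sdiff_distrib, Set.union_compl_self]
  rw [hs]
  have hiff := firstIdx_eq_secondIdx_iff (Z := Z) hY hu hu1 hv hv1
  unfold stepOne created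
  split_ifs with h1 h2 h2
  · obtain ⟨g1, g2⟩ := hYb.2.2 h1
    rw [bigPart_split hY hε g1 g2, ← h1]
    simp only [Multiset.insert_eq_cons, ← Multiset.singleton_add]
    abel
  · exact absurd (hiff.1 h1) h2
  · exact absurd (hiff.2 h2) h1
  · rw [bigPart_merge hY h1 hε hYb.1]
    rfl

/-- The multiset decomposition of a step that touches only large entries. -/
lemma exists_decomposition
    (hY : IsValid Y) (hZ : IsValid Z) (hu : 0 ≤ u) (hu1 : u < 1) (hv : 0 ≤ v) (hv1 : v < 1)
    (hε : 0 < ε) (hYb : StepBig ε Y Z u v) (hZb : StepBig ε Z Y u v) :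
    ∃ M' U' V' : Multiset ℝ,
      bigPart ε (stepOne Y Z u v) Set.univ = M' + U' ∧
      bigPart ε (stepOne Z Y u v) Set.univ = M' + V' ∧
      U'.card + V'.card ≤ unmatchedCount ε Y Z ∧
      (u < 1 - matchedSum Y Z → v < 1 - matchedSum Y Z → Y (firstIdx Y Z u) ≤ v →
        Z (firstIdx Z Y u) ≤ v → U'.card + V'.card < unmatchedCount ε Y Z) ∧
      untouched ε Y Z u v (matched Y Z)ᶜ ≤ U' ∧
      (u < 1 - matchedSum Y Z → v < Y (firstIdx Y Z u) →
        Y (firstIdx Y Z u) - v ∈ U') ∧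
      (u < 1 - matchedSum Y Z → v < Y (firstIdx Y Z u) → Z (firstIdx Z Y u) ≤ v →
        {v, Y (firstIdx Y Z u) - v} ≤ U' ∧
        (Z (firstIdx Z Y u) + Z (secondIdx Z Y u v)) ::ₘ untouched ε Z Y u v (matched Z Y)ᶜ ≤ V') := by
  classical
  have hA := bigPart_stepOne hY hu hu1 hv hv1 hε hYb
  have hB := bigPart_stepOne hZ hu hu1 hv hv1 hε hZb
  have eM := bigPart_matched_comm hε hY hZ
  have eMY := bigPart_pair hε hY (matched Y Z) hYb.1 hYb.2.1
  have eMZ := bigPart_pair hε hZ (matched Z Y) hZb.1 hZb.2.1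
  have eUY := bigPart_pair hε hY (matched Y Z)ᶜ hYb.1 hYb.2.1
  have eUZ := bigPart_pair hε hZ (matched Z Y)ᶜ hZb.1 hZb.2.1
  have iY := firstIdx_eq_secondIdx_iff (Z := Z) hY hu hu1 hv hv1
  have iZ := firstIdx_eq_secondIdx_iff (Z := Y) hZ hu hu1 hv hv1
  have mY := firstIdx_mem_matched_iff (Z := Z) hY hu hu1
  have mZ := firstIdx_mem_matched_iff (Z := Y) hZ hu hu1
  have eQ := matchedSum_comm hY hZ
  rw [← eQ] at mZ
  unfold unmatchedCount unmatchedBig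
  change _ = _ + _ + untouched ε Y Z u v (matched Y Z) at eMY
  change _ = _ + _ + untouched ε Z Y u v (matched Z Y) at eMZ
  change _ = _ + _ + untouched ε Y Z u v (matched Y Z)ᶜ at eUY
  change _ = _ + _ + untouched ε Z Y u v (matched Z Y)ᶜ at eUZ
  rw [eUY, eUZ]
  unfold created at hA hB
  set MY := untouched ε Y Z u v (matched Y Z)
  set MZ := untouched ε Z Y u v (matched Z Y)
  set UY := untouched ε Y Z u v (matched Y Z)ᶜ
  set UZ := untouched ε Z Y u v (matched Z Y)ᶜ
  -- The two matched multisets agree. In each case below the touched partners are cancelled from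
  -- this identity, and the untouched matched entries remain equal.
  rw [eMY, eMZ] at eM
  clear eMY eMZ eUY eUZ
  rcases lt_or_ge u (1 - matchedSum Y Z) with hq | hq
  · -- both first entries are unmatched
    have na : firstIdx Y Z u ∉ matched Y Z := fun h => absurd (mY.1 h) (not_le.2 hq)
    have nc : firstIdx Z Y u ∉ matched Z Y := fun h => absurd (mZ.1 h) (not_le.2 hq)
    have jY := secondIdx_mem_matched_iff hY hu hu1 hv hv1 hq
    have jZ := secondIdx_mem_matched_iff hZ hu hu1 hv hv1 (eQ ▸ hq)
    rw [← eQ] at jZ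
    rcases lt_or_ge v (1 - matchedSum Y Z) with hw | hw
    · have nb : secondIdx Y Z u v ∉ matched Y Z := fun h => absurd (jY.1 h) (not_le.2 hw)
      have nd : secondIdx Z Y u v ∉ matched Z Y := fun h => absurd (jZ.1 h) (not_le.2 hw)
      simp only [na, nb, nc, nd, if_false, false_and, zero_add, Set.mem_compl_iff, not_false_eq_true,
        true_and, if_true] at eM ⊢
      rw [← eM] at hB
      simp only [ne_comm (a := secondIdx Y Z u v), ne_comm (a := secondIdx Z Y u v), ne_eq, iY, iZ]
      rcases lt_or_ge v (Y (firstIdx Y Z u)) with h1 | h1 <;>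
      rcases lt_or_ge v (Z (firstIdx Z Y u)) with h2 | h2
      -- Both split: the two fragments `v` match each other and one unmatched remainder stays on
      -- each side.
      · rw [if_pos h1] at hA
        rw [if_pos h2] at hB
        refine ⟨v ::ₘ MY, (Y (firstIdx Y Z u) - v) ::ₘ UY, (Z (firstIdx Z Y u) - v) ::ₘ UZ, ?_, ?_, ?_, ?_,
          ?_, ?_, ?_⟩
        · rw [hA]; simp only [Multiset.insert_eq_cons, ← Multiset.singleton_add]; abel
        · rw [hB]; simp only [Multiset.insert_eq_cons, ← Multiset.singleton_add]; abel
        · simp [h1, h2]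
        · intro _ _ h; linarith
        · exact Multiset.le_cons_self _ _
        · intro _ _; exact Multiset.mem_cons_self _ _
        · intro _ _ h; linarith
      -- `Y` splits and `Z` merges: one against two unmatched entries become two against one.
      · rw [if_pos h1] at hA
        rw [if_neg (not_lt.2 h2)] at hB
        refine ⟨MY, v ::ₘ (Y (firstIdx Y Z u) - v) ::ₘ UY,
          (Z (firstIdx Z Y u) + Z (secondIdx Z Y u v)) ::ₘ UZ, ?_, ?_, ?_, ?_, ?_, ?_, ?_⟩
        · rw [hA]; simp only [Multiset.insert_eq_cons, ← Multiset.singleton_add]; abel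
        · rw [hB]; simp only [← Multiset.singleton_add]; abel
        · simp [h1, not_lt.2 h2]; omega
        · intro _ _ h; linarith
        · exact (Multiset.le_cons_self _ _).trans (Multiset.le_cons_self _ _)
        · intro _ _; simp
        · intro _ _ _
          refine ⟨?_, le_rfl⟩
          simp only [Multiset.insert_eq_cons]
          exact Multiset.cons_le_cons _ (Multiset.singleton_le.2 (Multiset.mem_cons_self _ _))
      · rw [if_neg (not_lt.2 h1)] at hA
        rw [if_pos h2] at hB
        refine ⟨MY, (Y (firstIdx Y Z u) + Y (secondIdx Y Z u v)) ::ₘ UY,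
          v ::ₘ (Z (firstIdx Z Y u) - v) ::ₘ UZ, ?_, ?_, ?_, ?_, ?_, ?_, ?_⟩
        · rw [hA]; simp only [← Multiset.singleton_add]; abel
        · rw [hB]; simp only [Multiset.insert_eq_cons, ← Multiset.singleton_add]; abel
        · simp [h2, not_lt.2 h1]; omega
        · intro _ _ _ h; linarith
        · exact Multiset.le_cons_self _ _
        · intro _ h; linarith
        · intro _ h; linarith
      -- Both merge: four unmatched entries become two. This is the case of the strict inequality.
      · rw [if_neg (not_lt.2 h1)] at hA
        rw [if_neg (not_lt.2 h2)] at hB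
        refine ⟨MY, (Y (firstIdx Y Z u) + Y (secondIdx Y Z u v)) ::ₘ UY,
          (Z (firstIdx Z Y u) + Z (secondIdx Z Y u v)) ::ₘ UZ, ?_, ?_, ?_, ?_, ?_, ?_, ?_⟩
        · rw [hA]; simp only [← Multiset.singleton_add]; abel
        · rw [hB]; simp only [← Multiset.singleton_add]; abel
        · simp [not_lt.2 h1, not_lt.2 h2]; omega
        · intro _ _ _ _; simp [not_lt.2 h1, not_lt.2 h2]; omega
        · exact Multiset.le_cons_self _ _
        · intro _ h; linarith
        · intro _ h; linarith
    -- On each side an unmatched entry absorbs one member of the same matched pair, so the number of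
    -- unmatched entries is unchanged.
    · have nb : secondIdx Y Z u v ∈ matched Y Z := jY.2 hw
      have nd : secondIdx Z Y u v ∈ matched Z Y := jZ.2 hw
      have hval := secondIdx_aligned_unmatched hY hZ hv1 hu hq hw
      have n1 : secondIdx Y Z u v ≠ firstIdx Y Z u := fun h => na (h ▸ nb)
      have n2 : secondIdx Z Y u v ≠ firstIdx Z Y u := fun h => nc (h ▸ nd)
      have h1 := mt iY.2 n1.symm
      have h2 := mt iZ.2 n2.symm
      simp only [na, nb, nc, nd, n1, n2, if_false, false_and, zero_add, Set.mem_compl_iff,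
        not_false_eq_true, true_and, if_true, ne_eq, not_true_eq_false, hval] at eM ⊢
      have eM' := add_left_cancel eM
      rw [if_neg h1] at hA
      rw [if_neg h2, ← eM'] at hB
      refine ⟨MY, (Y (firstIdx Y Z u) + Y (secondIdx Y Z u v)) ::ₘ UY,
        (Z (firstIdx Z Y u) + Z (secondIdx Z Y u v)) ::ₘ UZ, ?_, ?_, ?_, ?_, ?_, ?_, ?_⟩
      · rw [hA]; simp only [← Multiset.singleton_add]; abel
      · rw [hB]; simp only [← Multiset.singleton_add]; abel
      · simp
      · intro _ h; linarith
      · exact Multiset.le_cons_self _ _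
      · intro _ h; exact absurd h h1
      · intro _ h; exact absurd h h1
  · -- both first entries are matched
    have na : firstIdx Y Z u ∈ matched Y Z := mY.2 hq
    have nc : firstIdx Z Y u ∈ matched Z Y := mZ.2 hq
    have hval := (firstIdx_aligned hY hZ hq hu1).1
    rcases lt_or_ge v (Y (firstIdx Y Z u)) with h1 | h1
    -- A matched pair is split at the same point `v`, which gives two matched pairs.
    · have n1 := (iY.2 h1).symm
      have n2 := (iZ.2 (by rwa [hval])).symm
      simp only [na, nc, n1, n2, if_false, zero_add, add_zero, Set.mem_compl_iff, and_false, if_true, ne_eq, not_true_eq_false, hval] at eM ⊢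
      have eM' := add_left_cancel eM
      rw [if_pos h1] at hA
      rw [hval, if_pos h1, ← eM'] at hB
      refine ⟨v ::ₘ (Y (firstIdx Y Z u) - v) ::ₘ MY, UY, UZ, ?_, ?_, le_rfl, ?_, le_rfl, ?_, ?_⟩
      · rw [hA]; simp only [Multiset.insert_eq_cons, ← Multiset.singleton_add]; abel
      · rw [hB]; simp only [Multiset.insert_eq_cons, ← Multiset.singleton_add]; abel
      · intro h; linarith
      · intro h; linarith
      · intro h; linarith
    · have n1 := mt iY.1 (not_lt.2 h1)
      have n2 := mt iZ.1 (not_lt.2 (hval ▸ h1))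
      obtain ⟨k1, k2⟩ := secondIdx_aligned_matched hY hZ hu hu1 hv hv1 hq h1
      rw [if_neg (not_lt.2 h1)] at hA
      rw [hval, if_neg (not_lt.2 h1)] at hB
      by_cases nb : secondIdx Y Z u v ∈ matched Y Z
      · have nd := k1.1 nb
        have hval2 := k2 nb
        simp only [na, nc, nb, nd, ne_comm.1 n1, ne_comm.1 n2, if_false, false_and, zero_add, add_zero,
          Set.mem_compl_iff,
          not_false_eq_true, true_and, if_true, ne_eq, not_true_eq_false, hval, hval2] at eM ⊢
        have eM' := add_left_cancel eM
        rw [← eM', hval2] at hB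
        refine ⟨(Y (firstIdx Y Z u) + Y (secondIdx Y Z u v)) ::ₘ MY, UY, UZ, ?_, ?_, le_rfl, ?_, le_rfl,
          ?_, ?_⟩
        · rw [hA]; simp only [← Multiset.singleton_add]; abel
        · rw [hB]; simp only [← Multiset.singleton_add]; abel
        · intro h; linarith
        · intro h; linarith
        · intro h; linarith
      -- A matched pair is used up: on each side its member is added to an unmatched entry.
      · have nd := mt k1.2 nb
        simp only [na, nc, nb, nd, ne_comm.1 n1, ne_comm.1 n2, if_false, false_and, zero_add, add_zero,
          Set.mem_compl_iff,
          not_false_eq_true, true_and, if_true, ne_eq, not_true_eq_false, hval] at eM ⊢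
        have eM' := add_left_cancel eM
        rw [← eM'] at hB
        refine ⟨MY, (Y (firstIdx Y Z u) + Y (secondIdx Y Z u v)) ::ₘ UY,
          (Y (firstIdx Y Z u) + Z (secondIdx Z Y u v)) ::ₘ UZ, ?_, ?_, ?_, ?_, ?_, ?_, ?_⟩
        · rw [hA]; simp only [← Multiset.singleton_add]; abel
        · rw [hB]; simp only [← Multiset.singleton_add]; abel
        · simp
        · intro h; linarith
        · exact Multiset.le_cons_self _ _
        · intro h; linarith
        · intro h; linarith

end Core

/-! ### Consequences for the unmatched entries -/

section Consequences

variable {Y Z : Config} (hY : IsValid Y) (hZ : IsValid Z) {u v : ℝ} (hu : 0 ≤ u) (hu1 : u < 1)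
  (hv : 0 ≤ v) (hv1 : v < 1) {ε : ℝ} (hε : 0 < ε)

include hY hε in
-- Valid for every step, whatever sizes are involved: at most two entries disappear and at most two
-- appear.
lemma exists_bigPart_stepOne : ∃ P R : Multiset ℝ, P.card ≤ 2 ∧ R.card ≤ 2 ∧
    ∃ D, bigPart ε (stepOne Y Z u v) Set.univ = P + D ∧ bigPart ε Y Set.univ = R + D := by
  have hf := hY.finite ε hε
  unfold stepOne
  split_ifs with h
  · obtain ⟨R, hR, hR'⟩ := exists_eq_add_of_pair hf (firstIdx Y Z u) (firstIdx Y Z u)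
    have hs := (hasSum_splitSeq hY (a := firstIdx Y Z u) (v := v)).summable
    obtain ⟨P, hP, hP'⟩ := exists_eq_add_of_pair (finite_le_of_summable hs hε) 0 (firstIdx Y Z u + 1)
    refine ⟨P, R, hP, hR, _, ?_, hR'⟩
    rw [split_eq, bigPart_sortDesc hs hε, hP', bigPart_splitSeq_diff]
  · obtain ⟨R, hR, hR'⟩ := exists_eq_add_of_pair hf (firstIdx Y Z u) (secondIdx Y Z u v)
    have hs := (hasSum_mergeSeq hY h).summable
    obtain ⟨P, hP, hP'⟩ := exists_eq_add_of_pair (finite_le_of_summable hs hε) (firstIdx Y Z u)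
      (secondIdx Y Z u v)
    refine ⟨P, R, hP, hR, _, ?_, hR'⟩
    rw [merge_eq, bigPart_sortDesc hs hε, hP', bigPart_mergeSeq_diff]

include hY hZ hu hu1 hv hv1 hε in
-- New unmatched entries of `Y` come from the at most two entries created in `Y` and the at most two
-- removed from `Z`.
lemma card_unmatchedBig_stepOne_le : (unmatchedBig ε (stepOne Y Z u v) (stepOne Z Y u v)).card
    ≤ (unmatchedBig ε Y Z).card + 4 := by
  obtain ⟨P, R, hP, hR, D, h1, h2⟩ := exists_bigPart_stepOne (Z := Z) (u := u) (v := v) hY hε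
  obtain ⟨P', R', hP', hR', D', h1', h2'⟩ := exists_bigPart_stepOne (Z := Y) (u := u) (v := v) hZ hε
  have h3 := bigPart_le_add_unmatchedBig hε hY hZ
  have h4 : unmatchedBig ε (stepOne Y Z u v) (stepOne Z Y u v) ≤ P + unmatchedBig ε Y Z + R' := by
    refine unmatchedBig_le hε (isValid_stepOne hY hu hu1 hv hv1) (isValid_stepOne hZ hu hu1 hv hv1) ?_
    rw [h1, h1']
    rw [h2, h2'] at h3
    calc P + D ≤ P + (R + D) := by gcongr; exact Multiset.le_add_left _ _
      _ ≤ P + (R' + D' + unmatchedBig ε Y Z) := by gcongr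
      _ ≤ P + (R' + D' + unmatchedBig ε Y Z) + P' := Multiset.le_add_right _ _
      _ = P' + D' + (P + unmatchedBig ε Y Z + R') := by abel
  have h5 := Multiset.card_le_card h4
  simp only [Multiset.card_add] at h5
  omega

include hY hZ hu hu1 hv hv1 hε in
lemma unmatchedCount_stepOne_le_add :
    unmatchedCount ε (stepOne Y Z u v) (stepOne Z Y u v) ≤ unmatchedCount ε Y Z + 8 := by
  have h1 := card_unmatchedBig_stepOne_le hY hZ hu hu1 hv hv1 hε
  have h2 := card_unmatchedBig_stepOne_le hZ hY hu hu1 hv hv1 hε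
  unfold unmatchedCount
  omega

variable (hYb : StepBig ε Y Z u v) (hZb : StepBig ε Z Y u v)

include hY hZ hu hu1 hv hv1 hε hYb hZb in
lemma unmatchedCount_stepOne_le :
    unmatchedCount ε (stepOne Y Z u v) (stepOne Z Y u v) ≤ unmatchedCount ε Y Z := by
  obtain ⟨M', U', V', h1, h2, h3, -⟩ := exists_decomposition hY hZ hu hu1 hv hv1 hε hYb hZb
  have hY' := isValid_stepOne (Z := Z) hY hu hu1 hv hv1
  have hZ' := isValid_stepOne (Z := Y) hZ hu hu1 hv hv1
  have k1 := Multiset.card_le_card (unmatchedBig_le hε hY' hZ' (X := U') (by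
    rw [h1, h2, add_right_comm]; exact Multiset.le_add_right _ _))
  have k2 := Multiset.card_le_card (unmatchedBig_le hε hZ' hY' (X := V') (by
    rw [h1, h2, add_right_comm]; exact Multiset.le_add_right _ _))
  unfold unmatchedCount at *
  omega

include hY hZ hu hu1 hv hv1 hε hYb hZb in
lemma unmatchedCount_stepOne_lt (hu2 : u < 1 - matchedSum Y Z) (hv2 : v < 1 - matchedSum Y Z)
    (h : Y (firstIdx Y Z u) ≤ v) (h' : Z (firstIdx Z Y u) ≤ v) :
    unmatchedCount ε (stepOne Y Z u v) (stepOne Z Y u v) < unmatchedCount ε Y Z := by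
  obtain ⟨M', U', V', h1, h2, -, h3, -⟩ := exists_decomposition hY hZ hu hu1 hv hv1 hε hYb hZb
  have h3 := h3 hu2 hv2 h h'
  have hY' := isValid_stepOne (Z := Z) hY hu hu1 hv hv1
  have hZ' := isValid_stepOne (Z := Y) hZ hu hu1 hv hv1
  have k1 := Multiset.card_le_card (unmatchedBig_le hε hY' hZ' (X := U') (by
    rw [h1, h2, add_right_comm]; exact Multiset.le_add_right _ _))
  have k2 := Multiset.card_le_card (unmatchedBig_le hε hZ' hY' (X := V') (by
    rw [h1, h2, add_right_comm]; exact Multiset.le_add_right _ _))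
  unfold unmatchedCount at *
  omega

/-- If the number of unmatched entries does not drop, untouched unmatched entries and the remainder
of a split unmatched entry are unmatched after the step. -/
lemma unmatchedBig_stepOne (hY : IsValid Y) (hZ : IsValid Z) (hu : 0 ≤ u) (hu1 : u < 1)
    (hv : 0 ≤ v) (hv1 : v < 1) (hε : 0 < ε) (hYb : StepBig ε Y Z u v) (hZb : StepBig ε Z Y u v)
    (hN : unmatchedCount ε Y Z ≤ unmatchedCount ε (stepOne Y Z u v) (stepOne Z Y u v)) :
    untouched ε Y Z u v (matched Y Z)ᶜ ≤ unmatchedBig ε (stepOne Y Z u v) (stepOne Z Y u v) ∧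
    (u < 1 - matchedSum Y Z → v < Y (firstIdx Y Z u) →
        Y (firstIdx Y Z u) - v ∈ unmatchedBig ε (stepOne Y Z u v) (stepOne Z Y u v)) ∧
    (u < 1 - matchedSum Y Z → v < Y (firstIdx Y Z u) → Z (firstIdx Z Y u) ≤ v →
        {v, Y (firstIdx Y Z u) - v} ≤ unmatchedBig ε (stepOne Y Z u v) (stepOne Z Y u v) ∧
        (Z (firstIdx Z Y u) + Z (secondIdx Z Y u v)) ::ₘ untouched ε Z Y u v (matched Z Y)ᶜ
          ≤ unmatchedBig ε (stepOne Z Y u v) (stepOne Y Z u v)) := by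
  obtain ⟨M', U', V', h1, h2, h3, -, h4⟩ := exists_decomposition hY hZ hu hu1 hv hv1 hε hYb hZb
  have hY' := isValid_stepOne (Z := Z) hY hu hu1 hv hv1
  have hZ' := isValid_stepOne (Z := Y) hZ hu hu1 hv hv1
  have l1 := unmatchedBig_le hε hY' hZ' (X := U') (by
    rw [h1, h2, add_right_comm]; exact Multiset.le_add_right _ _)
  have l2 := unmatchedBig_le hε hZ' hY' (X := V') (by
    rw [h1, h2, add_right_comm]; exact Multiset.le_add_right _ _)
  have k1 := Multiset.card_le_card l1
  have k2 := Multiset.card_le_card l2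
  unfold unmatchedCount at *
  -- Since the total does not drop, both inclusions are equalities: `U'` and `V'` are exactly the
  -- new unmatched multisets.
  rw [Multiset.eq_of_le_of_card_le l1 (by omega), Multiset.eq_of_le_of_card_le l2 (by omega)]
  exact h4

end Consequences

/-! ### The mass of the small entries -/

section Dust

/-- The total mass of the entries smaller than `ε`. -/
def dust (ε : ℝ) (Y : ℕ → ℝ) : ℝ := ∑' i, if Y i < ε then Y i else 0

lemma hasSum_dust {x : ℕ → ℝ} (h0 : ∀ i, 0 ≤ x i) (hs : Summable x) (ε : ℝ) :
    HasSum (fun i => if x i < ε then x i else 0) (dust ε x) := by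
  refine (Summable.of_nonneg_of_le (fun i => ?_) (fun i => ?_) hs).hasSum
  · split_ifs <;> simp [h0]
  · split_ifs <;> simp [h0]

lemma dust_nonneg {x : ℕ → ℝ} (h0 : ∀ i, 0 ≤ x i) (ε : ℝ) : 0 ≤ dust ε x :=
  tsum_nonneg fun i => by split_ifs <;> simp [h0]

lemma dust_sortDesc {x : ℕ → ℝ} (h0 : ∀ i, 0 ≤ x i) (hs : Summable x) (ε : ℝ) :
    dust ε (sortDesc x) = dust ε x := by
  have hf : ∀ s : ℝ, 0 < s → {i | s ≤ x i}.Finite := fun _ h => finite_le_of_summable hs h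
  exact (((sameEntries_sortDesc hf).hasSum_iff (finite_le_sortDesc hf) hf (sortDesc_nonneg h0) h0
    (G := fun t => if t < ε then t else 0) (by simp)).2 (hasSum_dust h0 hs ε)).tsum_eq

variable {Y : Config} (hY : IsValid Y) {ε : ℝ} (hε : 0 < ε)

include hY in
-- If the merged entry is small, so were both of its parts.
lemma dust_merge_le {a b : ℕ} (hab : a ≠ b) : dust ε (merge Y a b) ≤ dust ε Y := by
  rw [merge_eq, dust_sortDesc (mergeSeq_nonneg hY) (hasSum_mergeSeq hY hab).summable]
  have h1 := hasSum_dust (mergeSeq_nonneg hY (a := a) (b := b)) (hasSum_mergeSeq hY hab).summable ε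
  have h2 := ((hasSum_dust hY.nonneg hY.hasSum.summable ε).add
    (hasSum_ite_eq a (if Y b < ε then Y b else 0))).sub (hasSum_ite_eq b (if Y b < ε then Y b else 0))
  rw [add_sub_cancel_right] at h2
  refine hasSum_le (fun i => ?_) h1 h2
  have ha := hY.nonneg a
  have hb := hY.nonneg b
  by_cases h : i = a
  · subst h
    simp only [mergeSeq, if_true, if_neg hab]
    split_ifs <;> linarith
  · by_cases h' : i = b
    · subst h'
      simp [mergeSeq, h]
    · simp [mergeSeq, h, h']

include hY hε in
-- Only the two fragments can be new small entries, and each contributes at most `ε`.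
lemma dust_split_le {a : ℕ} {v : ℝ} (hv : 0 ≤ v) (hva : v ≤ Y a) :
    dust ε (split Y a v) ≤ dust ε Y + 2 * ε := by
  have hs := (hasSum_splitSeq hY (a := a) (v := v)).summable
  rw [split_eq, dust_sortDesc (splitSeq_nonneg hY hv hva) hs]
  have h1 := hasSum_dust (splitSeq_nonneg hY hv hva) hs ε
  rw [← hasSum_nat_add_iff' 1] at h1
  have h2 := (hasSum_dust hY.nonneg hY.hasSum.summable ε).add (hasSum_ite_eq a ε)
  have h3 := hasSum_le (fun i => ?_) h1 h2
  · rw [Finset.sum_range_one] at h3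
    have h4 : (if splitSeq Y a v 0 < ε then splitSeq Y a v 0 else 0) ≤ ε := by
      split_ifs with h <;> linarith
    linarith
  · have := hY.nonneg i
    simp only [splitSeq]
    by_cases h : i = a
    · simp only [h, if_true]
      have := hY.nonneg a
      split_ifs <;> linarith
    · simp [h]

include hY hε in
lemma dust_stepOne_le {Z : Config} {u v : ℝ} (hu : 0 ≤ u) (hu1 : u < 1) (hv : 0 ≤ v) (hv1 : v < 1) :
    dust ε (stepOne Y Z u v) ≤ dust ε Y + 2 * ε := by
  unfold stepOne
  split_ifs with h
  · exact dust_split_le hY hε hv ((firstIdx_eq_secondIdx_iff hY hu hu1 hv hv1).1 h).le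
  · exact (dust_merge_le hY h).trans (by linarith)

end Dust

/-! ### Estimates for one step from a fixed state -/

open scoped ENNReal

/-- The law of `(u, v)`. -/
abbrev unif2 : Measure (ℝ × ℝ) := unif.prod unif

lemma unif_le (s : Set ℝ) : unif s ≤ volume s := Measure.restrict_apply_le _ _

lemma unif_Ico {a l : ℝ} (ha : 0 ≤ a) (hl : a + l ≤ 1) :
    unif (Set.Ico a (a + l)) = ENNReal.ofReal l := by
  rw [unif, Measure.restrict_apply measurableSet_Ico, Set.inter_eq_left.2, Real.volume_Ico]
  · congr 1; ring
  · exact fun x hx => ⟨ha.trans hx.1, hx.2.le.trans hl⟩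

lemma unif2_rect {a l b m : ℝ} (ha : 0 ≤ a) (hl : a + l ≤ 1) (hb : 0 ≤ b) (hm : b + m ≤ 1)
    (hl0 : 0 ≤ l) : unif2 (Set.Ico a (a + l) ×ˢ Set.Ico b (b + m)) = ENNReal.ofReal (l * m) := by
  rw [Measure.prod_prod, unif_Ico ha hl, unif_Ico hb hm, ENNReal.ofReal_mul hl0]

lemma unif2_fst_le (a l : ℝ) : unif2 {w | a ≤ w.1 ∧ w.1 < a + l} ≤ ENNReal.ofReal l := by
  have : {w : ℝ × ℝ | a ≤ w.1 ∧ w.1 < a + l} = Set.Ico a (a + l) ×ˢ Set.univ := by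
    ext w
    simp
  rw [this, Measure.prod_prod, measure_univ, mul_one]
  refine (unif_le _).trans ?_
  rw [Real.volume_Ico]
  exact ENNReal.ofReal_le_ofReal (by linarith)

lemma unif2_strip_le {f : ℝ → ℝ} (hf : Measurable f) (l : ℝ) :
    unif2 {w | f w.1 ≤ w.2 ∧ w.2 < f w.1 + l} ≤ ENNReal.ofReal l := by
  have hm : MeasurableSet {w : ℝ × ℝ | f w.1 ≤ w.2 ∧ w.2 < f w.1 + l} :=
    (measurableSet_le (hf.comp measurable_fst) measurable_snd).inter
      (measurableSet_lt measurable_snd ((hf.comp measurable_fst).add measurable_const))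
  rw [Measure.prod_apply hm]
  calc ∫⁻ x, unif (Prod.mk x ⁻¹' {w : ℝ × ℝ | f w.1 ≤ w.2 ∧ w.2 < f w.1 + l}) ∂unif
      ≤ ∫⁻ _, ENNReal.ofReal l ∂unif := by
        refine lintegral_mono fun x => (unif_le _).trans ?_
        change volume (Set.Ico (f x) (f x + l)) ≤ _
        rw [Real.volume_Ico]
        exact ENNReal.ofReal_le_ofReal (by linarith)
    _ = ENNReal.ofReal l := by simp

/-- The unit square, without its upper and right sides. -/
def unitSquare : Set (ℝ × ℝ) := Set.Ico 0 1 ×ˢ Set.Ico 0 1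

lemma ae_unitSquare : ∀ᵐ w ∂unif2, w ∈ unitSquare := by
  have h : unif2 unitSquare = 1 := by
    have := unif2_rect (a := 0) (l := 1) (b := 0) (m := 1) le_rfl (by simp) le_rfl (by simp) zero_le_one
    simpa [unitSquare] using this
  have hm : MeasurableSet unitSquare := measurableSet_Ico.prod measurableSet_Ico
  exact (mem_ae_iff_prob_eq_one hm).2 h

section FixedState

variable {Y Z : Config}

lemma measurable_firstIdx_const (Y Z : Config) : Measurable fun u => firstIdx Y Z u :=
  measurable_tileAt (measurable_tileLeft (Y := fun _ : ℝ => Y) (Z := fun _ => Z) measurable_const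
    measurable_const) (fun _ => measurable_const) measurable_id

lemma measurable_hatLeft_const (Y Z : Config) (i : ℕ) :
    Measurable fun u => hatLeft Y Z (firstIdx Y Z u) i :=
  measurable_hatLeft (Y := fun _ : ℝ => Y) (Z := fun _ => Z) measurable_const measurable_const
    (measurable_firstIdx_const Y Z) i

variable (hY : IsValid Y) (hZ : IsValid Z)

include hY in
lemma exists_inHatTile {u v : ℝ} (hu : 0 ≤ u) (hu1 : u < 1) (hv : 0 ≤ v) (hv1 : v < 1) :
    hatLeft Y Z (firstIdx Y Z u) (secondIdx Y Z u v) ≤ v ∧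
      v < hatLeft Y Z (firstIdx Y Z u) (secondIdx Y Z u v) + Y (secondIdx Y Z u v) := by
  have h : ∃ b, hatLeft Y Z (firstIdx Y Z u) b ≤ v ∧ v < hatLeft Y Z (firstIdx Y Z u) b + Y b := by
    set a := firstIdx Y Z u with ha
    have hau := inTile_firstIdx (Z := Z) hY hu hu1
    have hla := tileLeft_nonneg (Z := Z) hY a
    have hra := tileRight_le_one (Z := Z) hY a
    have h0 := hY.nonneg a
    rcases lt_or_ge v (Y a) with h1 | h1
    · exact ⟨a, by simp [hatLeft, hv, h1]⟩
    · rcases lt_or_ge v (Y a + tileLeft Y Z a) with h2 | h2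
      · obtain ⟨b, hb⟩ := exists_inTile (Z := Z) hY (x := v - Y a) (by linarith) (by linarith)
        have hba : b ≠ a := by
          rintro rfl
          linarith [hb.1]
        have hle : tileLeft Y Z b + Y b ≤ tileLeft Y Z a := by
          rcases tile_separated (Z := Z) hY hba with h3 | h3
          · exact h3
          · linarith [hb.1, hb.2]
        refine ⟨b, ?_⟩
        rw [hatLeft, if_neg hba, if_pos hle]
        constructor <;> linarith [hb.1, hb.2]
      · obtain ⟨b, hb⟩ := exists_inTile (Z := Z) hY hv hv1
        have hba : b ≠ a := by
          rintro rfl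
          linarith [hb.2]
        refine ⟨b, ?_⟩
        rw [hatLeft, if_neg hba, if_neg (by linarith [hb.2])]
        exact hb
  obtain ⟨b, h1, h2⟩ := h
  rw [secondIdx_eq hY h1 h2]
  exact ⟨h1, h2⟩

include hY in
/-- The probability that the step touches the entry of index `i`. -/
lemma unif2_touch_le (i : ℕ) : unif2 {w | w ∈ unitSquare ∧
    (firstIdx Y Z w.1 = i ∨ secondIdx Y Z w.1 w.2 = i)} ≤ ENNReal.ofReal (2 * Y i) := by
  have hsub : {w | w ∈ unitSquare ∧ (firstIdx Y Z w.1 = i ∨ secondIdx Y Z w.1 w.2 = i)} ⊆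
      {w | tileLeft Y Z i ≤ w.1 ∧ w.1 < tileLeft Y Z i + Y i} ∪
      {w | hatLeft Y Z (firstIdx Y Z w.1) i ≤ w.2 ∧
        w.2 < hatLeft Y Z (firstIdx Y Z w.1) i + Y i} := by
    rintro ⟨u, v⟩ ⟨⟨⟨hu, hu1⟩, hv, hv1⟩, h | h⟩
    · left
      have := inTile_firstIdx (Z := Z) hY hu hu1
      simp only at h
      rwa [h] at this
    · right
      have := exists_inHatTile (Z := Z) hY hu hu1 hv hv1
      simp only at h
      rwa [h] at this
  refine (measure_mono hsub).trans ((measure_union_le _ _).trans ?_)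
  refine (add_le_add (unif2_fst_le _ _) (unif2_strip_le (measurable_hatLeft_const Y Z i) _)).trans ?_
  rw [← ENNReal.ofReal_add (hY.nonneg i) (hY.nonneg i), two_mul]

include hY in
-- A small entry is touched with probability at most twice the small mass. A small fragment requires
-- `v` to lie within `ε` of an end of `Ŷ_a`, that is in one of two strips of height `ε`.
lemma unif2_not_stepBig_le {ε : ℝ} (hε : 0 < ε) :
    unif2 {w | w ∈ unitSquare ∧ ¬ StepBig ε Y Z w.1 w.2} ≤ ENNReal.ofReal (2 * dust ε Y + 2 * ε) := by
  have hsub : {w | w ∈ unitSquare ∧ ¬ StepBig ε Y Z w.1 w.2} ⊆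
      (⋃ i ∈ {i | Y i < ε}, {w | w ∈ unitSquare ∧
        (firstIdx Y Z w.1 = i ∨ secondIdx Y Z w.1 w.2 = i)}) ∪
      ({w | (0 : ℝ) ≤ w.2 ∧ w.2 < 0 + ε} ∪
        {w | Y (firstIdx Y Z w.1) - ε ≤ w.2 ∧ w.2 < Y (firstIdx Y Z w.1) - ε + ε}) := by
    rintro ⟨u, v⟩ ⟨hw, h⟩
    have hw' := hw
    obtain ⟨⟨hu, hu1⟩, hv, hv1⟩ := hw'
    simp only at hu hu1 hv hv1 h
    by_contra hcon
    simp only [Set.mem_union, Set.mem_iUnion, Set.mem_ofPred_eq, not_or, not_exists, not_and, hw,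
      true_and, not_lt] at hcon
    obtain ⟨h1, h2, h3⟩ := hcon
    refine h ⟨?_, ?_, fun h4 => ⟨?_, ?_⟩⟩
    · by_contra! h5
      exact (h1 _ h5).1 rfl
    · by_contra! h5
      exact (h1 _ h5).2 rfl
    · linarith [h2 hv]
    · have h5 := (firstIdx_eq_secondIdx_iff hY hu hu1 hv hv1).1 h4
      by_contra! h6
      linarith [h3 (by linarith)]
  have hm : Measurable fun u => Y (firstIdx Y Z u) - ε :=
    ((measurable_from_nat (f := Y)).comp (measurable_firstIdx_const Y Z)).sub measurable_const
  have h1 : unif2 (⋃ i ∈ {i | Y i < ε}, {w | w ∈ unitSquare ∧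
        (firstIdx Y Z w.1 = i ∨ secondIdx Y Z w.1 w.2 = i)}) ≤ ENNReal.ofReal (2 * dust ε Y) := by
    rw [Set.biUnion_eq_iUnion]
    refine (measure_iUnion_le _).trans ?_
    have hd := hasSum_dust hY.nonneg hY.hasSum.summable ε
    have hd2 := hd.mul_left 2
    rw [← hd2.tsum_eq, ENNReal.ofReal_tsum_of_nonneg _ hd2.summable]
    · rw [← tsum_subtype_eq_of_support_subset (s := {i | Y i < ε})]
      · refine ENNReal.tsum_le_tsum fun i => ?_
        have : Y i < ε := i.2
        rw [if_pos this]
        exact unif2_touch_le hY i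
      · intro i hi
        by_contra h
        have h : ¬ Y i < ε := h
        simp [h] at hi
    · intro i
      have := hY.nonneg i
      split_ifs <;> simp [this]
  refine (measure_mono hsub).trans ((measure_union_le _ _).trans ?_)
  rw [ENNReal.ofReal_add (by have := dust_nonneg hY.nonneg ε; positivity) (by positivity)]
  refine add_le_add h1 ((measure_union_le _ _).trans ?_)
  refine (add_le_add (unif2_strip_le measurable_const ε) (unif2_strip_le hm ε)).trans ?_
  rw [← ENNReal.ofReal_add hε.le hε.le, two_mul]

/-- The step is exceptional: it touches a small entry or creates one, or it lowers the number of
unmatched entries. -/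
def Exceptional (ε : ℝ) (Y Z : Config) (w : ℝ × ℝ) : Prop :=
  ¬ StepBig ε Y Z w.1 w.2 ∨ ¬ StepBig ε Z Y w.1 w.2 ∨
    unmatchedCount ε (stepOne Y Z w.1 w.2) (stepOne Z Y w.1 w.2) < unmatchedCount ε Y Z

lemma exceptional_comm {ε : ℝ} {w : ℝ × ℝ} : Exceptional ε Y Z w ↔ Exceptional ε Z Y w := by
  unfold Exceptional
  rw [unmatchedCount_comm ε Y Z, unmatchedCount_comm ε (stepOne Y Z w.1 w.2)]
  tauto

/-- There is enough unmatched mass outside every single unmatched entry. -/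
def Spread (η : ℝ) (Y Z : Config) : Prop :=
  η ≤ 1 - matchedSum Y Z ∧ (∀ i ∉ matched Y Z, Y i ≤ 1 - matchedSum Y Z - η) ∧
    ∀ i ∉ matched Z Y, Z i ≤ 1 - matchedSum Y Z - η

include hY hZ in
-- Take `u` in [0, η) and `v` in the last stretch of length `η` of the unmatched part. Both first
-- entries are unmatched and not longer than `v`, so both configurations merge two unmatched
-- entries.
lemma le_unif2_exceptional_of_spread {ε η : ℝ} (hε : 0 < ε) (hη : 0 < η) (h : Spread η Y Z) :
    ENNReal.ofReal (η ^ 2) ≤ unif2 {w | Exceptional ε Y Z w} := by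
  obtain ⟨h1, h2, h3⟩ := h
  have hQ := matchedSum_nonneg (Z := Z) hY
  have hQ' := matchedSum_comm hY hZ
  rw [pow_two, ← unif2_rect (a := 0) (l := η) (b := 1 - matchedSum Y Z - η) (m := η) le_rfl
    (by linarith) (by linarith) (by linarith) hη.le]
  refine measure_mono ?_
  rintro ⟨u, v⟩ ⟨⟨hu, hu'⟩, hv, hv'⟩
  simp only at hu hu' hv hv'
  have hu1 : u < 1 := by linarith
  have hv0 : 0 ≤ v := by linarith
  have hv1 : v < 1 := by linarith
  unfold Exceptional
  by_cases hYb : StepBig ε Y Z u v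
  swap; · exact Or.inl hYb
  by_cases hZb : StepBig ε Z Y u v
  swap; · exact Or.inr (Or.inl hZb)
  right; right
  refine unmatchedCount_stepOne_lt hY hZ hu hu1 hv0 hv1 hε hYb hZb (by linarith) (by linarith) ?_ ?_
  · refine (h2 _ ?_).trans hv
    rw [firstIdx_mem_matched_iff hY hu hu1]
    linarith
  · refine (h3 _ ?_).trans hv
    rw [firstIdx_mem_matched_iff hZ hu hu1, ← hQ']
    linarith

/-- One unmatched entry of `Y` is almost all of the unmatched mass, but `Z` has three unmatched
entries of size at least `η`. -/
def OneAgainstThree (η : ℝ) (Y Z : Config) : Prop :=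
  (∃ i ∉ matched Y Z, 1 - matchedSum Y Z - η < Y i) ∧
    ∃ j₁ ∉ matched Z Y, ∃ j₂ ∉ matched Z Y, ∃ j₃ ∉ matched Z Y, j₁ ≠ j₂ ∧ j₁ ≠ j₃ ∧ j₂ ≠ j₃ ∧
      η ≤ Z j₁ ∧ η ≤ Z j₂ ∧ η ≤ Z j₃

/-- There is an unmatched entry of `Y` with size in the open interval `(s / 2, s)`. -/
def HasScale (s : ℝ) (Y Z : Config) : Prop := ∃ i ∉ matched Y Z, s / 2 < Y i ∧ Y i < s

include hY in
lemma hasScale_of_mem {ε s t : ℝ} (hε : 0 < ε) (ht : t ∈ unmatchedBig ε Y Z) (h1 : s / 2 < t)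
    (h2 : t < s) : HasScale s Y Z := by
  obtain ⟨i, hi, -, rfl⟩ := (mem_bigPart (hY.finite ε hε) _).1 ht
  exact ⟨i, hi, h1, h2⟩

include hY hZ in
-- In a non-exceptional step an untouched unmatched entry stays unmatched, so the scale can only be
-- lost by touching that entry, which has size below `s`.
lemma unif2_not_hasScale_le {ε s : ℝ} (hε : 0 < ε) (hs : ε ≤ s / 2) (h : HasScale s Y Z) :
    unif2 {w | w ∈ unitSquare ∧ ¬ Exceptional ε Y Z w ∧
      ¬ HasScale s (stepOne Y Z w.1 w.2) (stepOne Z Y w.1 w.2)} ≤ ENNReal.ofReal (2 * s) := by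
  obtain ⟨i, hi, h1, h2⟩ := h
  refine le_trans (measure_mono ?_) ((unif2_touch_le (Z := Z) hY i).trans
    (ENNReal.ofReal_le_ofReal (by linarith)))
  rintro ⟨u, v⟩ ⟨hw, hex, hns⟩
  refine ⟨hw, ?_⟩
  obtain ⟨⟨hu, hu1⟩, hv, hv1⟩ := hw
  simp only at hu hu1 hv hv1 hns ⊢
  unfold Exceptional at hex
  push Not at hex
  obtain ⟨hYb, hZb, hN⟩ := hex
  by_contra! hcon
  have := (unmatchedBig_stepOne hY hZ hu hu1 hv hv1 hε hYb hZb hN).1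
  refine hns (hasScale_of_mem (isValid_stepOne hY hu hu1 hv hv1) hε (Multiset.mem_of_le this ?_) h1 h2)
  rw [untouched, mem_bigPart (hY.finite ε hε)]
  exact ⟨i, ⟨hi, by simp [hcon.1.symm, hcon.2.symm]⟩, by linarith, rfl⟩

include hY hZ in
-- `u` selects the large unmatched entry and `v` splits it near its right end. In a non-exceptional
-- step the remainder `Y i - v` stays unmatched, whatever happens in `Z`.
lemma le_unif2_hasScale {ε ρ s : ℝ} (hε : 0 < ε) (hρ : 0 < ρ) (hs0 : 0 < s) (hs : s ≤ ρ) {i : ℕ}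
    (hi : i ∉ matched Y Z) (hYi : ρ < Y i) :
    ENNReal.ofReal (ρ * (s / 4)) ≤ unif2 {w | Exceptional ε Y Z w ∨
      HasScale s (stepOne Y Z w.1 w.2) (stepOne Z Y w.1 w.2)} := by
  have hQ := matchedSum_nonneg (Z := Z) hY
  have hl := tileLeft_nonneg (Z := Z) hY i
  have hr := tileRight_unmatched_le hY hi
  -- For `v` in [Y i - 3s/4, Y i - s/2) the remainder lies in (s/2, 3s/4].
  rw [← unif2_rect (a := tileLeft Y Z i) (l := ρ) (b := Y i - 3 * s / 4) (m := s / 4) hl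
    (by linarith) (by linarith) (by linarith) hρ.le]
  refine measure_mono ?_
  rintro ⟨u, v⟩ ⟨⟨hu, hu'⟩, hv, hv'⟩
  simp only at hu hu' hv hv'
  have hu0 : 0 ≤ u := by linarith
  have hu1 : u < 1 := by linarith
  have hv0 : 0 ≤ v := by linarith
  have hv1 : v < 1 := by linarith
  have ht : InTile Y Z i u := ⟨hu, by linarith⟩
  have hfi := ht.firstIdx_eq hY
  by_cases hex : Exceptional ε Y Z (u, v)
  · exact Or.inl hex
  right
  unfold Exceptional at hex
  push Not at hex
  obtain ⟨hYb, hZb, hN⟩ := hex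
  have := (unmatchedBig_stepOne hY hZ hu0 hu1 hv0 hv1 hε hYb hZb hN).2.1 (by linarith)
    (by rw [hfi]; linarith)
  rw [hfi] at this
  exact hasScale_of_mem (isValid_stepOne hY hu0 hu1 hv0 hv1) hε this (by linarith) (by linarith)

include hY in
lemma add_le_of_unmatched {i j : ℕ} (hi : i ∉ matched Y Z) (hj : j ∉ matched Y Z) (hij : i ≠ j) :
    Y i + Y j ≤ 1 - matchedSum Y Z := by
  have h1 := tileRight_unmatched_le hY hi
  have h2 := tileRight_unmatched_le hY hj
  have h3 := tileLeft_nonneg (Z := Z) hY i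
  have h4 := tileLeft_nonneg (Z := Z) hY j
  rcases tile_separated (Z := Z) hY hij with h | h <;> linarith

end FixedState

/-! ### Unmatched entries outside the rare states -/

section Spreading

variable {Y Z : Config} (hY : IsValid Y) (hZ : IsValid Z)

include hY hZ in
lemma spread_comm {η : ℝ} : Spread η Y Z ↔ Spread η Z Y := by
  unfold Spread
  rw [matchedSum_comm hY hZ]
  tauto

include hY in
-- Whichever unmatched entry is singled out, at least one of the two entries `p`, `q` remains
-- outside it.
lemma le_sub_of_pair_le {ε η p q : ℝ} (hε : 0 < ε) (h : {p, q} ≤ unmatchedBig ε Y Z) (hp : η ≤ p)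
    (hq : η ≤ q) : η ≤ 1 - matchedSum Y Z ∧ ∀ k ∉ matched Y Z, Y k ≤ 1 - matchedSum Y Z - η := by
  have hf := hY.finite ε hε
  obtain ⟨i, hi, hεi, rfl⟩ := (mem_bigPart hf _).1 (Multiset.mem_of_le h (by simp : p ∈ ({p, q} : Multiset ℝ)))
  rw [unmatchedBig, bigPart_eq_cons hf hi hεi, Multiset.insert_eq_cons, Multiset.cons_le_cons_iff,
    Multiset.singleton_le] at h
  obtain ⟨j, ⟨hj, hji⟩, -, rfl⟩ := (mem_bigPart hf _).1 h
  have hij : i ≠ j := fun h => hji h.symm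
  refine ⟨?_, fun k hk => ?_⟩
  · have := add_le_of_unmatched hY hi hj hij
    have := hY.nonneg j
    linarith
  · by_cases hki : k = i
    · subst hki
      linarith [add_le_of_unmatched hY hi hj hij]
    · linarith [add_le_of_unmatched hY hk hi hki]

include hY in
lemma add_add_le_of_unmatched {i j k : ℕ} (hi : i ∉ matched Y Z) (hj : j ∉ matched Y Z)
    (hk : k ∉ matched Y Z) (hij : i ≠ j) (hik : i ≠ k) (hjk : j ≠ k) :
    Y i + Y j + Y k ≤ 1 - matchedSum Y Z := by
  have h := sum_le_hasSum {i, j, k} (fun l _ => unmatchedPart_nonneg hY l)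
    (hasSum_unmatchedPart (Z := Z) hY)
  rw [Finset.sum_insert (by simp [hij, hik]), Finset.sum_pair hjk, unmatchedPart_of_notMem hi,
    unmatchedPart_of_notMem hj, unmatchedPart_of_notMem hk] at h
  linarith

include hY in
-- The intervals follow the order of the indices, so the largest unmatched entry starts at 0. Small
-- `u` thus selects the largest unmatched entry in both tilings at once.
lemma exists_first_unmatched {j : ℕ} (hj : j ∉ matched Y Z) : ∃ m, m ∉ matched Y Z ∧
    tileLeft Y Z m = 0 ∧ ∀ j ∉ matched Y Z, Y j ≤ Y m := by
  classical
  have hex : ∃ j, j ∉ matched Y Z := ⟨j, hj⟩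
  refine ⟨Nat.find hex, Nat.find_spec hex, ?_, fun j hj => hY.anti (Nat.find_min' hex hj)⟩
  rw [tileLeft_unmatched (Nat.find_spec hex)]
  refine Finset.sum_eq_zero fun k hk => if_pos ?_
  by_contra h
  exact Nat.find_min hex (Finset.mem_range.1 hk) h

include hY hZ in
-- With `m` the largest unmatched entry of `Z`, take `u < η` and `v` in [Z m, Z m + η/2). Then `Z`
-- merges, while the dominant entry of `Y`, longer than `Z m + η`, splits into pieces of size at
-- least `η/2`. If the step is not exceptional, each side ends with two unmatched entries of size at
-- least `η/2`.
lemma le_unif2_spread {ε η : ℝ} (hε : 0 < ε) (hεη : ε ≤ η / 2) (h : OneAgainstThree η Y Z) :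
    ENNReal.ofReal (η ^ 2 / 2) ≤ unif2 {w | Exceptional ε Y Z w ∨
      Spread (η / 2) (stepOne Y Z w.1 w.2) (stepOne Z Y w.1 w.2)} := by
  classical
  obtain ⟨⟨i', hi', hYi⟩, j₁, hj₁, j₂, hj₂, j₃, hj₃, h12, h13, h23, g1, g2, g3⟩ := h
  have hQ := matchedSum_nonneg (Z := Z) hY
  have hQ' := matchedSum_comm hY hZ
  obtain ⟨m, hm, hm0, hmax⟩ := exists_first_unmatched hZ hj₁
  obtain ⟨i, hi, hi0, hmax'⟩ := exists_first_unmatched hY hi'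
  replace hYi := hYi.trans_le (hmax' i' hi')
  -- At least two of the three entries differ from `m`.
  have hsum : Z m + 2 * η ≤ 1 - matchedSum Z Y := by
    by_cases h1 : m = j₁
    · subst h1
      linarith [add_add_le_of_unmatched hZ hm hj₂ hj₃ h12 h13 h23]
    · by_cases h2 : m = j₂
      · subst h2
        linarith [add_add_le_of_unmatched hZ hm hj₁ hj₃ h1 h23 h13]
      · linarith [add_add_le_of_unmatched hZ hm hj₁ hj₂ h1 h2 h12]
  have hm1 := hmax j₁ hj₁
  have hr := tileRight_unmatched_le hY hi
  have hη0 : 0 < η := by linarith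
  rw [show η ^ 2 / 2 = η * (η / 2) by ring, ← unif2_rect (a := 0) (b := Z m) le_rfl
    (by linarith) (by linarith) (by linarith) (by linarith)]
  refine measure_mono ?_
  rintro ⟨u, v⟩ ⟨⟨hu, hu'⟩, hv, hv'⟩
  simp only at hu hu' hv hv'
  have hu0 : 0 ≤ u := hu
  have hu1 : u < 1 := by linarith
  have hv0 : 0 ≤ v := by linarith
  have hv1 : v < 1 := by linarith
  have hu2 : u < 1 - matchedSum Y Z := by linarith
  have ht : InTile Y Z i u := ⟨by rw [hi0]; exact hu, by rw [hi0]; linarith⟩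
  have hfi := ht.firstIdx_eq hY
  by_cases hexc : Exceptional ε Y Z (u, v)
  · exact Or.inl hexc
  right
  unfold Exceptional at hexc
  push Not at hexc
  obtain ⟨hYb, hZb, hN⟩ := hexc
  have hc : firstIdx Z Y u ∉ matched Z Y := by
    rw [firstIdx_mem_matched_iff hZ hu0 hu1]
    linarith
  have hcv : Z (firstIdx Z Y u) ≤ v := (hmax _ hc).trans hv
  obtain ⟨k1, k2⟩ := (unmatchedBig_stepOne hY hZ hu0 hu1 hv0 hv1 hε hYb hZb hN).2.2 hu2
    (by rw [hfi]; linarith) hcv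
  rw [hfi] at k1
  have hY' := isValid_stepOne (Z := Z) hY hu0 hu1 hv0 hv1
  have hZ' := isValid_stepOne (Z := Y) hZ hu0 hu1 hv0 hv1
  -- The step touches at most two indices of `Z`, so one of the three entries survives.
  obtain ⟨j, hj, hjη, hjc, hjd⟩ : ∃ j, j ∉ matched Z Y ∧ η ≤ Z j ∧ j ≠ firstIdx Z Y u ∧
      j ≠ secondIdx Z Y u v := by
    by_contra! hcon
    have q1 := hcon j₁ hj₁ g1
    have q2 := hcon j₂ hj₂ g2
    have q3 := hcon j₃ hj₃ g3
    by_cases e1 : j₁ = firstIdx Z Y u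
    · have e2 := q2 (fun h => h12 (e1.trans h.symm))
      have e3 := q3 (fun h => h13 (e1.trans h.symm))
      exact h23 (e2.trans e3.symm)
    · by_cases e2 : j₂ = firstIdx Z Y u
      · exact h13 ((q1 e1).trans (q3 (fun h => h23 (e2.trans h.symm))).symm)
      · exact h12 ((q1 e1).trans (q2 e2).symm)
  have k3 : {Z (firstIdx Z Y u) + Z (secondIdx Z Y u v), Z j}
      ≤ unmatchedBig ε (stepOne Z Y u v) (stepOne Y Z u v) := by
    refine le_trans ?_ k2
    rw [Multiset.insert_eq_cons, Multiset.cons_le_cons_iff, Multiset.singleton_le, untouched,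
      mem_bigPart (hZ.finite ε hε)]
    exact ⟨j, ⟨hj, by simp [hjc, hjd]⟩, by linarith, rfl⟩
  have hcd : η / 2 ≤ Z (firstIdx Z Y u) + Z (secondIdx Z Y u v) := by
    have htc : InTile Z Y m u := ⟨by rw [hm0]; exact hu, by rw [hm0]; linarith⟩
    rw [htc.firstIdx_eq hZ]
    linarith [hZ.nonneg (secondIdx Z Y u v)]
  have s1 := le_sub_of_pair_le (η := η / 2) hY' hε k1 (by linarith) (by linarith)
  have s2 := le_sub_of_pair_le (η := η / 2) hZ' hε k3 hcd (by linarith)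
  rw [← matchedSum_comm hY' hZ'] at s2
  exact ⟨s1.1, s1.2, s2.2⟩

lemma exists_unmatched_of_not_spread (hY : IsValid Y) (hZ : IsValid Z) {η : ℝ}
    (h1 : η ≤ 1 - matchedSum Y Z) (h : ¬ Spread η Y Z) :
    (∃ i ∉ matched Y Z, 1 - matchedSum Y Z - η < Y i) ∨
      ∃ i ∉ matched Z Y, 1 - matchedSum Z Y - η < Z i := by
  by_contra! hcon
  refine h ⟨h1, hcon.1, ?_⟩
  rw [matchedSum_comm hY hZ]
  exact hcon.2

open Classical in
/-- The scales `k < K` at which `Y` has an unmatched entry. -/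
def scales (s : ℕ → ℝ) (K : ℕ) (Y Z : Config) : Finset ℕ :=
  (Finset.range K).filter fun k => HasScale (s k) Y Z

lemma mem_scales {s : ℕ → ℝ} {K k : ℕ} : k ∈ scales s K Y Z ↔ k < K ∧ HasScale (s k) Y Z := by
  simp [scales]

/-- The ranges (s k / 2, s k) are disjoint, so different scales are occupied by different entries.
-/
lemma exists_index_of_mem_scales {s : ℕ → ℝ} {K : ℕ} (hs : ∀ k l, k < l → s l ≤ s k / 2) :
    ∃ f : ℕ → ℕ, (∀ k ∈ scales s K Y Z, f k ∉ matched Y Z ∧ s k / 2 < Y (f k)) ∧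
      Set.InjOn f (scales s K Y Z) := by
  classical
  have hex : ∀ k, ∃ i, k ∈ scales s K Y Z → i ∉ matched Y Z ∧ s k / 2 < Y i ∧ Y i < s k := by
    intro k
    by_cases hk : k ∈ scales s K Y Z
    · obtain ⟨i, h1, h2, h3⟩ := (mem_scales.1 hk).2
      exact ⟨i, fun _ => ⟨h1, h2, h3⟩⟩
    · exact ⟨0, fun h => absurd h hk⟩
  choose f hf using hex
  refine ⟨f, fun k hk => ⟨(hf k hk).1, (hf k hk).2.1⟩, fun k hk l hl h => ?_⟩
  obtain ⟨-, h1, h2⟩ := hf k hk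
  obtain ⟨-, h3, h4⟩ := hf l hl
  rw [← h] at h3 h4
  by_contra hne
  rcases lt_or_gt_of_ne hne with hlt | hlt
  · linarith [hs k l hlt]
  · linarith [hs l k hlt]

include hY in
-- Beside the dominant entry there is less than `η` of unmatched mass, too little for any other
-- entry on a scale.
lemma card_scales_le_one {η : ℝ} {s : ℕ → ℝ} {K : ℕ} (hs : ∀ k l, k < l → s l ≤ s k / 2)
    (hη : ∀ k < K, η ≤ s k / 2) (h : ∃ i ∉ matched Y Z, 1 - matchedSum Y Z - η < Y i) :
    (scales s K Y Z).card ≤ 1 := by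
  obtain ⟨f, hf, hinj⟩ := exists_index_of_mem_scales (Y := Y) (Z := Z) (K := K) hs
  obtain ⟨i, hi, hYi⟩ := h
  have key : ∀ k ∈ scales s K Y Z, f k = i := by
    intro k hk
    by_contra hne
    have h1 := add_le_of_unmatched hY (hf k hk).1 hi hne
    have h2 := hη k (mem_scales.1 hk).1
    linarith [(hf k hk).2]
  refine Finset.card_le_one.2 fun k hk l hl => hinj hk hl ?_
  rw [key k hk, key l hl]

lemma card_scales_le_two {η : ℝ} {s : ℕ → ℝ} {K : ℕ} (hs : ∀ k l, k < l → s l ≤ s k / 2)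
    (hη : ∀ k < K, η ≤ s k / 2) (h : ∃ i ∉ matched Y Z, 1 - matchedSum Y Z - η < Y i)
    (h' : ¬ OneAgainstThree η Y Z) : (scales s K Z Y).card ≤ 2 := by
  obtain ⟨f, hf, hinj⟩ := exists_index_of_mem_scales (Y := Z) (Z := Y) (K := K) hs
  by_contra! hcon
  obtain ⟨a, b, c, ha, hb, hc, hab, hac, hbc⟩ := Finset.two_lt_card_iff.1 hcon
  have hη' : ∀ k ∈ scales s K Z Y, η ≤ Z (f k) := fun k hk =>
    (hη k (mem_scales.1 hk).1).trans (hf k hk).2.le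
  exact h' ⟨h, f a, (hf a ha).1, f b, (hf b hb).1, f c, (hf c hc).1,
    fun h => hab (hinj ha hb h), fun h => hac (hinj ha hc h), fun h => hbc (hinj hb hc h),
    hη' a ha, hη' b hb, hη' c hc⟩

/-- One scale on the side of the dominant entry and two on the other. If the unmatched mass is below
`η`, no scale is occupied. -/
lemma card_scales_add_le_three (hY : IsValid Y) (hZ : IsValid Z) {η : ℝ} {s : ℕ → ℝ} {K : ℕ}
    (hs : ∀ k l, k < l → s l ≤ s k / 2)
    (hη : ∀ k < K, η ≤ s k / 2) (h1 : ¬ Spread η Y Z) (h2 : ¬ OneAgainstThree η Y Z)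
    (h3 : ¬ OneAgainstThree η Z Y) : (scales s K Y Z).card + (scales s K Z Y).card ≤ 3 := by
  by_cases hQ : η ≤ 1 - matchedSum Y Z
  · rcases exists_unmatched_of_not_spread hY hZ hQ h1 with h | h
    · have := card_scales_le_one hY hs hη h
      have := card_scales_le_two hs hη h h2
      omega
    · have := card_scales_le_one hZ hs hη h
      have := card_scales_le_two hs hη h h3
      omega
  · have key : ∀ {Y Z : Config}, IsValid Y → 1 - matchedSum Y Z < η → (scales s K Y Z).card = 0 := by
      intro Y Z hY hQ
      rw [Finset.card_eq_zero, Finset.eq_empty_iff_forall_notMem]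
      intro k hk
      obtain ⟨i, hi, h4, -⟩ := (mem_scales.1 hk).2
      have := tileRight_unmatched_le hY hi
      have := tileLeft_nonneg (Z := Z) hY i
      have := hη k (mem_scales.1 hk).1
      linarith
    rw [key hY (not_le.1 hQ), key hZ (by rw [← matchedSum_comm hY hZ]; exact not_le.1 hQ)]
    omega

end Spreading

/-! ### Measurability -/

section Measurability

variable {α : Type*} [MeasurableSpace α] {Y Z : α → Config} (hY : Measurable Y) (hZ : Measurable Z)

/-- For an infinite set the series is ∞, whose `toReal` is 0, in agreement with `ncard`. -/
lemma measurable_ncard {T : α → Set ℕ} (hT : ∀ i, MeasurableSet {x | i ∈ T x}) :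
    Measurable fun x => (T x).ncard := by
  classical
  have h : ∀ x, ((T x).ncard : ℝ) = (∑' i, if i ∈ T x then (1 : ℝ≥0∞) else 0).toReal := by
    intro x
    have h1 : ∑' i, (if i ∈ T x then (1 : ℝ≥0∞) else 0) = ((T x).encard : ℝ≥0∞) := by
      rw [← ENNReal.tsum_set_one, tsum_subtype (T x) (fun _ => (1 : ℝ≥0∞))]
      rfl
    rw [h1]
    rcases (T x).finite_or_infinite with hf | hf
    · rw [← hf.cast_ncard_eq]
      simp
    · rw [hf.encard_eq, hf.ncard]
      simp
  have h2 : Measurable fun x => ((T x).ncard : ℝ) := by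
    simp only [h]
    exact (Measurable.tsum fun i => Measurable.ite (hT i) measurable_const
      measurable_const).ennreal_toReal
  refine measurable_to_countable' fun n => ?_
  have : (fun x => (T x).ncard) ⁻¹' {n} = (fun x => ((T x).ncard : ℝ)) ⁻¹' {(n : ℝ)} := by
    ext x
    simp
  rw [this]
  exact h2 (measurableSet_singleton _)

/-- For an infinite index set both sides take the default value 0, so measurability holds on the
whole space of configurations, not only on the simplex. -/
lemma card_bigPart_eq_ncard (ε : ℝ) (x : ℕ → ℝ) (S : Set ℕ) :
    (bigPart ε x S).card = {i | i ∈ S ∧ ε ≤ x i}.ncard := by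
  by_cases hfin : {i | i ∈ S ∧ ε ≤ x i}.Finite
  · rw [bigPart, finsum_mem_eq_finite_toFinset_sum _ hfin, Multiset.card_sum,
      Set.ncard_eq_toFinset_card _ hfin, Finset.card_eq_sum_ones]
    simp
  · have hs : {i | i ∈ S ∧ ε ≤ x i} ∩ Function.support (fun i => ({x i} : Multiset ℝ))
        = {i | i ∈ S ∧ ε ≤ x i} := Set.inter_eq_left.2 fun i _ => by simp
    rw [bigPart, finsum_mem_eq_zero_of_infinite (by rwa [hs]), Set.Infinite.ncard hfin,
      Multiset.card_zero]

include hY hZ in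
lemma measurableSet_unmatched_and {A : Set ℝ} (hA : MeasurableSet A) (i : ℕ) :
    MeasurableSet {x | i ∉ matched (Y x) (Z x) ∧ Y x i ∈ A} :=
  (measurableSet_matched hY hZ i).compl.inter (((measurable_pi_apply i).comp hY) hA)

include hY hZ in
lemma measurable_unmatchedCount (ε : ℝ) : Measurable fun x => unmatchedCount ε (Y x) (Z x) := by
  unfold unmatchedCount unmatchedBig
  simp only [card_bigPart_eq_ncard]
  exact (measurable_ncard fun i => measurableSet_unmatched_and hY hZ measurableSet_Ici i).add
    (measurable_ncard fun i => measurableSet_unmatched_and hZ hY measurableSet_Ici i)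

include hY hZ in
lemma measurableSet_stepBig (ε : ℝ) {u v : α → ℝ} (hu : Measurable u) (hv : Measurable v) :
    MeasurableSet {x | StepBig ε (Y x) (Z x) (u x) (v x)} := by
  have hy : ∀ j, Measurable fun x => Y x j := fun j => (measurable_pi_apply j).comp hY
  have ha : Measurable fun x => firstIdx (Y x) (Z x) (u x) :=
    measurable_tileAt (measurable_tileLeft hY hZ) hy hu
  have hb : Measurable fun x => secondIdx (Y x) (Z x) (u x) (v x) :=
    measurable_tileAt (measurable_hatLeft hY hZ ha) hy hv
  unfold StepBig
  refine (measurableSet_le measurable_const (measurable_eval hy ha)).inter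
    ((measurableSet_le measurable_const (measurable_eval hy hb)).inter ?_)
  simp only [imp_iff_not_or]
  exact (measurableSet_eq_fun ha hb).compl.union ((measurableSet_le measurable_const hv).inter
    (measurableSet_le measurable_const ((measurable_eval hy ha).sub hv)))

include hY hZ in
lemma measurableSet_hasScale (s : ℝ) : MeasurableSet {x | HasScale s (Y x) (Z x)} := by
  have : {x | HasScale s (Y x) (Z x)}
      = ⋃ i, {x | i ∉ matched (Y x) (Z x) ∧ Y x i ∈ Set.Ioo (s / 2) s} := by
    ext x
    simp [HasScale]
  rw [this]
  exact MeasurableSet.iUnion fun i => measurableSet_unmatched_and hY hZ measurableSet_Ioo i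

include hY hZ in
lemma measurableSet_exists_unmatched (ρ : ℝ) :
    MeasurableSet {x | ∃ i ∉ matched (Y x) (Z x), ρ < Y x i} := by
  have : {x | ∃ i ∉ matched (Y x) (Z x), ρ < Y x i}
      = ⋃ i, {x | i ∉ matched (Y x) (Z x) ∧ Y x i ∈ Set.Ioi ρ} := by
    ext x
    simp
  rw [this]
  exact MeasurableSet.iUnion fun i => measurableSet_unmatched_and hY hZ measurableSet_Ioi i

include hY hZ in
lemma measurableSet_spread (η : ℝ) : MeasurableSet {x | Spread η (Y x) (Z x)} := by
  have hy : ∀ j, Measurable fun x => Y x j := fun j => (measurable_pi_apply j).comp hY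
  have hz : ∀ j, Measurable fun x => Z x j := fun j => (measurable_pi_apply j).comp hZ
  have hQ := measurable_matchedSum hY hZ
  have h : {x | Spread η (Y x) (Z x)} = {x | η ≤ 1 - matchedSum (Y x) (Z x)} ∩
      ((⋂ i, ({x | i ∈ matched (Y x) (Z x)} ∪ {x | Y x i ≤ 1 - matchedSum (Y x) (Z x) - η})) ∩
      ⋂ i, ({x | i ∈ matched (Z x) (Y x)} ∪ {x | Z x i ≤ 1 - matchedSum (Y x) (Z x) - η})) := by
    ext x
    simp only [Spread, Set.mem_ofPred_eq, Set.mem_inter_iff, Set.mem_iInter, Set.mem_union,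
      or_iff_not_imp_left]
  rw [h]
  refine (measurableSet_le measurable_const (measurable_const.sub hQ)).inter
    ((MeasurableSet.iInter fun i => ?_).inter (MeasurableSet.iInter fun i => ?_))
  · exact (measurableSet_matched hY hZ i).union
      (measurableSet_le (hy i) ((measurable_const.sub hQ).sub measurable_const))
  · exact (measurableSet_matched hZ hY i).union
      (measurableSet_le (hz i) ((measurable_const.sub hQ).sub measurable_const))

include hY in
lemma measurable_dust (ε : ℝ) : Measurable fun x => dust ε (Y x) := by
  have hy : ∀ j, Measurable fun x => Y x j := fun j => (measurable_pi_apply j).comp hY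
  unfold dust
  exact Measurable.tsum fun i => Measurable.ite (measurableSet_lt (hy i) measurable_const) (hy i)
    measurable_const

lemma isValid_iff {Y : Config} : IsValid Y ↔
    (∀ i, Y (i + 1) ≤ Y i) ∧ (∀ i, 0 ≤ Y i) ∧ ∑' i, ENNReal.ofReal (Y i) = 1 := by
  constructor
  · intro h
    refine ⟨fun i => h.anti (Nat.le_succ i), h.nonneg, ?_⟩
    rw [← ENNReal.ofReal_tsum_of_nonneg h.nonneg h.hasSum.summable, h.hasSum.tsum_eq,
      ENNReal.ofReal_one]
  · rintro ⟨h1, h2, h3⟩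
    refine ⟨antitone_nat_of_succ_le h1, h2, ?_⟩
    have hs : Summable Y := by
      have := ENNReal.summable_toReal (f := fun i => ENNReal.ofReal (Y i)) (by rw [h3]; simp)
      simpa only [ENNReal.toReal_ofReal (h2 _)] using this
    rw [← ENNReal.ofReal_tsum_of_nonneg h2 hs, ENNReal.ofReal_eq_one] at h3
    rw [← h3]
    exact hs.hasSum

include hY in
lemma measurableSet_isValid : MeasurableSet {x | IsValid (Y x)} := by
  have hy : ∀ j, Measurable fun x => Y x j := fun j => (measurable_pi_apply j).comp hY
  simp only [isValid_iff]
  refine MeasurableSet.inter ?_ (MeasurableSet.inter ?_ ?_)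
  · exact measurableSet_setOfPred.2 (Measurable.forall fun i =>
      measurableSet_setOfPred.1 (measurableSet_le (hy (i + 1)) (hy i)))
  · exact measurableSet_setOfPred.2 (Measurable.forall fun i =>
      measurableSet_setOfPred.1 (measurableSet_le measurable_const (hy i)))
  · exact measurableSet_eq_fun (Measurable.tsum fun i => (hy i).ennreal_ofReal)
      measurable_const

include hY hZ in
lemma measurableSet_exceptional (ε : ℝ) {u v : α → ℝ} (hu : Measurable u) (hv : Measurable v) :
    MeasurableSet {x | Exceptional ε (Y x) (Z x) (u x, v x)} :=
  (measurableSet_stepBig hY hZ ε hu hv).compl.union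
    ((measurableSet_stepBig hZ hY ε hu hv).compl.union
      (measurableSet_lt (measurable_unmatchedCount (measurable_stepOne hY hZ hu hv)
        (measurable_stepOne hZ hY hu hv) ε) (measurable_unmatchedCount hY hZ ε)))

end Measurability

/-! ### One step of the law of the chain -/

/-- The pairs of configurations. -/
abbrev State : Type := Config × Config

/-- The law after one step, for the initial law `μ`. -/
def stepLaw (μ : Measure State) : Measure State :=
  (μ.prod unif2).map fun q => coupledStep q.1 q.2

/-- Both configurations are in the simplex. -/
def IsValidPair (p : State) : Prop := IsValid p.1 ∧ IsValid p.2

lemma measurableSet_isValidPair : MeasurableSet {p | IsValidPair p} :=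
  (measurableSet_isValid measurable_fst).inter (measurableSet_isValid measurable_snd)

section OneStep

variable (μ : Measure State)

lemma stepLaw_apply {A : Set State} (hA : MeasurableSet A) :
    stepLaw μ A = (μ.prod unif2) {q | coupledStep q.1 q.2 ∈ A} :=
  Measure.map_apply measurable_coupledStep hA

lemma measure_eq_prod {A : Set State} : μ A = (μ.prod unif2) {q | q.1 ∈ A} := by
  have : {q : State × (ℝ × ℝ) | q.1 ∈ A} = A ×ˢ Set.univ := by
    ext q
    simp
  rw [this, Measure.prod_prod, measure_univ, mul_one]

lemma lintegral_stepLaw {f : State → ℝ≥0∞} (hf : Measurable f) :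
    ∫⁻ p, f p ∂(stepLaw μ) = ∫⁻ q, f (coupledStep q.1 q.2) ∂(μ.prod unif2) :=
  lintegral_map hf measurable_coupledStep

lemma lintegral_eq_prod {f : State → ℝ≥0∞} (hf : Measurable f) :
    ∫⁻ p, f p ∂μ = ∫⁻ q, f q.1 ∂(μ.prod unif2) := by
  rw [← lintegral_map hf measurable_fst, measurePreserving_fst.map_eq]

lemma ae_prod (hμ : ∀ᵐ p ∂μ, IsValidPair p) :
    ∀ᵐ q ∂(μ.prod unif2), IsValidPair q.1 ∧ q.2 ∈ unitSquare :=
  (Measure.quasiMeasurePreserving_fst.ae hμ).and (Measure.quasiMeasurePreserving_snd.ae ae_unitSquare)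

lemma ae_isValidPair_stepLaw (hμ : ∀ᵐ p ∂μ, IsValidPair p) : ∀ᵐ p ∂(stepLaw μ), IsValidPair p := by
  unfold stepLaw
  rw [ae_map_iff measurable_coupledStep.aemeasurable measurableSet_isValidPair]
  filter_upwards [ae_prod μ hμ] with q ⟨⟨h1, h2⟩, ⟨hu, hu1⟩, hv, hv1⟩
  exact ⟨isValid_stepOne h1 hu hu1 hv hv1, isValid_stepOne h2 hu hu1 hv hv1⟩

/-- Expected mass of the small entries. -/
def dustMean (ε : ℝ) : ℝ≥0∞ := ∫⁻ p, ENNReal.ofReal (dust ε p.1 + dust ε p.2) ∂μ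

/-- Expected number of unmatched entries of size at least `ε`. -/
def countMean (ε : ℝ) : ℝ≥0∞ := ∫⁻ p, (unmatchedCount ε p.1 p.2 : ℝ≥0∞) ∂μ

/-- Probability of an exceptional step. -/
def excProb (ε : ℝ) : ℝ≥0∞ := (μ.prod unif2) {q | Exceptional ε q.1.1 q.1.2 q.2}

lemma measurable_dust_pair (ε : ℝ) :
    Measurable fun p : State => ENNReal.ofReal (dust ε p.1 + dust ε p.2) :=
  ((measurable_dust measurable_fst ε).add (measurable_dust measurable_snd ε)).ennreal_ofReal

lemma measurable_count_pair (ε : ℝ) :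
    Measurable fun p : State => (unmatchedCount ε p.1 p.2 : ℝ≥0∞) :=
  (measurable_from_nat (f := fun n : ℕ => (n : ℝ≥0∞))).comp
    (measurable_unmatchedCount measurable_fst measurable_snd ε)

lemma measurableSet_exceptional_pair (ε : ℝ) :
    MeasurableSet {q : State × (ℝ × ℝ) | Exceptional ε q.1.1 q.1.2 q.2} :=
  measurableSet_exceptional (Y := fun q : State × (ℝ × ℝ) => q.1.1) (Z := fun q => q.1.2)
    (by fun_prop) (by fun_prop) ε (u := fun q => q.2.1) (v := fun q => q.2.2) (by fun_prop) (by fun_prop)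

variable {ε : ℝ} (hε : 0 < ε) (hμ : ∀ᵐ p ∂μ, IsValidPair p)

include hε hμ in
lemma dustMean_stepLaw_le [IsProbabilityMeasure μ] : dustMean (stepLaw μ) ε ≤ dustMean μ ε + ENNReal.ofReal (4 * ε) := by
  unfold dustMean
  rw [lintegral_stepLaw μ (measurable_dust_pair ε), lintegral_eq_prod μ (measurable_dust_pair ε)]
  have : ENNReal.ofReal (4 * ε) = ∫⁻ _, ENNReal.ofReal (4 * ε) ∂(μ.prod unif2) := by simp
  rw [this, ← lintegral_add_right _ measurable_const]
  refine lintegral_mono_ae ?_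
  filter_upwards [ae_prod μ hμ] with q ⟨⟨h1, h2⟩, ⟨hu, hu1⟩, hv, hv1⟩
  rw [← ENNReal.ofReal_add (add_nonneg (dust_nonneg h1.nonneg ε) (dust_nonneg h2.nonneg ε))
    (by positivity)]
  refine ENNReal.ofReal_le_ofReal ?_
  have k1 := dust_stepOne_le (Z := q.1.2) h1 hε hu hu1 hv hv1
  have k2 := dust_stepOne_le (Z := q.1.1) h2 hε hu hu1 hv hv1
  simp only [coupledStep]
  linarith

/-- The step touches or creates a small entry. -/
def badSet (ε : ℝ) : Set (State × (ℝ × ℝ)) :=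
  {q | ¬ StepBig ε q.1.1 q.1.2 q.2.1 q.2.2 ∨ ¬ StepBig ε q.1.2 q.1.1 q.2.1 q.2.2}

lemma measurableSet_badSet (ε : ℝ) : MeasurableSet (badSet ε) :=
  (measurableSet_stepBig (Y := fun q : State × (ℝ × ℝ) => q.1.1) (Z := fun q => q.1.2)
    (by fun_prop) (by fun_prop) ε (u := fun q => q.2.1) (v := fun q => q.2.2) (by fun_prop)
    (by fun_prop)).compl.union
  (measurableSet_stepBig (Y := fun q : State × (ℝ × ℝ) => q.1.2) (Z := fun q => q.1.1)
    (by fun_prop) (by fun_prop) ε (u := fun q => q.2.1) (v := fun q => q.2.2) (by fun_prop)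
    (by fun_prop)).compl

include hε hμ in
lemma measure_badSet_le [IsProbabilityMeasure μ] :
    (μ.prod unif2) (badSet ε) ≤ 2 * dustMean μ ε + ENNReal.ofReal (4 * ε) := by
  rw [Measure.prod_apply (measurableSet_badSet ε)]
  unfold dustMean
  have : ENNReal.ofReal (4 * ε) = ∫⁻ _, ENNReal.ofReal (4 * ε) ∂μ := by simp
  rw [this, ← lintegral_const_mul _ (measurable_dust_pair ε), ← lintegral_add_right _ measurable_const]
  refine lintegral_mono_ae ?_
  filter_upwards [hμ] with p ⟨h1, h2⟩
  have d1 := dust_nonneg h1.nonneg ε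
  have d2 := dust_nonneg h2.nonneg ε
  have hae : (Prod.mk p ⁻¹' badSet ε : Set (ℝ × ℝ)) ≤ᵐ[unif2]
      ({w | w ∈ unitSquare ∧ ¬ StepBig ε p.1 p.2 w.1 w.2} ∪
        {w | w ∈ unitSquare ∧ ¬ StepBig ε p.2 p.1 w.1 w.2} : Set (ℝ × ℝ)) := by
    filter_upwards [ae_unitSquare] with w hw h
    rcases h with h | h
    · exact Or.inl ⟨hw, h⟩
    · exact Or.inr ⟨hw, h⟩
  refine (measure_mono_ae hae).trans ((measure_union_le _ _).trans ?_)
  refine (add_le_add (unif2_not_stepBig_le h1 hε) (unif2_not_stepBig_le h2 hε)).trans ?_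
  rw [← ENNReal.ofReal_add (by positivity) (by positivity), ← ENNReal.ofReal_ofNat 2,
    ← ENNReal.ofReal_mul (by norm_num), ← ENNReal.ofReal_add (by positivity) (by positivity)]
  exact ENNReal.ofReal_le_ofReal (by linarith)

include hε hμ in
-- The count acts as a potential. On a step outside `badSet` the new count plus the indicator of an
-- exceptional step is at most the old count. On a bad step the count grows by at most 8, and the
-- indicator brings the cost to 9.
lemma countMean_stepLaw_add_le [IsProbabilityMeasure μ] : countMean (stepLaw μ) ε + excProb μ ε
    ≤ countMean μ ε + 9 * (2 * dustMean μ ε + ENNReal.ofReal (4 * ε)) := by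
  refine le_trans ?_ (add_le_add le_rfl (mul_le_mul_right (measure_badSet_le μ hε hμ) 9))
  unfold countMean excProb
  rw [lintegral_stepLaw μ (measurable_count_pair ε), lintegral_eq_prod μ (measurable_count_pair ε),
    ← lintegral_indicator_one (measurableSet_exceptional_pair ε),
    ← lintegral_indicator_one (measurableSet_badSet ε),
    ← lintegral_const_mul _ (measurable_one.indicator (measurableSet_badSet ε)),
    ← lintegral_add_right _ (measurable_one.indicator (measurableSet_exceptional_pair ε)),
    ← lintegral_add_right _ ((measurable_one.indicator (measurableSet_badSet ε)).const_mul 9)]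
  refine lintegral_mono_ae ?_
  filter_upwards [ae_prod μ hμ] with q ⟨⟨h1, h2⟩, ⟨hu, hu1⟩, hv, hv1⟩
  have k1 := unmatchedCount_stepOne_le_add h1 h2 hu hu1 hv hv1 hε
  by_cases hbad : q ∈ badSet ε
  · rw [Set.indicator_of_mem hbad]
    have k2 : ({q | Exceptional ε q.1.1 q.1.2 q.2} : Set (State × (ℝ × ℝ))).indicator
        (1 : State × (ℝ × ℝ) → ℝ≥0∞) q ≤ 1 := Set.indicator_le_self' (fun _ _ => zero_le) q
    have k3 : (unmatchedCount ε (coupledStep q.1 q.2).1 (coupledStep q.1 q.2).2 : ℝ≥0∞)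
        ≤ unmatchedCount ε q.1.1 q.1.2 + 8 := by exact_mod_cast k1
    calc _ ≤ (unmatchedCount ε q.1.1 q.1.2 + 8 : ℝ≥0∞) + 1 := add_le_add k3 k2
      _ = _ := by
        rw [add_assoc]
        norm_num
  · rw [Set.indicator_of_notMem hbad, mul_zero, add_zero]
    have hb := hbad
    simp only [badSet, Set.mem_ofPred_eq, not_or, not_not] at hb
    have k2 := unmatchedCount_stepOne_le h1 h2 hu hu1 hv hv1 hε hb.1 hb.2
    by_cases hexc : Exceptional ε q.1.1 q.1.2 q.2
    · rw [Set.indicator_of_mem (by exact hexc)]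
      have k3 : unmatchedCount ε (coupledStep q.1 q.2).1 (coupledStep q.1 q.2).2
          < unmatchedCount ε q.1.1 q.1.2 := by
        rcases hexc with h | h | h
        · exact absurd hb.1 h
        · exact absurd hb.2 h
        · exact h
      have k4 : unmatchedCount ε (coupledStep q.1 q.2).1 (coupledStep q.1 q.2).2 + 1
          ≤ unmatchedCount ε q.1.1 q.1.2 := k3
      simp only [Pi.one_apply]
      exact_mod_cast k4
    · rw [Set.indicator_of_notMem (by exact hexc), add_zero]
      exact_mod_cast k2

lemma mul_le_prod {T : Set (State × (ℝ × ℝ))} (hT : MeasurableSet T) {A : Set State} {c : ℝ≥0∞}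
    (h : ∀ᵐ p ∂μ, p ∈ A → c ≤ unif2 (Prod.mk p ⁻¹' T)) : c * μ A ≤ (μ.prod unif2) T := by
  rw [Measure.prod_apply hT]
  refine le_trans ?_ (mul_meas_ge_le_lintegral (measurable_measure_prodMk_left hT) c)
  exact mul_le_mul_right (measure_mono_ae h) c

lemma prod_le_mul {T : Set (State × (ℝ × ℝ))} (hT : MeasurableSet T) {A : Set State} {c : ℝ≥0∞}
    (hA : MeasurableSet A) (h : ∀ᵐ p ∂μ, p ∈ A → unif2 (Prod.mk p ⁻¹' T) ≤ c)
    (h' : ∀ q ∈ T, q.1 ∈ A) : (μ.prod unif2) T ≤ c * μ A := by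
  rw [Measure.prod_apply hT, ← lintegral_indicator_const hA]
  refine lintegral_mono_ae ?_
  filter_upwards [h] with p hp
  by_cases hpA : p ∈ A
  · rw [Set.indicator_of_mem hpA]
    exact hp hpA
  · have : Prod.mk p ⁻¹' T = ∅ := by
      ext w
      simp only [Set.mem_preimage, Set.mem_empty_iff_false, iff_false]
      exact fun hw => hpA (h' _ hw)
    rw [this, measure_empty]
    exact zero_le

include hε hμ in
lemma spread_le_excProb {η : ℝ} (hη : 0 < η) :
    ENNReal.ofReal (η ^ 2) * μ {p | Spread η p.1 p.2} ≤ excProb μ ε := by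
  refine mul_le_prod μ (measurableSet_exceptional_pair ε) ?_
  filter_upwards [hμ] with p ⟨h1, h2⟩ hp
  exact le_unif2_exceptional_of_spread h1 h2 hε hη hp

lemma measurableSet_step {A : Set State} (hA : MeasurableSet A) :
    MeasurableSet {q : State × (ℝ × ℝ) | coupledStep q.1 q.2 ∈ A} := measurable_coupledStep hA

lemma measurableSet_spread_pair (η : ℝ) : MeasurableSet {p : State | Spread η p.1 p.2} :=
  measurableSet_spread measurable_fst measurable_snd η

include hε hμ in
lemma oneAgainstThree_le {η : ℝ} (hεη : ε ≤ η / 2) :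
    ENNReal.ofReal (η ^ 2 / 2) * μ {p | OneAgainstThree η p.1 p.2 ∨ OneAgainstThree η p.2 p.1}
      ≤ excProb μ ε + stepLaw μ {p | Spread (η / 2) p.1 p.2} := by
  rw [stepLaw_apply μ (measurableSet_spread_pair _)]
  refine le_trans ?_ (measure_union_le _ _)
  refine mul_le_prod μ ((measurableSet_exceptional_pair ε).union
    (measurableSet_step (measurableSet_spread_pair _))) ?_
  filter_upwards [hμ] with p ⟨h1, h2⟩ hp
  rcases hp with hp | hp
  · exact le_unif2_spread h1 h2 hε hεη hp
  · refine (le_unif2_spread h2 h1 hε hεη hp).trans (measure_mono_ae ?_)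
    filter_upwards [ae_unitSquare] with w ⟨⟨hu, hu1⟩, hv, hv1⟩ hw
    rcases hw with hw | hw
    · exact Or.inl (exceptional_comm.1 hw)
    · exact Or.inr ((spread_comm (isValid_stepOne h1 hu hu1 hv hv1)
        (isValid_stepOne h2 hu hu1 hv hv1)).2 hw)

/-- One of the configurations has an unmatched entry of size in `(s / 2, s)`. -/
def scaleSet (s : ℝ) : Set State := {p | HasScale s p.1 p.2 ∨ HasScale s p.2 p.1}

/-- One of the configurations has an unmatched entry larger than `ρ`. -/
def largeSet (ρ : ℝ) : Set State :=
  {p | (∃ i ∉ matched p.1 p.2, ρ < p.1 i) ∨ ∃ i ∉ matched p.2 p.1, ρ < p.2 i}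

lemma measurableSet_scaleSet (s : ℝ) : MeasurableSet (scaleSet s) :=
  (measurableSet_hasScale measurable_fst measurable_snd s).union
    (measurableSet_hasScale measurable_snd measurable_fst s)

lemma measurableSet_largeSet (ρ : ℝ) : MeasurableSet (largeSet ρ) :=
  (measurableSet_exists_unmatched measurable_fst measurable_snd ρ).union
    (measurableSet_exists_unmatched measurable_snd measurable_fst ρ)

include hε hμ in
lemma scaleSet_loss_le {s : ℝ} (hs : ε ≤ s / 2) :
    (μ.prod unif2) {q | q.1 ∈ scaleSet s ∧ ¬ Exceptional ε q.1.1 q.1.2 q.2 ∧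
      coupledStep q.1 q.2 ∉ scaleSet s} ≤ ENNReal.ofReal (2 * s) * μ (scaleSet s) := by
  refine prod_le_mul μ ((measurable_fst (measurableSet_scaleSet s)).inter
    ((measurableSet_exceptional_pair ε).compl.inter
      (measurableSet_step (measurableSet_scaleSet s)).compl)) (measurableSet_scaleSet s) ?_
      fun q hq => hq.1
  filter_upwards [hμ] with p ⟨h1, h2⟩ hp
  rcases hp with hp | hp
  · refine (measure_mono_ae ?_).trans (unif2_not_hasScale_le h1 h2 hε hs hp)
    filter_upwards [ae_unitSquare] with w hw h
    exact ⟨hw, h.2.1, fun h' => h.2.2 (Or.inl h')⟩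
  · refine (measure_mono_ae ?_).trans (unif2_not_hasScale_le h2 h1 hε hs hp)
    filter_upwards [ae_unitSquare] with w hw h
    exact ⟨hw, fun h' => h.2.1 (exceptional_comm.1 h'), fun h' => h.2.2 (Or.inr h')⟩

include hε hμ in
lemma scaleSet_gain_le {ρ s : ℝ} (hρ : 0 < ρ) (hs0 : 0 < s) (hs : s ≤ ρ) :
    ENNReal.ofReal (ρ * (s / 4)) * μ (largeSet ρ \ scaleSet s) ≤
    (μ.prod unif2) {q | q.1 ∈ (scaleSet s)ᶜ ∧ (Exceptional ε q.1.1 q.1.2 q.2 ∨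
      coupledStep q.1 q.2 ∈ scaleSet s)} := by
  refine mul_le_prod μ ((measurable_fst (measurableSet_scaleSet s).compl).inter
    ((measurableSet_exceptional_pair ε).union
      (measurableSet_step (measurableSet_scaleSet s)))) ?_
  filter_upwards [hμ] with p ⟨h1, h2⟩ hp
  obtain ⟨⟨i, hi, hρi⟩ | ⟨i, hi, hρi⟩, hps⟩ := hp
  · refine (le_unif2_hasScale h1 h2 hε hρ hs0 hs hi hρi).trans (measure_mono fun w hw => ⟨hps, ?_⟩)
    exact hw.imp id Or.inl
  · refine (le_unif2_hasScale h2 h1 hε hρ hs0 hs hi hρi).trans (measure_mono fun w hw => ⟨hps, ?_⟩)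
    exact hw.imp exceptional_comm.1 Or.inr

include hε hμ in
/-- Balance of the probability that there is an unmatched entry of scale `s`. -/
lemma scaleSet_balance {ρ s : ℝ} (hρ : 0 < ρ) (hs0 : 0 < s) (hs : s ≤ ρ) (hs' : ε ≤ s / 2) :
    μ (scaleSet s) + ENNReal.ofReal (ρ * (s / 4)) * μ (largeSet ρ \ scaleSet s)
      ≤ stepLaw μ (scaleSet s) + ENNReal.ofReal (2 * s) * μ (scaleSet s) + excProb μ ε := by
  have hE := measurableSet_scaleSet s
  have g1 := scaleSet_gain_le μ hε hμ hρ hs0 hs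
  have g2 := scaleSet_loss_le μ hε hμ hs'
  rw [stepLaw_apply μ hE, measure_eq_prod μ (A := scaleSet s)]
  set P := μ.prod unif2
  set S : Set (State × (ℝ × ℝ)) := {q | coupledStep q.1 q.2 ∈ scaleSet s}
  have hS : MeasurableSet S := measurableSet_step hE
  set A : Set (State × (ℝ × ℝ)) := {q | q.1 ∈ scaleSet s}
  have hA : MeasurableSet A := measurable_fst hE
  set X : Set (State × (ℝ × ℝ)) := {q | Exceptional ε q.1.1 q.1.2 q.2}
  have hX : MeasurableSet X := measurableSet_exceptional_pair ε
  -- Exceptional steps from inside and from outside the scale event are kept apart, so that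
  -- `excProb` is spent only once in the balance.
  have e1 : P A ≤ P (S ∩ A) + P ((A \ S) \ X) + P (X ∩ A) := by
    refine (measure_mono ?_).trans ((measure_union_le _ _).trans (add_le_add (measure_union_le _ _) le_rfl))
    intro q hq
    by_cases h1 : q ∈ S
    · exact Or.inl (Or.inl ⟨h1, hq⟩)
    · by_cases h2 : q ∈ X
      · exact Or.inr ⟨h2, hq⟩
      · exact Or.inl (Or.inr ⟨⟨hq, h1⟩, h2⟩)
  have e2 : P {q | q.1 ∈ (scaleSet s)ᶜ ∧ (Exceptional ε q.1.1 q.1.2 q.2 ∨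
      coupledStep q.1 q.2 ∈ scaleSet s)} ≤ P (S \ A) + P (X \ A) := by
    refine (measure_mono ?_).trans (measure_union_le _ _)
    rintro q ⟨h1, h2 | h2⟩
    · exact Or.inr ⟨h2, h1⟩
    · exact Or.inl ⟨h2, h1⟩
  have e3 : P ((A \ S) \ X) ≤ ENNReal.ofReal (2 * s) * P A := by
    rw [← measure_eq_prod μ (A := scaleSet s)]
    refine le_trans (measure_mono ?_) g2
    rintro q ⟨⟨h1, h2⟩, h3⟩
    exact ⟨h1, h3, h2⟩
  calc P A + ENNReal.ofReal (ρ * (s / 4)) * μ (largeSet ρ \ scaleSet s)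
      ≤ (P (S ∩ A) + ENNReal.ofReal (2 * s) * P A + P (X ∩ A)) + (P (S \ A) + P (X \ A)) :=
        add_le_add (e1.trans (by gcongr)) (g1.trans e2)
    _ = (P (S ∩ A) + P (S \ A)) + ENNReal.ofReal (2 * s) * P A + (P (X ∩ A) + P (X \ A)) := by abel
    _ = P S + ENNReal.ofReal (2 * s) * P A + P X := by
        rw [measure_inter_add_sdiff S hA, measure_inter_add_sdiff X hA]

end OneStep

/-! ### Moments of the Poisson–Dirichlet distribution -/

lemma one_sub_sum_stick (U : ℕ → ℝ) (n : ℕ) :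
    1 - ∑ i : Fin n, stick U i = ∏ i ∈ Finset.range n, (1 - U i) := by
  induction n with
  | zero => simp
  | succ n ih =>
    have h : stick U n = U n * (1 - ∑ i : Fin n, stick U i) := by rw [stick]
    rw [Fin.sum_univ_castSucc, Finset.prod_range_succ, ← ih]
    simp only [Fin.val_castSucc, Fin.val_last]
    rw [h]
    ring

lemma stick_eq (U : ℕ → ℝ) (n : ℕ) : stick U n = U n * ∏ i ∈ Finset.range n, (1 - U i) := by
  rw [stick, one_sub_sum_stick]

/-- The probability space of the stick breaking. -/
abbrev stickLaw : Measure (ℕ → ℝ) := Measure.infinitePi fun _ : ℕ => unif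

lemma ae_mem_Icc : ∀ᵐ U ∂stickLaw, ∀ i, U i ∈ Set.Icc (0 : ℝ) 1 := by
  rw [ae_all_iff]
  intro i
  have h : ∀ᵐ x ∂unif, x ∈ Set.Icc (0 : ℝ) 1 := ae_restrict_mem measurableSet_Icc
  exact (measurePreserving_eval_infinitePi (fun _ : ℕ => unif) i).quasiMeasurePreserving.ae h

/-- The mean 4/5 of (1 - U)^(1/4) makes the expected fourth roots of the remaining stick lengths a
geometric series with sum 5. -/
lemma lintegral_unif_rpow :
    ∫⁻ x, ENNReal.ofReal ((1 - x) ^ (1 / 4 : ℝ)) ∂unif = ENNReal.ofReal (4 / 5) := by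
  have hc : Continuous fun x : ℝ => (1 - x) ^ (1 / 4 : ℝ) :=
    (continuous_const.sub continuous_id).rpow_const fun _ => Or.inr (by norm_num)
  have hi : IntegrableOn (fun x : ℝ => (1 - x) ^ (1 / 4 : ℝ)) (Set.Icc 0 1) :=
    hc.continuousOn.integrableOn_Icc
  rw [unif, ← ofReal_integral_eq_lintegral_ofReal hi]
  · congr 1
    rw [integral_Icc_eq_integral_Ioc, ← intervalIntegral.integral_of_le zero_le_one,
      intervalIntegral.integral_comp_sub_left (fun x : ℝ => x ^ (1 / 4 : ℝ)),
      integral_rpow (Or.inl (by norm_num))]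
    norm_num
  · filter_upwards [ae_restrict_mem measurableSet_Icc] with x hx
    exact Real.rpow_nonneg (by linarith [hx.2]) _

lemma lintegral_prod_rpow (n : ℕ) : ∫⁻ U, ∏ i ∈ Finset.range n,
    ENNReal.ofReal ((1 - U i) ^ (1 / 4 : ℝ)) ∂stickLaw = ENNReal.ofReal (4 / 5) ^ n := by
  have hg : Measurable fun x : ℝ => ENNReal.ofReal ((1 - x) ^ (1 / 4 : ℝ)) := by fun_prop
  have hi := iIndepFun_infinitePi (P := fun _ : ℕ => unif)
    (X := fun _ x => ENNReal.ofReal ((1 - x) ^ (1 / 4 : ℝ))) (fun _ => hg)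
  rw [lintegral_prod_eq_prod_lintegral_of_indepFun _ _ hi fun i => hg.comp (measurable_pi_apply i)]
  have : ∀ i : ℕ, ∫⁻ U, ENNReal.ofReal ((1 - U i) ^ (1 / 4 : ℝ)) ∂stickLaw = ENNReal.ofReal (4 / 5) := by
    intro i
    rw [← lintegral_unif_rpow, ← Measure.infinitePi_map_eval (fun _ : ℕ => unif) i,
      lintegral_map hg (measurable_pi_apply i)]
  rw [Finset.prod_congr rfl fun i _ => this i, Finset.prod_const, Finset.card_range]

lemma lintegral_tsum_prod_rpow : ∫⁻ U, ∑' n, ∏ i ∈ Finset.range n,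
    ENNReal.ofReal ((1 - U i) ^ (1 / 4 : ℝ)) ∂stickLaw = 5 := by
  rw [lintegral_tsum]
  · simp only [lintegral_prod_rpow]
    rw [ENNReal.tsum_geometric, ← ENNReal.ofReal_one, ← ENNReal.ofReal_sub _ (by norm_num),
      ← ENNReal.ofReal_inv_of_pos (by norm_num)]
    norm_num
  · intro n
    exact (Finset.measurable_prod _ fun i _ => by fun_prop).aemeasurable

lemma prod_ofReal_rpow {U : ℕ → ℝ} (hU : ∀ i, U i ∈ Set.Icc (0 : ℝ) 1) (n : ℕ) :
    ∏ i ∈ Finset.range n, ENNReal.ofReal ((1 - U i) ^ (1 / 4 : ℝ))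
      = ENNReal.ofReal ((∏ i ∈ Finset.range n, (1 - U i)) ^ (1 / 4 : ℝ)) := by
  have h : ∀ i, 0 ≤ 1 - U i := fun i => by linarith [(hU i).2]
  rw [← ENNReal.ofReal_prod_of_nonneg fun i _ => Real.rpow_nonneg (h i) _,
    Real.finsetProd_rpow _ _ fun i _ => h i]

/-- The sum of the fourth roots of the entries. -/
def rootSum (Y : ℕ → ℝ) : ℝ≥0∞ := ∑' i, ENNReal.ofReal (Y i ^ (1 / 4 : ℝ))

lemma measurable_rootSum : Measurable rootSum :=
  Measurable.tsum fun i => by fun_prop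

lemma stick_nonneg {U : ℕ → ℝ} (hU : ∀ i, U i ∈ Set.Icc (0 : ℝ) 1) (n : ℕ) : 0 ≤ stick U n := by
  rw [stick_eq]
  exact mul_nonneg (hU n).1 (Finset.prod_nonneg fun i _ => by linarith [(hU i).2])

lemma rootSum_stick_le {U : ℕ → ℝ} (hU : ∀ i, U i ∈ Set.Icc (0 : ℝ) 1) :
    rootSum (stick U) ≤ ∑' n, ∏ i ∈ Finset.range n, ENNReal.ofReal ((1 - U i) ^ (1 / 4 : ℝ)) := by
  refine ENNReal.tsum_le_tsum fun n => ?_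
  rw [prod_ofReal_rpow hU]
  refine ENNReal.ofReal_le_ofReal (Real.rpow_le_rpow (stick_nonneg hU n) ?_ (by norm_num))
  rw [stick_eq]
  exact mul_le_of_le_one_left (Finset.prod_nonneg fun i _ => by linarith [(hU i).2]) (hU n).2

/-- The series of the fourth roots of the remaining lengths has finite mean. Almost surely its terms
tend to 0, so nothing of the stick is left in the limit. -/
lemma ae_hasSum_stick : ∀ᵐ U ∂stickLaw, HasSum (stick U) 1 := by
  have hfin : ∀ᵐ U ∂stickLaw, ∑' n, ∏ i ∈ Finset.range n,
      ENNReal.ofReal ((1 - U i) ^ (1 / 4 : ℝ)) < ∞ := by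
    refine ae_lt_top (Measurable.tsum fun n => Finset.measurable_prod _ fun i _ => by fun_prop) ?_
    rw [lintegral_tsum_prod_rpow]
    simp
  filter_upwards [hfin, ae_mem_Icc] with U h hU
  have h1 := ENNReal.tendsto_atTop_zero_of_tsum_ne_top h.ne
  simp only [prod_ofReal_rpow hU] at h1
  have hp : ∀ n, 0 ≤ ∏ i ∈ Finset.range n, (1 - U i) := fun n =>
    Finset.prod_nonneg fun i _ => by linarith [(hU i).2]
  have h2 := (ENNReal.tendsto_toReal ENNReal.zero_ne_top).comp h1
  have h3 : Filter.Tendsto (fun n => (∏ i ∈ Finset.range n, (1 - U i)) ^ (1 / 4 : ℝ)) Filter.atTop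
      (nhds 0) := by
    simpa [Function.comp_def, ENNReal.toReal_ofReal (Real.rpow_nonneg (hp _) _)] using h2
  have h4 : Filter.Tendsto (fun n => ∏ i ∈ Finset.range n, (1 - U i)) Filter.atTop (nhds 0) := by
    have := h3.pow 4
    simp only [← Real.rpow_mul_natCast (hp _)] at this
    simpa using this
  rw [hasSum_iff_tendsto_nat_of_nonneg (stick_nonneg hU)]
  have h5 := (tendsto_const_nhds (x := (1 : ℝ))).sub h4
  rw [sub_zero] at h5
  refine h5.congr fun n => ?_
  rw [← one_sub_sum_stick, Finset.sum_range]
  ring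

lemma measurable_sortDesc_stick : Measurable fun U : ℕ → ℝ => sortDesc (stick U) :=
  measurable_sortDesc.comp (measurable_pi_lambda _ measurable_stick)

lemma ae_isValid_PD1 : ∀ᵐ Y ∂PD1, IsValid Y := by
  unfold PD1
  have hm : MeasurableSet {Y : Config | IsValid Y} := measurableSet_isValid measurable_id
  rw [ae_map_iff measurable_sortDesc_stick.aemeasurable hm]
  filter_upwards [ae_hasSum_stick, ae_mem_Icc] with U h hU
  exact isValid_sortDesc (stick_nonneg hU) h

lemma rootSum_sortDesc {x : ℕ → ℝ} (h0 : ∀ i, 0 ≤ x i) (hs : Summable x) :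
    rootSum (sortDesc x) = rootSum x := by
  have hf : ∀ s : ℝ, 0 < s → {i | s ≤ x i}.Finite := fun _ h => finite_le_of_summable hs h
  exact (((sameEntries_sortDesc hf).hasSum_iff (finite_le_sortDesc hf) hf (sortDesc_nonneg h0) h0
    (G := fun t => ENNReal.ofReal (t ^ (1 / 4 : ℝ))) (by norm_num)).2 ENNReal.summable.hasSum).tsum_eq

lemma lintegral_rootSum_PD1_le : ∫⁻ Y, rootSum Y ∂PD1 ≤ 5 := by
  unfold PD1
  rw [lintegral_map measurable_rootSum measurable_sortDesc_stick, ← lintegral_tsum_prod_rpow]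
  refine lintegral_mono_ae ?_
  filter_upwards [ae_hasSum_stick, ae_mem_Icc] with U h hU
  rw [rootSum_sortDesc (stick_nonneg hU) h.summable]
  exact rootSum_stick_le hU

/-! ### Small mass and number of large entries in terms of the sum of fourth roots -/

section Bounds

variable {Y : Config} (hY : IsValid Y) {ε : ℝ} (hε : 0 < ε)

include hY hε in
-- Entrywise, y = y^(3/4) y^(1/4) ≤ ε^(3/4) y^(1/4) for y < ε.
lemma dust_le_rootSum : ENNReal.ofReal (dust ε Y) ≤ ENNReal.ofReal (ε ^ (3 / 4 : ℝ)) * rootSum Y := by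
  have hd := hasSum_dust hY.nonneg hY.hasSum.summable ε
  rw [← hd.tsum_eq, ENNReal.ofReal_tsum_of_nonneg _ hd.summable, rootSum, ← ENNReal.tsum_mul_left]
  · refine ENNReal.tsum_le_tsum fun i => ?_
    rw [← ENNReal.ofReal_mul (Real.rpow_nonneg hε.le _)]
    refine ENNReal.ofReal_le_ofReal ?_
    have h0 := hY.nonneg i
    split_ifs with h
    · calc Y i = Y i ^ (3 / 4 : ℝ) * Y i ^ (1 / 4 : ℝ) := by
            rw [← Real.rpow_add_of_nonneg h0 (by norm_num) (by norm_num)]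
            norm_num
        _ ≤ _ := by gcongr
    · exact mul_nonneg (Real.rpow_nonneg hε.le _) (Real.rpow_nonneg h0 _)
  · intro i
    split_ifs <;> simp [hY.nonneg]

include hY hε in
-- Entrywise, 1 ≤ (y/ε)^(1/4) for y ≥ ε.
lemma card_unmatchedBig_le_rootSum (Z : Config) : ((unmatchedBig ε Y Z).card : ℝ≥0∞)
    ≤ ENNReal.ofReal (ε ^ (-(1 / 4) : ℝ)) * rootSum Y := by
  classical
  have hfin : {i | i ∈ (matched Y Z)ᶜ ∧ ε ≤ Y i}.Finite := (hY.finite ε hε).subset fun i hi => hi.2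
  have h1 : ((unmatchedBig ε Y Z).card : ℝ≥0∞)
      = ∑' i, {i | i ∈ (matched Y Z)ᶜ ∧ ε ≤ Y i}.indicator (fun _ => (1 : ℝ≥0∞)) i := by
    rw [← tsum_subtype _ (fun _ => (1 : ℝ≥0∞)), ENNReal.tsum_set_one, unmatchedBig,
      card_bigPart_eq_ncard, ← hfin.cast_ncard_eq]
    simp
  rw [h1, rootSum, ← ENNReal.tsum_mul_left]
  refine ENNReal.tsum_le_tsum fun i => ?_
  rw [← ENNReal.ofReal_mul (Real.rpow_nonneg hε.le _)]
  by_cases hi : i ∈ {i | i ∈ (matched Y Z)ᶜ ∧ ε ≤ Y i}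
  · rw [Set.indicator_of_mem hi, ← ENNReal.ofReal_one]
    refine ENNReal.ofReal_le_ofReal ?_
    calc (1 : ℝ) = ε ^ (-(1 / 4) : ℝ) * ε ^ (1 / 4 : ℝ) := by
          rw [← Real.rpow_add hε]; norm_num
      _ ≤ _ := by
        have := hi.2
        gcongr
  · rw [Set.indicator_of_notMem hi]
    exact zero_le

end Bounds

/-! ### Bounds for the initial law -/

section Initial

variable {ν : Measure State} (h1 : ν.map Prod.fst = PD1) (h2 : ν.map Prod.snd = PD1)

include h1 h2 in
lemma ae_isValidPair_of_marginals : ∀ᵐ p ∂ν, IsValidPair p := by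
  have k1 : ∀ᵐ p ∂ν, IsValid p.1 := by
    have := ae_isValid_PD1
    rw [← h1] at this
    exact ae_of_ae_map measurable_fst.aemeasurable this
  have k2 : ∀ᵐ p ∂ν, IsValid p.2 := by
    have := ae_isValid_PD1
    rw [← h2] at this
    exact ae_of_ae_map measurable_snd.aemeasurable this
  exact k1.and k2

include h1 h2 in
lemma lintegral_rootSum_marginals_le : ∫⁻ p, (rootSum p.1 + rootSum p.2) ∂ν ≤ 10 := by
  have hm : Measurable fun p : State => rootSum p.1 := measurable_rootSum.comp measurable_fst
  rw [lintegral_add_left hm,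
    ← lintegral_map measurable_rootSum measurable_fst,
    ← lintegral_map measurable_rootSum measurable_snd, h1, h2]
  refine (add_le_add lintegral_rootSum_PD1_le lintegral_rootSum_PD1_le).trans ?_
  norm_num

lemma measurable_rootSum_pair : Measurable fun p : State => rootSum p.1 + rootSum p.2 :=
  (measurable_rootSum.comp measurable_fst).add (measurable_rootSum.comp measurable_snd)

include h1 h2 in
lemma dustMean_le {ε : ℝ} (hε : 0 < ε) : dustMean ν ε ≤ ENNReal.ofReal (10 * ε ^ (3 / 4 : ℝ)) := by
  calc dustMean ν ε ≤ ∫⁻ p, ENNReal.ofReal (ε ^ (3 / 4 : ℝ)) * (rootSum p.1 + rootSum p.2) ∂ν := by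
        refine lintegral_mono_ae ?_
        filter_upwards [ae_isValidPair_of_marginals h1 h2] with p hp
        rw [ENNReal.ofReal_add (dust_nonneg hp.1.nonneg ε) (dust_nonneg hp.2.nonneg ε), mul_add]
        exact add_le_add (dust_le_rootSum hp.1 hε) (dust_le_rootSum hp.2 hε)
    _ ≤ ENNReal.ofReal (ε ^ (3 / 4 : ℝ)) * 10 := by
        rw [lintegral_const_mul _ measurable_rootSum_pair]
        gcongr
        exact lintegral_rootSum_marginals_le h1 h2
    _ = _ := by
        rw [mul_comm 10, ENNReal.ofReal_mul (Real.rpow_nonneg hε.le _)]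
        norm_num

include h1 h2 in
lemma countMean_le {ε : ℝ} (hε : 0 < ε) :
    countMean ν ε ≤ ENNReal.ofReal (10 * ε ^ (-(1 / 4) : ℝ)) := by
  calc countMean ν ε ≤ ∫⁻ p, ENNReal.ofReal (ε ^ (-(1 / 4) : ℝ)) * (rootSum p.1 + rootSum p.2) ∂ν := by
        refine lintegral_mono_ae ?_
        filter_upwards [ae_isValidPair_of_marginals h1 h2] with p hp
        rw [unmatchedCount, Nat.cast_add, mul_add]
        exact add_le_add (card_unmatchedBig_le_rootSum hp.1 hε _)
          (card_unmatchedBig_le_rootSum hp.2 hε _)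
    _ ≤ ENNReal.ofReal (ε ^ (-(1 / 4) : ℝ)) * 10 := by
        rw [lintegral_const_mul _ measurable_rootSum_pair]
        gcongr
        exact lintegral_rootSum_marginals_le h1 h2
    _ = _ := by
        rw [mul_comm 10, ENNReal.ofReal_mul (Real.rpow_nonneg hε.le _)]
        norm_num

end Initial

/-! ### Summation along the chain -/

section Chain

variable {μ : ℕ → Measure State} [∀ t, IsProbabilityMeasure (μ t)]
  (hstep : ∀ t, μ (t + 1) = stepLaw (μ t))
  (h1 : (μ 0).map Prod.fst = PD1) (h2 : (μ 0).map Prod.snd = PD1)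

lemma excProb_ne_top (ε : ℝ) (t : ℕ) : excProb (μ t) ε ≠ ⊤ := measure_ne_top _ _

include hstep h1 h2

omit [∀ t, IsProbabilityMeasure (μ t)] in
lemma ae_isValidPair_chain (t : ℕ) : ∀ᵐ p ∂μ t, IsValidPair p := by
  induction t with
  | zero => exact ae_isValidPair_of_marginals h1 h2
  | succ t ih => rw [hstep]; exact ae_isValidPair_stepLaw _ ih

lemma dustMean_chain_le {ε : ℝ} (hε : 0 < ε) (t : ℕ) :
    dustMean (μ t) ε ≤ ENNReal.ofReal (10 * ε ^ (3 / 4 : ℝ) + 4 * ε * t) := by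
  induction t with
  | zero => simpa using dustMean_le h1 h2 hε
  | succ t ih =>
    rw [hstep]
    refine (dustMean_stepLaw_le _ hε (ae_isValidPair_chain hstep h1 h2 t)).trans ?_
    refine (add_le_add ih le_rfl).trans ?_
    rw [← ENNReal.ofReal_add (by positivity) (by positivity)]
    refine ENNReal.ofReal_le_ofReal ?_
    push_cast
    linarith

lemma countMean_chain_add_sum_le {ε : ℝ} (hε : 0 < ε) (n : ℕ) :
    countMean (μ n) ε + ∑ t ∈ Finset.range n, excProb (μ t) ε
      ≤ countMean (μ 0) ε
        + ∑ t ∈ Finset.range n, 9 * (2 * dustMean (μ t) ε + ENNReal.ofReal (4 * ε)) := by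
  induction n with
  | zero => simp
  | succ n ih =>
    rw [Finset.sum_range_succ, Finset.sum_range_succ, hstep]
    have h := countMean_stepLaw_add_le (μ n) hε (ae_isValidPair_chain hstep h1 h2 n)
    calc _ = (countMean (stepLaw (μ n)) ε + excProb (μ n) ε)
          + ∑ t ∈ Finset.range n, excProb (μ t) ε := by ring
      _ ≤ countMean (μ n) ε + 9 * (2 * dustMean (μ n) ε + ENNReal.ofReal (4 * ε))
          + ∑ t ∈ Finset.range n, excProb (μ t) ε := by gcongr
      _ = (countMean (μ n) ε + ∑ t ∈ Finset.range n, excProb (μ t) ε)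
          + 9 * (2 * dustMean (μ n) ε + ENNReal.ofReal (4 * ε)) := by ring
      _ ≤ _ := by
        rw [← add_assoc]
        gcongr

/-- For ε = T⁻² the initial count costs 10 ε^(-1/4) = 10 T^(1/2). The small mass is of order 1/T at
each of the T steps and costs only a constant. -/
lemma sum_excProb_le {T : ℕ} (hT : 1 ≤ T) :
    ∑ t ∈ Finset.range T, (excProb (μ t) ((T : ℝ) ^ (-2 : ℝ))).toReal
      ≤ 300 * (T : ℝ) ^ (1 / 2 : ℝ) := by
  have hT' : (1 : ℝ) ≤ T := by exact_mod_cast hT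
  have hT0 : (0 : ℝ) < T := by linarith
  set ε : ℝ := (T : ℝ) ^ (-2 : ℝ) with hεd
  have hε : 0 < ε := Real.rpow_pos_of_pos hT0 _
  have e1 : ε ≤ (T : ℝ)⁻¹ := by
    rw [hεd, ← Real.rpow_neg_one]
    exact Real.rpow_le_rpow_of_exponent_le hT' (by norm_num)
  have e1' : ε * T ≤ (T : ℝ)⁻¹ := by
    rw [hεd, ← Real.rpow_neg_one]
    nth_rw 2 [← Real.rpow_one (T : ℝ)]
    rw [← Real.rpow_add hT0]
    norm_num
  have e2 : ε ^ (3 / 4 : ℝ) ≤ (T : ℝ)⁻¹ := by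
    rw [hεd, ← Real.rpow_mul hT0.le, ← Real.rpow_neg_one]
    exact Real.rpow_le_rpow_of_exponent_le hT' (by norm_num)
  have e3 : ε ^ (-(1 / 4) : ℝ) = (T : ℝ) ^ (1 / 2 : ℝ) := by
    rw [hεd, ← Real.rpow_mul hT0.le]
    norm_num
  have key : ∑ t ∈ Finset.range T, excProb (μ t) ε
      ≤ ENNReal.ofReal (300 * (T : ℝ) ^ (1 / 2 : ℝ)) := by
    refine le_add_self.trans ((countMean_chain_add_sum_le hstep h1 h2 hε T).trans ?_)
    have hc := countMean_le h1 h2 hε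
    rw [e3] at hc
    -- The mean small mass is at most (10 + 4)/T, and 288 = 9 (2 · 14 + 4).
    have hd : ∀ t ∈ Finset.range T, 9 * (2 * dustMean (μ t) ε + ENNReal.ofReal (4 * ε))
        ≤ ENNReal.ofReal (288 * (T : ℝ)⁻¹) := by
      intro t ht
      have ht' : (t : ℝ) ≤ T := by exact_mod_cast (Finset.mem_range.1 ht).le
      have hdt : dustMean (μ t) ε ≤ ENNReal.ofReal (14 * (T : ℝ)⁻¹) := by
        refine (dustMean_chain_le hstep h1 h2 hε t).trans (ENNReal.ofReal_le_ofReal ?_)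
        have : ε * t ≤ ε * T := by gcongr
        linarith
      calc 9 * (2 * dustMean (μ t) ε + ENNReal.ofReal (4 * ε))
          ≤ 9 * (2 * ENNReal.ofReal (14 * (T : ℝ)⁻¹) + ENNReal.ofReal (4 * (T : ℝ)⁻¹)) := by
            gcongr
        _ = ENNReal.ofReal (288 * (T : ℝ)⁻¹) := by
            have h9 : (9 : ENNReal) = ENNReal.ofReal 9 := by simp
            have h2 : (2 : ENNReal) = ENNReal.ofReal 2 := by simp
            rw [h9, h2, ← ENNReal.ofReal_mul (by norm_num),
              ← ENNReal.ofReal_add (by positivity) (by positivity),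
              ← ENNReal.ofReal_mul (by norm_num)]
            congr 1
            ring
    refine (add_le_add hc (Finset.sum_le_sum hd)).trans ?_
    rw [Finset.sum_const, Finset.card_range, nsmul_eq_mul, ← ENNReal.ofReal_natCast,
      ← ENNReal.ofReal_mul (by positivity), ← ENNReal.ofReal_add (by positivity) (by positivity)]
    refine ENNReal.ofReal_le_ofReal ?_
    have h5 : (1 : ℝ) ≤ (T : ℝ) ^ (1 / 2 : ℝ) := Real.one_le_rpow hT' (by norm_num)
    have h6 : (T : ℝ) * (288 * (T : ℝ)⁻¹) = 288 := by field_simp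
    rw [h6]
    linarith
  rw [← ENNReal.toReal_sum fun t _ => excProb_ne_top ε t]
  exact ENNReal.toReal_le_of_le_ofReal (by positivity) key

variable {ε : ℝ} (hε : 0 < ε)

include hε

lemma spread_chain_le {η : ℝ} (hη : 0 < η) (t : ℕ) :
    η ^ 2 * (μ t).real {p | Spread η p.1 p.2} ≤ (excProb (μ t) ε).toReal := by
  have h := ENNReal.toReal_mono (excProb_ne_top ε t)
    (spread_le_excProb (μ t) hε (ae_isValidPair_chain hstep h1 h2 t) hη)
  rwa [ENNReal.toReal_mul, ENNReal.toReal_ofReal (by positivity)] at h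

lemma oneAgainstThree_chain_le {η : ℝ} (hη : ε ≤ η / 2) (t : ℕ) :
    η ^ 2 / 2 * (μ t).real {p | OneAgainstThree η p.1 p.2 ∨ OneAgainstThree η p.2 p.1}
      ≤ (excProb (μ t) ε).toReal + (μ (t + 1)).real {p | Spread (η / 2) p.1 p.2} := by
  have h := oneAgainstThree_le (μ t) hε (ae_isValidPair_chain hstep h1 h2 t) hη
  rw [← hstep t] at h
  have h := ENNReal.toReal_mono (ENNReal.add_ne_top.2 ⟨measure_ne_top _ _, measure_ne_top _ _⟩) h
  rwa [ENNReal.toReal_mul, ENNReal.toReal_ofReal (by positivity),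
    ENNReal.toReal_add (measure_ne_top _ _) (measure_ne_top _ _)] at h

lemma scaleSet_chain_le {ρ s : ℝ} (hρ : 0 < ρ) (hs0 : 0 < s) (hs : s ≤ ρ) (hs' : ε ≤ s / 2)
    (t : ℕ) : ρ * (s / 4) * ((μ t).real (largeSet ρ) - (μ t).real (scaleSet s))
      ≤ (μ (t + 1)).real (scaleSet s) - (μ t).real (scaleSet s)
        + 2 * s * (μ t).real (scaleSet s) + (excProb (μ t) ε).toReal := by
  have h := scaleSet_balance (μ t) hε (ae_isValidPair_chain hstep h1 h2 t) hρ hs0 hs hs'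
  rw [← hstep t] at h
  have hf : ∀ (m : Measure State) [IsProbabilityMeasure m] (A : Set State) (c : ℝ),
      ENNReal.ofReal c * m A ≠ ⊤ := fun m _ A c =>
    ENNReal.mul_ne_top ENNReal.ofReal_ne_top (measure_ne_top _ _)
  have he : excProb (μ t) ε ≠ ⊤ := excProb_ne_top ε t
  have h := ENNReal.toReal_mono
    (ENNReal.add_ne_top.2 ⟨ENNReal.add_ne_top.2 ⟨measure_ne_top _ _, hf _ _ _⟩, he⟩) h
  rw [ENNReal.toReal_add (measure_ne_top _ _) (hf _ _ _),
    ENNReal.toReal_add (ENNReal.add_ne_top.2 ⟨measure_ne_top _ _, hf _ _ _⟩) he,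
    ENNReal.toReal_add (measure_ne_top _ _) (hf _ _ _), ENNReal.toReal_mul, ENNReal.toReal_mul,
    ENNReal.toReal_ofReal (by positivity), ENNReal.toReal_ofReal (by positivity)] at h
  have hd : (μ t).real (largeSet ρ) - (μ t).real (scaleSet s)
      ≤ (μ t).real (largeSet ρ \ scaleSet s) := le_measureReal_sdiff
  have := mul_le_mul_of_nonneg_left hd (show 0 ≤ ρ * (s / 4) by positivity)
  simp only [measureReal_def] at this ⊢
  linarith

omit hε

/-- The left side is at most the expected number of occupied scales, both sides taken together: at
most 3 outside the rare states and trivially at most `K` on them. -/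
lemma sum_scaleSet_le {ρ : ℝ} {η : ℝ} {K : ℕ} (hρ : 0 < ρ) (hη : η = ρ / 2 ^ K) (t : ℕ) :
    ∑ k ∈ Finset.range K, (μ t).real (scaleSet (ρ / 2 ^ k))
      ≤ 3 + K * ((μ t).real {p | Spread η p.1 p.2}
        + (μ t).real {p | OneAgainstThree η p.1 p.2 ∨ OneAgainstThree η p.2 p.1}) := by
  set B : Set State := {p | Spread η p.1 p.2}
    ∪ {p | OneAgainstThree η p.1 p.2 ∨ OneAgainstThree η p.2 p.1} with hB
  have hpt : ∀ᵐ p ∂μ t, ∑ k ∈ Finset.range K, (scaleSet (ρ / 2 ^ k)).indicator 1 p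
      ≤ 3 + B.indicator (fun _ => (K : ENNReal)) p := by
    filter_upwards [ae_isValidPair_chain hstep h1 h2 t] with p hp
    classical
    have hsum : ∑ k ∈ Finset.range K, (scaleSet (ρ / 2 ^ k)).indicator (1 : State → ENNReal) p
        = (((Finset.range K).filter fun k => p ∈ scaleSet (ρ / 2 ^ k)).card : ENNReal) := by
      simp [Set.indicator_apply]
    rw [hsum]
    by_cases hpB : p ∈ B
    · rw [Set.indicator_of_mem hpB]
      refine le_add_left ?_
      exact_mod_cast (Finset.card_filter_le _ _).trans (Finset.card_range K).le
    · have hcard : (scales (fun k => ρ / 2 ^ k) K p.1 p.2).card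
          + (scales (fun k => ρ / 2 ^ k) K p.2 p.1).card ≤ 3 := by
        simp only [hB, Set.mem_union, Set.mem_ofPred_eq, not_or] at hpB
        refine card_scales_add_le_three hp.1 hp.2 ?_ ?_ hpB.1 hpB.2.1 hpB.2.2
        · intro k l hkl
          have : (2 : ℝ) ^ (k + 1) ≤ 2 ^ l := pow_le_pow_right₀ (by norm_num) hkl
          rw [div_div, ← pow_succ]
          gcongr
        · intro k hk
          have : (2 : ℝ) ^ (k + 1) ≤ 2 ^ K := pow_le_pow_right₀ (by norm_num) hk
          rw [hη, div_div, ← pow_succ]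
          gcongr
      refine le_add_right ?_
      refine le_trans ?_ (Nat.cast_le.2 hcard)
      rw [Nat.cast_le]
      refine le_trans (Finset.card_le_card ?_) (Finset.card_union_le _ _)
      intro k hk
      rw [Finset.mem_filter, Finset.mem_range] at hk
      rw [Finset.mem_union, mem_scales, mem_scales]
      exact hk.2.imp (fun h => ⟨hk.1, h⟩) fun h => ⟨hk.1, h⟩
  have hI : ∑ k ∈ Finset.range K, μ t (scaleSet (ρ / 2 ^ k)) ≤ 3 + K * μ t B := by
    calc ∑ k ∈ Finset.range K, μ t (scaleSet (ρ / 2 ^ k))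
        = ∫⁻ p, ∑ k ∈ Finset.range K, (scaleSet (ρ / 2 ^ k)).indicator 1 p ∂μ t := by
          rw [lintegral_finsetSum _ fun k _ =>
            measurable_one.indicator (measurableSet_scaleSet _)]
          exact Finset.sum_congr rfl fun k _ =>
            (lintegral_indicator_one (measurableSet_scaleSet _)).symm
      _ ≤ ∫⁻ p, 3 + B.indicator (fun _ => (K : ENNReal)) p ∂μ t := lintegral_mono_ae hpt
      _ ≤ 3 + K * μ t B := by
          rw [lintegral_add_left measurable_const, lintegral_const, measure_univ, mul_one]
          gcongr
          exact lintegral_indicator_const_le _ _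
  have hf : (K : ENNReal) * μ t B ≠ ⊤ :=
    ENNReal.mul_ne_top (ENNReal.natCast_ne_top _) (measure_ne_top _ _)
  have hI := ENNReal.toReal_mono (ENNReal.add_ne_top.2 ⟨by simp, hf⟩) hI
  rw [ENNReal.toReal_sum fun k _ => measure_ne_top _ _, ENNReal.toReal_add (by simp) hf,
    ENNReal.toReal_mul, ENNReal.toReal_natCast] at hI
  refine hI.trans ?_
  have hu : (μ t B).toReal ≤ _ := measureReal_union_le (μ := μ t) _ _
  rw [show (3 : ENNReal).toReal = 3 by simp]
  gcongr

end Chain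

/-! ### Time averages and the choice of the scales -/

section Average

variable {μ : ℕ → Measure State} [∀ t, IsProbabilityMeasure (μ t)]
  (hstep : ∀ t, μ (t + 1) = stepLaw (μ t))
  (h1 : (μ 0).map Prod.fst = PD1) (h2 : (μ 0).map Prod.snd = PD1)

include hstep h1 h2

variable {ε : ℝ} (hε : 0 < ε) (T : ℕ)

/-- The expected number of exceptional steps before time `T`. -/
def totalExc (μ : ℕ → Measure State) (ε : ℝ) (T : ℕ) : ℝ :=
  ∑ t ∈ Finset.range T, (excProb (μ t) ε).toReal

omit [∀ t, IsProbabilityMeasure (μ t)] hstep h1 h2 in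
lemma totalExc_nonneg : 0 ≤ totalExc μ ε T := Finset.sum_nonneg fun _ _ => ENNReal.toReal_nonneg

include hε

lemma sum_spread_le {η : ℝ} (hη : 0 < η) :
    ∑ t ∈ Finset.range T, (μ t).real {p | Spread η p.1 p.2} ≤ (η ^ 2)⁻¹ * totalExc μ ε T := by
  rw [le_inv_mul_iff₀ (by positivity), totalExc, Finset.mul_sum]
  exact Finset.sum_le_sum fun t _ => spread_chain_le hstep h1 h2 hε hη t

lemma sum_oneAgainstThree_le {η : ℝ} (hη : ε ≤ η / 2) :
    ∑ t ∈ Finset.range T,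
        (μ t).real {p | OneAgainstThree η p.1 p.2 ∨ OneAgainstThree η p.2 p.1}
      ≤ (η ^ 2)⁻¹ * (2 * (totalExc μ ε T + 4 * (η ^ 2)⁻¹ * totalExc μ ε T + 1)) := by
  have hη0 : 0 < η := by linarith
  rw [le_inv_mul_iff₀ (by positivity)]
  have ha := Finset.sum_le_sum fun t (_ : t ∈ Finset.range T) =>
    oneAgainstThree_chain_le hstep h1 h2 hε hη t
  rw [← Finset.mul_sum, Finset.sum_add_distrib] at ha
  have hb := sum_spread_le hstep h1 h2 hε T (half_pos hη0)
  -- Shifting the time by one changes the sum only by its boundary terms.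
  have hc : ∑ t ∈ Finset.range T, (μ (t + 1)).real {p | Spread (η / 2) p.1 p.2}
      ≤ ∑ t ∈ Finset.range T, (μ t).real {p | Spread (η / 2) p.1 p.2} + 1 := by
    have hd := Finset.sum_range_succ (fun t => (μ t).real {p | Spread (η / 2) p.1 p.2}) T
    rw [Finset.sum_range_succ'] at hd
    have h0 : 0 ≤ (μ 0).real {p | Spread (η / 2) p.1 p.2} := measureReal_nonneg
    have h3 : (μ T).real {p | Spread (η / 2) p.1 p.2} ≤ 1 := measureReal_le_one
    linarith
  have he : ((η / 2) ^ 2)⁻¹ = 4 * (η ^ 2)⁻¹ := by field_simp; norm_num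
  rw [he] at hb
  rw [← totalExc] at ha
  linarith

/-- Summing the balance over time telescopes the probability of the scale event to at most 1. After
division by `s` its coefficient no longer depends on the scale. -/
lemma sum_largeSet_le_sum_scaleSet {ρ s : ℝ} (hρ : 0 < ρ) (hρ1 : ρ ≤ 1) (hs0 : 0 < s)
    (hs : s ≤ ρ) (hs' : ε ≤ s / 2) :
    ρ / 4 * ∑ t ∈ Finset.range T, (μ t).real (largeSet ρ)
      ≤ s⁻¹ * (1 + totalExc μ ε T)
        + 9 / 4 * ∑ t ∈ Finset.range T, (μ t).real (scaleSet s) := by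
  have ha := Finset.sum_le_sum fun t (_ : t ∈ Finset.range T) =>
    scaleSet_chain_le hstep h1 h2 hε hρ hs0 hs hs' t
  rw [← Finset.mul_sum, Finset.sum_sub_distrib, Finset.sum_add_distrib, Finset.sum_add_distrib,
    Finset.sum_range_sub (fun t => (μ t).real (scaleSet s)), ← Finset.mul_sum, ← totalExc] at ha
  have h0 : 0 ≤ (μ 0).real (scaleSet s) := measureReal_nonneg
  have h3 : (μ T).real (scaleSet s) ≤ 1 := measureReal_le_one
  have hE : 0 ≤ ∑ t ∈ Finset.range T, (μ t).real (scaleSet s) :=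
    Finset.sum_nonneg fun _ _ => measureReal_nonneg
  set E := ∑ t ∈ Finset.range T, (μ t).real (scaleSet s)
  set R := ∑ t ∈ Finset.range T, (μ t).real (largeSet ρ)
  -- 9/4 collects the loss rate 2 and ρ/4 ≤ 1/4, the latter from bounding the difference event below
  -- by a difference of probabilities.
  have hb : s * (ρ / 4 * R) ≤ (1 + totalExc μ ε T) + s * (9 / 4 * E) := by
    have : s * ρ * E ≤ s * 1 * E := by gcongr
    nlinarith
  have hc := mul_le_mul_of_nonneg_left hb (inv_nonneg.2 hs0.le)
  rwa [inv_mul_cancel_left₀ hs0.ne', mul_add, inv_mul_cancel_left₀ hs0.ne'] at hc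

/-- Summed over `k < K`, the left side gains a factor `K`, while the main term on the right stays of
order `T`, since only three scales are typically occupied. -/
lemma sum_largeSet_le {ρ : ℝ} {K : ℕ} (hρ : 0 < ρ) (hρ1 : ρ ≤ 1) {η : ℝ} (hη : η = ρ / 2 ^ K)
    (hεη : ε ≤ η / 2) :
    K * (ρ / 4) * ∑ t ∈ Finset.range T, (μ t).real (largeSet ρ)
      ≤ K * (η⁻¹ * (1 + totalExc μ ε T))
        + 9 / 4 * (3 * T + K * ((η ^ 2)⁻¹ * totalExc μ ε T
          + (η ^ 2)⁻¹ * (2 * (totalExc μ ε T + 4 * (η ^ 2)⁻¹ * totalExc μ ε T + 1)))) := by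
  have hη0 : 0 < η := by rw [hη]; positivity
  have he := totalExc_nonneg (μ := μ) (ε := ε) T
  have hk : ∀ k ∈ Finset.range K, ρ / 4 * ∑ t ∈ Finset.range T, (μ t).real (largeSet ρ)
      ≤ η⁻¹ * (1 + totalExc μ ε T)
        + 9 / 4 * ∑ t ∈ Finset.range T, (μ t).real (scaleSet (ρ / 2 ^ k)) := by
    intro k hk
    have hsη : η ≤ ρ / 2 ^ k := by
      rw [hη]
      have : (2 : ℝ) ^ k ≤ 2 ^ K :=
        pow_le_pow_right₀ (by norm_num) (Finset.mem_range.1 hk).le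
      gcongr
    refine (sum_largeSet_le_sum_scaleSet hstep h1 h2 hε T (s := ρ / 2 ^ k) hρ hρ1
      (by positivity) (div_le_self hρ.le (one_le_pow₀ (by norm_num))) (by linarith)).trans ?_
    gcongr
  have hs := Finset.sum_le_sum hk
  rw [Finset.sum_const, Finset.card_range, nsmul_eq_mul, Finset.sum_add_distrib,
    Finset.sum_const, Finset.card_range, nsmul_eq_mul, ← Finset.mul_sum, Finset.sum_comm,
    ← mul_assoc] at hs
  refine hs.trans ?_
  gcongr
  refine (Finset.sum_le_sum fun t _ => sum_scaleSet_le hstep h1 h2 hρ hη t).trans ?_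
  rw [Finset.sum_add_distrib, Finset.sum_const, Finset.card_range, nsmul_eq_mul, mul_comm (T : ℝ),
    ← Finset.mul_sum, Finset.sum_add_distrib]
  gcongr
  · exact sum_spread_le hstep h1 h2 hε T hη0
  · exact sum_oneAgainstThree_le hstep h1 h2 hε T hεη

omit hε in
lemma sum_largeSet_le_div_log (hT : 1 ≤ T) {ρ : ℝ} (hρ : 0 < ρ) (hρ1 : ρ ≤ 1)
    (hlog : 80 ≤ ρ * Real.log T) :
    ∑ t ∈ Finset.range T, (μ t).real (largeSet ρ)
      ≤ 3000000 * T * (ρ * Real.log T)⁻¹ := by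
  have hT' : (1 : ℝ) ≤ T := by exact_mod_cast hT
  have hT0 : (0 : ℝ) < T := by linarith
  -- All error terms are compared with X = T^(1/40). `K` of order log T with 2^K ≤ X gives η ≥ X⁻²,
  -- and `totalExc` is at most 300 X²⁰. The worst term is then of order X²⁹, below T = X⁴⁰.
  set l := Real.log T with hl
  have hl80 : 80 ≤ l := by nlinarith
  set X := Real.exp (l / 40) with hX
  have hXT : X ^ 40 = T := by
    rw [hX, ← Real.exp_nat_mul, hl]
    push_cast
    rw [mul_div_cancel₀ _ (by norm_num : (40 : ℝ) ≠ 0), Real.exp_log hT0]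
  have hX2 : 2 ≤ X := by
    have := Real.add_one_le_exp (l / 40)
    linarith
  have hlX : l ≤ 40 * X := by
    have := Real.add_one_le_exp (l / 40)
    linarith
  have hX1 : 1 ≤ X := by linarith
  have hX0 : 0 < X := by linarith
  -- As l/40 ≥ 2, taking the integer part loses at most a factor 2.
  obtain ⟨K, hK1, hK2⟩ : ∃ K : ℕ, (K : ℝ) ≤ l / 40 ∧ l / 80 ≤ K := by
    refine ⟨⌊l / 40⌋₊, Nat.floor_le (by linarith), ?_⟩
    have := Nat.lt_floor_add_one (l / 40)
    linarith
  have h2K : (2 : ℝ) ^ K ≤ X := by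
    calc (2 : ℝ) ^ K ≤ Real.exp 1 ^ K := by
          have := Real.add_one_le_exp (1 : ℝ)
          gcongr
          linarith
      _ = Real.exp K := by rw [← Real.exp_nat_mul, mul_one]
      _ ≤ X := Real.exp_le_exp.2 hK1
  have hKX : (K : ℝ) ≤ X := by
    have : (K : ℝ) < 2 ^ K := by exact_mod_cast K.lt_two_pow_self
    linarith
  have hρX : 1 ≤ ρ * X := by nlinarith
  set η := ρ / 2 ^ K with hη
  have hη0 : 0 < η := by positivity
  have hηX : 1 ≤ η * X ^ 2 := by
    rw [hη, div_mul_eq_mul_div, le_div_iff₀ (by positivity)]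
    nlinarith
  have hηi : η⁻¹ ≤ X ^ 2 := by
    rw [inv_le_iff_one_le_mul₀ hη0]
    linarith
  have hηi2 : (η ^ 2)⁻¹ ≤ X ^ 4 := by
    rw [← inv_pow]
    calc η⁻¹ ^ 2 ≤ (X ^ 2) ^ 2 := by gcongr
      _ = X ^ 4 := by ring
  set ε : ℝ := (T : ℝ) ^ (-2 : ℝ) with hεd
  have hε : 0 < ε := Real.rpow_pos_of_pos hT0 _
  have hεX : ε = (X ^ 80)⁻¹ := by
    rw [hεd, Real.rpow_neg hT0.le, ← hXT]
    norm_num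
    rw [← pow_mul]
  have hεη : ε ≤ η / 2 := by
    rw [hεX, inv_le_iff_one_le_mul₀ (by positivity)]
    have : 2 * X ^ 2 ≤ X ^ 80 := by
      calc 2 * X ^ 2 ≤ X * X ^ 2 := by gcongr
        _ = X ^ 3 := by ring
        _ ≤ X ^ 80 := pow_le_pow_right₀ hX1 (by norm_num)
    nlinarith
  have he0 := totalExc_nonneg (μ := μ) (ε := ε) T
  have he : totalExc μ ε T ≤ 300 * X ^ 20 := by
    refine (sum_excProb_le hstep h1 h2 hT).trans (le_of_eq ?_)
    congr 1
    rw [← Real.sqrt_eq_rpow, ← hXT, show X ^ 40 = (X ^ 20) ^ 2 by ring,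
      Real.sqrt_sq (by positivity)]
  have hmain := sum_largeSet_le hstep h1 h2 hε T hρ hρ1 hη hεη
  set e := totalExc μ ε T
  set R := ∑ t ∈ Finset.range T, (μ t).real (largeSet ρ)
  have hR : 0 ≤ R := Finset.sum_nonneg fun _ _ => measureReal_nonneg
  have hp : ∀ n ≤ 40, X ^ n ≤ T := fun n hn => hXT ▸ pow_le_pow_right₀ hX1 hn
  have hb1 : K * (η⁻¹ * (1 + e)) ≤ 301 * T := by
    calc K * (η⁻¹ * (1 + e)) ≤ X * (X ^ 2 * (1 + 300 * X ^ 20)) := by gcongr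
      _ = X ^ 3 + 300 * X ^ 23 := by ring
      _ ≤ T + 300 * T := by gcongr <;> exact hp _ (by norm_num)
      _ = 301 * T := by ring
  have hb2 : K * ((η ^ 2)⁻¹ * e + (η ^ 2)⁻¹ * (2 * (e + 4 * (η ^ 2)⁻¹ * e + 1))) ≤ 3302 * T := by
    calc K * ((η ^ 2)⁻¹ * e + (η ^ 2)⁻¹ * (2 * (e + 4 * (η ^ 2)⁻¹ * e + 1)))
        ≤ X * (X ^ 4 * (300 * X ^ 20)
          + X ^ 4 * (2 * (300 * X ^ 20 + 4 * X ^ 4 * (300 * X ^ 20) + 1))) := by gcongr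
      _ = 900 * X ^ 25 + 2400 * X ^ 29 + 2 * X ^ 5 := by ring
      _ ≤ 900 * T + 2400 * T + 2 * T := by gcongr <;> exact hp _ (by norm_num)
      _ = 3302 * T := by ring
  -- 301 + (9/4)(3 + 3302) is below 9000; the final constant comes from 80 · 4 · 9000 ≤ 3000000.
  have hfin : l / 80 * (ρ / 4) * R ≤ 9000 * T := by
    calc l / 80 * (ρ / 4) * R ≤ K * (ρ / 4) * R := by gcongr
      _ ≤ 9000 * T := by linarith
  rw [le_mul_inv_iff₀ (by linarith)]
  linarith

end Average

/-! ### The chain at a random time -/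

section RandomTime

variable {Ω : Type*} [MeasurableSpace Ω] {μ : Measure Ω} [IsProbabilityMeasure μ]

lemma couplingKernel_apply {A : Set State} (hA : MeasurableSet A) (p : State) :
    couplingKernel p A = unif2 {w | coupledStep p w ∈ A} :=
  Measure.map_apply (measurable_coupledStep.comp measurable_prodMk_left) hA

lemma stepLaw_apply_eq_lintegral (m : Measure State) {A : Set State} (hA : MeasurableSet A) :
    stepLaw m A = ∫⁻ p, couplingKernel p A ∂m := by
  rw [stepLaw_apply m hA]
  refine (Measure.prod_apply (measurable_coupledStep hA)).trans (lintegral_congr fun p => ?_)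
  rw [couplingKernel_apply hA]
  rfl

lemma couplingKernel_le_one {A : Set State} (hA : MeasurableSet A) (p : State) :
    couplingKernel p A ≤ 1 := by
  rw [couplingKernel_apply hA]
  exact prob_le_one

/-- Integrating the conditional transition probability gives the recursion for the one-time laws. -/
lemma IsMarkovChain.map_succ {X : ℕ → Ω → State} (h : IsMarkovChain couplingKernel X μ) (t : ℕ) :
    μ.map (X (t + 1)) = stepLaw (μ.map (X t)) := by
  ext A hA
  have hle : (⨆ s : Fin (t + 1), MeasurableSpace.comap (X s) inferInstance) ≤ ‹MeasurableSpace Ω› :=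
    iSup_le fun s => (h.measurable s).comap_le
  have hpre := h.measurable (t + 1) hA
  have hi : ∫ ω, (couplingKernel (X t ω)).real A ∂μ = μ.real (X (t + 1) ⁻¹' A) := by
    rw [← integral_congr_ae (h.transition t A hA), integral_condExp hle,
      integral_indicator_const _ hpre, smul_eq_mul, mul_one]
  have hm : Measurable fun p => couplingKernel p A := Kernel.measurable_coe _ hA
  rw [stepLaw_apply_eq_lintegral _ hA, lintegral_map hm (h.measurable t),
    Measure.map_apply (h.measurable _) hA, ← ofReal_measureReal, ← hi,
    ofReal_integral_eq_lintegral_ofReal]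
  · refine lintegral_congr fun ω => ?_
    exact ENNReal.ofReal_toReal (ne_top_of_le_ne_top ENNReal.one_ne_top (couplingKernel_le_one hA _))
  · refine Integrable.of_bound
      (hm.comp (h.measurable t)).ennreal_toReal.aestronglyMeasurable 1 (ae_of_all _ fun ω => ?_)
    rw [Real.norm_of_nonneg measureReal_nonneg]
    exact ENNReal.toReal_le_of_le_ofReal zero_le_one
      (by simpa using couplingKernel_le_one hA (X t ω))
  · exact ae_of_all _ fun ω => measureReal_nonneg

/-- The supremum of the empty set is 0 by convention, which `0 < ρ` excludes. -/
lemma exists_of_lt_largestUnmatched {Y Z : Config} {ρ : ℝ} (hρ : 0 < ρ)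
    (h : ρ < largestUnmatched Y Z) : ∃ i ∉ matched Y Z, ρ < Y i := by
  have hne : (Y '' (matched Y Z)ᶜ).Nonempty := by
    rw [Set.nonempty_iff_ne_empty]
    intro h0
    rw [largestUnmatched, h0, Real.sSup_empty] at h
    linarith
  obtain ⟨_, ⟨i, hi, rfl⟩, hlt⟩ := exists_lt_of_lt_csSup hne h
  exact ⟨i, hi, hlt⟩

lemma mem_largeSet_of_lt_max {p : State} {ρ : ℝ} (hρ : 0 < ρ)
    (h : ρ < max (largestUnmatched p.1 p.2) (largestUnmatched p.2 p.1)) : p ∈ largeSet ρ :=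
  (lt_max_iff.1 h).imp (exists_of_lt_largestUnmatched hρ) (exists_of_lt_largestUnmatched hρ)

lemma measure_largeSet_eq_zero {m : Measure State} (hm : ∀ᵐ p ∂m, IsValidPair p) {ρ : ℝ}
    (hρ : 1 ≤ ρ) : m (largeSet ρ) = 0 := by
  refine measure_mono_null ?_ (ae_iff.1 hm)
  rintro p hp hv
  rcases hp with ⟨i, -, hi⟩ | ⟨i, -, hi⟩
  · linarith [le_hasSum hv.1.hasSum i fun j _ => hv.1.nonneg j]
  · linarith [le_hasSum hv.2.hasSum i fun j _ => hv.2.nonneg j]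

/-- A uniform time independent of the process: the probability at the random time is at most the
average over the times. -/
lemma measureReal_random_time_le {E : Type*} [MeasurableSpace E] {X : ℕ → Ω → E}
    (hX : ∀ t, Measurable (X t)) {q : Ω → ℕ} (hq : Measurable q) {T : ℕ} (hT : 0 < T)
    (hu : ∀ k < T, μ.real {ω | q ω = k} = 1 / (T : ℝ)) (hi : IndepFun q (fun ω t => X t ω) μ)
    {A : Set E} (hA : MeasurableSet A) :
    μ.real {ω | X (q ω) ω ∈ A} ≤ (T : ℝ)⁻¹ * ∑ t ∈ Finset.range T, (μ.map (X t)).real A := by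
  have hT0 : (0 : ℝ) < T := by exact_mod_cast hT
  have hmq : ∀ k : ℕ, MeasurableSet {ω | q ω = k} := fun k => hq (measurableSet_singleton k)
  -- The T prescribed values 1/T already add up to one, so `q` is almost surely below `T`.
  have hlt : μ.real {ω | q ω < T} = 1 := by
    have : {ω | q ω < T} = ⋃ k ∈ Finset.range T, {ω | q ω = k} := by
      ext ω
      simp
    rw [this, measureReal_biUnion_finset _ fun k _ => hmq k]
    · rw [Finset.sum_congr rfl fun k hk => hu k (Finset.mem_range.1 hk)]
      simp [hT0.ne']
    · intro a _ b _ hab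
      rw [Function.onFun, Set.disjoint_left]
      rintro ω rfl hb
      exact hab hb
  have hge : μ.real {ω | q ω < T}ᶜ = 0 := by
    rw [probReal_compl_eq_one_sub (show MeasurableSet {ω | q ω < T} from hq measurableSet_Iio), hlt,
      sub_self]
  have hterm : ∀ t ∈ Finset.range T, μ.real ({ω | q ω = t} ∩ X t ⁻¹' A)
      = (T : ℝ)⁻¹ * (μ.map (X t)).real A := by
    intro t ht
    have h := hi.measure_inter_preimage_eq_mul {t} ((fun x : ℕ → E => x t) ⁻¹' A)
      (measurableSet_singleton t) (measurable_pi_apply t hA)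
    rw [map_measureReal_apply (hX t) hA, ← one_div, ← hu t (Finset.mem_range.1 ht),
      measureReal_def, measureReal_def, measureReal_def, ← ENNReal.toReal_mul]
    exact congrArg ENNReal.toReal h
  calc μ.real {ω | X (q ω) ω ∈ A}
      ≤ μ.real ((⋃ t ∈ Finset.range T, {ω | q ω = t} ∩ X t ⁻¹' A) ∪ {ω | q ω < T}ᶜ) := by
        refine measureReal_mono fun ω hω => ?_
        by_cases h : q ω < T
        · refine Or.inl ?_
          simp only [Set.mem_iUnion]
          exact ⟨q ω, Finset.mem_range.2 h, rfl, hω⟩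
        · exact Or.inr h
    _ ≤ ∑ t ∈ Finset.range T, μ.real ({ω | q ω = t} ∩ X t ⁻¹' A) + 0 := by
        rw [← hge]
        exact (measureReal_union_le _ _).trans
          (add_le_add (measureReal_biUnion_finset_le _ _) le_rfl)
    _ = _ := by rw [add_zero, Finset.sum_congr rfl hterm, Finset.mul_sum]

end RandomTime

end CoagFrag

end

/-! ### The theorem -/

theorem mainTheorem3 :
    ∃ C : ℝ, 0 < C ∧
      ∀ {Ω : Type*} [MeasurableSpace Ω] (μ : MeasureTheory.Measure Ω)
        [MeasureTheory.IsProbabilityMeasure μ]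
        (Y Z : ℕ → Ω → CoagFrag.Config) (q : Ω → ℕ) (t₀ : ℕ) (ρ : ℝ),
        -- initial states: independent samples from `PD(1)`
        μ.map (Y 0) = CoagFrag.PD1 →
        μ.map (Z 0) = CoagFrag.PD1 →
        ProbabilityTheory.IndepFun (Y 0) (Z 0) μ →
        -- evolution under the coupling kernel
        CoagFrag.IsMarkovChain CoagFrag.couplingKernel (fun t ω => (Y t ω, Z t ω)) μ →
        -- `q` is uniform in `{0, …, t₀ - 1}` and independent of the chain
        2 ≤ t₀ →
        Measurable q →
        (∀ k < t₀, μ.real {ω | q ω = k} = 1 / (t₀ : ℝ)) →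
        ProbabilityTheory.IndepFun q (fun ω t => (Y t ω, Z t ω)) μ →
        0 < ρ →
        μ.real {ω | ρ < max (CoagFrag.largestUnmatched (Y (q ω) ω) (Z (q ω) ω))
            (CoagFrag.largestUnmatched (Z (q ω) ω) (Y (q ω) ω))}
          ≤ C * ρ⁻¹ * (Real.log t₀)⁻¹ := by
  refine ⟨3000000, by norm_num, ?_⟩
  intro Ω _ μ _ Y Z q T ρ hY hZ _ hchain hT hq hu hi hρ
  have hX := hchain.measurable
  have hT0 : (0 : ℝ) < T := by exact_mod_cast (by omega : 0 < T)
  have hlog : 0 < Real.log T := Real.log_pos (by exact_mod_cast (by omega : 1 < T))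
  rw [mul_assoc, ← mul_inv]
  -- In this range the claimed bound exceeds 1 and there is nothing to prove.
  by_cases hsmall : ρ * Real.log T < 80
  · refine measureReal_le_one.trans ?_
    rw [← div_eq_mul_inv, le_div_iff₀ (by positivity)]
    linarith
  push Not at hsmall
  set X : ℕ → Ω → CoagFrag.State := fun t ω => (Y t ω, Z t ω) with hXd
  have hprob : ∀ t, IsProbabilityMeasure (μ.map (X t)) := fun t =>
    Measure.isProbabilityMeasure_map (hX t).aemeasurable
  have hstep : ∀ t, μ.map (X (t + 1)) = CoagFrag.stepLaw (μ.map (X t)) := hchain.map_succ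
  have h1 : (μ.map (X 0)).map Prod.fst = CoagFrag.PD1 := by
    rw [Measure.map_map measurable_fst (hX 0)]
    exact hY
  have h2 : (μ.map (X 0)).map Prod.snd = CoagFrag.PD1 := by
    rw [Measure.map_map measurable_snd (hX 0)]
    exact hZ
  have hbound : ∑ t ∈ Finset.range T, (μ.map (X t)).real (CoagFrag.largeSet ρ)
      ≤ 3000000 * T * (ρ * Real.log T)⁻¹ := by
    -- The averaging argument needs ρ ≤ 1; no entry of a configuration of total mass one exceeds a
    -- larger ρ.
    rcases le_total ρ 1 with hρ1 | hρ1
    · exact CoagFrag.sum_largeSet_le_div_log (μ := fun t => μ.map (X t)) hstep h1 h2 T (by omega)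
        hρ hρ1 hsmall
    · rw [Finset.sum_eq_zero fun t _ => by
        rw [measureReal_def, CoagFrag.measure_largeSet_eq_zero
          (CoagFrag.ae_isValidPair_chain (μ := fun t => μ.map (X t)) hstep h1 h2 t) hρ1,
          ENNReal.toReal_zero]]
      positivity
  calc _ ≤ μ.real {ω | X (q ω) ω ∈ CoagFrag.largeSet ρ} :=
        measureReal_mono fun ω hω => CoagFrag.mem_largeSet_of_lt_max (p := X (q ω) ω) hρ hω
    _ ≤ (T : ℝ)⁻¹ * ∑ t ∈ Finset.range T, (μ.map (X t)).real (CoagFrag.largeSet ρ) :=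
        CoagFrag.measureReal_random_time_le hX hq (by omega) hu hi
          (CoagFrag.measurableSet_largeSet ρ)
    _ ≤ (T : ℝ)⁻¹ * (3000000 * T * (ρ * Real.log T)⁻¹) := by gcongr
    _ = _ := by field_simp
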